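/- **Setting.** Let $R=[x_0-\tfrac12,\,x_0+a-\tfrac12]\times[y_0-\tfrac12,\,y_0+b-\tfrac12]$ with $x_0,y_0\in\mathbb Z$ and integers $a,b\ge 1$. Let $n\ge\max\{a,b\}$ sensors be placed at integer points of $R$ (several sensors may share a point). The sensing area of a sensor is the closed disc of radius $\tfrac12$ around its position. A list of $n$ positions in the plane is *blocking* if every line that is perpendicular to a coordinate axis and meets $R$ meets the sensing area of some sensor. The MinNum-WCR problem asks for a blocking list of (arbitrary real) positions that differs from the initial one for as few sensors as possible. The first coordinate of an integer point is its row and the second one its column. The rows of $R$ are the integers $x_0,\dots,x_0+a-1$, and its columns are $y_0,\dots,y_0+b-1$. A *row (column) gap* is a row (column) of $R$ that contains no sensor; let $r$ and $c$ be the numbers of row and column gaps of the initial configuration. A sensor is *free* if there is another sensor in its row and another sensor in its column. A *free set* is a set of free sensors that can all be removed at the same time without creating new row or column gaps; a *maximum free set* $M$ is a free set of largest size, and $k=|M|$. A sensor is of *type 1* if exactly one of its row and its column contains another sensor. **Algorithm 1** (stated for $r\ge c$; if $c>r$, exchange the roles of rows and columns). Choose a maximum free set $M$. Then move sensors one after the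 other. Each move puts one sensor on an integer point and covers the named gaps, each of which has to be a gap at that moment. A sensor of $M$ is moved at most once. In the moves of type 1 sensors, only sensors outside $M$ are moved, and types are those that the sensors outside $M$ have at that moment after removal of all sensors of $M$. - If $k\ge r$: $c$ sensors of $M$ jump to crossings of row gaps with column gaps, covering the first (lowest-numbered) $c$ row gaps and all column gaps; then $r-c$ further sensors of $M$ slide inside their columns to cover the remaining row gaps. - If $c\le k<r$: $c$ sensors of $M$ jump as before; then the other $k-c$ sensors of $M$ are moved to points of $R$ in $k-c$ further row gaps; then, $r-k$ times, a type 1 sensor that is alone in its column slides inside this column to cover a row gap. - If $k<c$: the $k$ sensors of $M$ jump to crossings of row gaps with column gaps; then, $(c-k)+(r-k)$ times, a type 1 sensor that is alone in its column slides inside this column to cover a row gap, or a type 1 sensor that is alone in its row slides inside this row to cover a column gap. **Theorem.** 1. Whichever choices are made, Algorithm 1 never gets stuck: each prescribed move is possible when its turn comes. When it ends, the sensors are at integer points of $R$, their positions are blocking, and they solve the MinNum-WCR problem. The number of sensors that were moved is $\max\{r,c\}$ if $k\ge\min\{r,c\}$, and $r+c-k$ if $k<\min\{r,c\}$. 2.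 Algorithm 1 can be carried out in time $O(n^{3/2})$: there are a constant $C$ and one program for a random access machine with uniform cost (integer registers and memory cells; assignment of constants, addition, subtraction, indirect memory access, and tests for positivity, each costing one step) that, for all $n$ and all inputs as above, given as the list of the sensor coordinates together with $n$, $x_0,a,y_0,b$, halts after at most $C\,n^{3/2}$ steps with final positions that are a possible outcome of Algorithm 1. -/

import Mathlib

/-! ### Sensors, configurations and weak barrier coverage -/

/-- An axis-parallel rectangle in the plane; the index `d : Fin 2` selects the axis. -/
structure Rect where
  lo : Fin 2 → ℝ
  hi : Fin 2 → ℝ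
  lo_lt_hi : ∀ d, lo d < hi d

/-- The closed rectangle as a set of points of the Euclidean plane. -/
def Rect.carrier (R : Rect) : Set (EuclideanSpace ℝ (Fin 2)) :=
  {z | ∀ d, R.lo d ≤ z d ∧ z d ≤ R.hi d}

/-- A rectangle together with `n` sensors, each with a sensing range and a position. -/
structure Configuration (n : ℕ) where
  rect : Rect
  range : Fin n → ℝ
  pos : Fin n → EuclideanSpace ℝ (Fin 2)

namespace Configuration

variable {n : ℕ}

/-- The sensing area of a sensor: the closed disc around its position. -/
def sensingArea (C : Configuration n) (k : Fin n) : Set (EuclideanSpace ℝ (Fin 2)) :=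
  Metric.closedBall (C.pos k) (C.range k)

/-- Every line perpendicular to one of the two axes that meets the rectangle
meets the sensing area of some sensor. -/
def IsBlocking (C : Configuration n) : Prop :=
  ∀ (d : Fin 2) (t : ℝ), ({z | z d = t} ∩ C.rect.carrier).Nonempty →
    ∃ k, ({z | z d = t} ∩ C.sensingArea k).Nonempty

/-- The standing assumptions on an initial configuration: the sensors lie in the rectangle, and
the sum of their diameters is at least the longer side. -/
def Admissible (C : Configuration n) : Prop :=
  (∀ k, C.pos k ∈ C.rect.carrier) ∧
    ∀ d, C.rect.hi d - C.rect.lo d ≤ ∑ k, 2 * C.range k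

/-- The same rectangle and the same sensors, at new positions. -/
def relocate (C : Configuration n) (q : Fin n → EuclideanSpace ℝ (Fin 2)) : Configuration n :=
  { C with pos := q }

/-- The number of sensors that have to be moved to reach the positions `q`. -/
noncomputable def numMoved (C : Configuration n) (q : Fin n → EuclideanSpace ℝ (Fin 2)) : ℕ :=
  {k | dist (C.pos k) (q k) ≠ 0}.ncard

/-- `q` is a solution of the MinNum-WCR problem: a blocking configuration that relocates as few
sensors as possible, among all blocking configurations with arbitrary real positions. -/
def SolvesMinNum (C : Configuration n) (q : Fin n → EuclideanSpace ℝ (Fin 2)) : Prop :=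
  (C.relocate q).IsBlocking ∧ ∀ q', (C.relocate q').IsBlocking → C.numMoved q ≤ C.numMoved q'

end Configuration

/-! ### Integer configurations with sensor ranges 1/2 and a rectangle displaced by 1/2 -/

/-- An integer configuration. The rectangle is the product over the axes `d` of the intervals
`[lo d - 1/2, lo d + side d - 1/2]`. The first coordinate (`d = 0`) of a position is its row, the
second one (`d = 1`) its column; the rows and columns that matter are the integers `i` with
`lo d ≤ i < lo d + side d`. Several sensors may share a position. -/
structure IntConfig (n : ℕ) where
  lo : Fin 2 → ℤ
  side : Fin 2 → ℕ
  side_pos : ∀ d, 0 < side d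
  pos : Fin n → Fin 2 → ℤ

/-- The integer point `p`, as a point of the Euclidean plane. -/
noncomputable def gridPoint (p : Fin 2 → ℤ) : EuclideanSpace ℝ (Fin 2) :=
  WithLp.toLp 2 fun d => (p d : ℝ)

namespace IntConfig

variable {n : ℕ}

/-- The configuration in the plane described by `I`; all sensing ranges are `1/2`. -/
noncomputable def toConfiguration (I : IntConfig n) : Configuration n where
  rect :=
    { lo := fun d => (I.lo d : ℝ) - 1 / 2
      hi := fun d => (I.lo d : ℝ) + (I.side d : ℝ) - 1 / 2
      lo_lt_hi := fun d => by
        have h : (0 : ℝ) < (I.side d : ℝ) := Nat.cast_pos.mpr (I.side_pos d)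
        linarith }
  range := fun _ => 1 / 2
  pos := fun k => gridPoint (I.pos k)

/-- The rows (`d = 0`), respectively columns (`d = 1`), of the rectangle. -/
noncomputable def lines (I : IntConfig n) (d : Fin 2) : Finset ℤ :=
  Finset.Ico (I.lo d) (I.lo d + (I.side d : ℤ))

/-- The rows, respectively columns, that contain no sensor of `S`, when the sensors are at the
positions `p`. -/
noncomputable def gapsAt (I : IntConfig n) (p : Fin n → Fin 2 → ℤ) (S : Finset (Fin n)) (d : Fin 2) :
    Finset ℤ :=
  (I.lines d).filter fun i => ∀ k ∈ S, p k d ≠ i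

/-- The row gaps (`d = 0`), respectively column gaps (`d = 1`), of the initial configuration. -/
noncomputable def gaps (I : IntConfig n) (d : Fin 2) : Finset ℤ :=
  I.gapsAt I.pos Finset.univ d

/-- A sensor is free if there is another sensor in its row and another sensor in its column. -/
def IsFree (I : IntConfig n) (k : Fin n) : Prop :=
  ∀ d, ∃ l, l ≠ k ∧ I.pos l d = I.pos k d

/-- A set of free sensors that can all be removed at the same time without creating new gaps. -/
def IsFreeSet (I : IntConfig n) (M : Finset (Fin n)) : Prop :=
  (∀ k ∈ M, I.IsFree k) ∧ ∀ d, I.gapsAt I.pos Mᶜ d = I.gaps d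

/-- A maximum free set: a free set of largest cardinality. -/
def IsMaxFreeSet (I : IntConfig n) (M : Finset (Fin n)) : Prop :=
  I.IsFreeSet M ∧ ∀ M', I.IsFreeSet M' → M'.card ≤ M.card

end IntConfig

/-- With the sensors at positions `p` and all sensors outside `S` removed, sensor `k` is of type 1
with company along `f`: some other sensor of `S` has the same `f`-coordinate, and no other sensor
of `S` has the same coordinate on the other axis. For `f = 0` there is another sensor in its row
and none in its column; for `f = 1` it is the other way round. -/
def IsTypeOne {n : ℕ} (p : Fin n → Fin 2 → ℤ) (S : Finset (Fin n)) (f : Fin 2) (k : Fin n) :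
    Prop :=
  k ∈ S ∧ (∃ l ∈ S, l ≠ k ∧ p l f = p k f) ∧ ∀ l ∈ S, l ≠ k → p l f.rev ≠ p k f.rev

/-! ### Algorithm 1

The algorithm leaves several choices open (the maximum free set `M`, which sensor goes to which
gap), so it is given as a nondeterministic procedure: a schedule of moves, together with the
relation that says which moves are legal. The axis `d` is one with at least as many gaps as the
other axis `d.rev`; `d = 0` is the case "`r ≥ c`", and `d = 1` is the same with rows and columns
exchanged. -/

namespace AlgorithmOne

/-- The kinds of moves. `jumpFirst`, `jump`, `freeSlide` and `freeMove` move a sensor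
of `M` that has not been used yet; the other two move a sensor of type 1. -/
inductive MoveKind where
  | jumpFirst
  | jump
  | freeSlide
  | freeMove
  | slideMajor
  | slideAny

/-- The state of the algorithm: current positions, and the sensors of `M` not used so far. -/
structure State (n : ℕ) where
  pos : Fin n → Fin 2 → ℤ
  unused : Finset (Fin n)

variable {n : ℕ}

/-- The current gaps along an axis. -/
noncomputable def State.gaps (s : State n) (I : IntConfig n) (f : Fin 2) : Finset ℤ :=
  I.gapsAt s.pos Finset.univ f

/-- Put sensor `k` at the point `q`. -/
def State.place (s : State n) (k : Fin n) (q : Fin 2 → ℤ) : State n where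
  pos := Function.update s.pos k q
  unused := s.unused.erase k

/-- Slide sensor `k`: its `f`-coordinate becomes `i`, its other coordinate stays as it is. -/
def State.slide (s : State n) (k : Fin n) (f : Fin 2) (i : ℤ) : State n :=
  s.place k (Function.update (s.pos k) f i)

/-- The legal moves. Types of sensors are always those after removal of the sensors of `M`. -/
inductive Move (I : IntConfig n) (M : Finset (Fin n)) (d : Fin 2) :
    MoveKind → State n → State n → Prop
  /-- An unused sensor of `M` jumps to the crossing of the first gap along `d` with a gap along
  the other axis. -/
  | jumpFirst (s : State n) (k : Fin n) (q : Fin 2 → ℤ) (hk : k ∈ s.unused)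
      (hfirst : IsLeast (s.gaps I d : Set ℤ) (q d)) (hq : q d.rev ∈ s.gaps I d.rev) :
      Move I M d .jumpFirst s (s.place k q)
  /-- An unused sensor of `M` jumps to the crossing of a row gap and a column gap. -/
  | jump (s : State n) (k : Fin n) (q : Fin 2 → ℤ) (hk : k ∈ s.unused)
      (hq : ∀ f, q f ∈ s.gaps I f) :
      Move I M d .jump s (s.place k q)
  /-- An unused sensor of `M` slides into a gap along `d`. -/
  | freeSlide (s : State n) (k : Fin n) (i : ℤ) (hk : k ∈ s.unused) (hi : i ∈ s.gaps I d) :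
      Move I M d .freeSlide s (s.slide k d i)
  /-- An unused sensor of `M` moves to any grid point of the rectangle in a gap along `d`. -/
  | freeMove (s : State n) (k : Fin n) (q : Fin 2 → ℤ) (hk : k ∈ s.unused)
      (hq : q d ∈ s.gaps I d) (hin : q d.rev ∈ I.lines d.rev) :
      Move I M d .freeMove s (s.place k q)
  /-- A sensor of type 1 with company along `d` slides into a gap along `d`. -/
  | slideMajor (s : State n) (k : Fin n) (i : ℤ) (hk : IsTypeOne s.pos Mᶜ d k)
      (hi : i ∈ s.gaps I d) :
      Move I M d .slideMajor s (s.slide k d i)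
  /-- A sensor of type 1 with company along an axis `f` slides into a gap along `f`. -/
  | slideAny (s : State n) (k : Fin n) (f : Fin 2) (i : ℤ) (hk : IsTypeOne s.pos Mᶜ f k)
      (hi : i ∈ s.gaps I f) :
      Move I M d .slideAny s (s.slide k f i)

/-- The moves made by the algorithm in its three cases, in their order: `r` and `c` are the
numbers of gaps along `d` and along the other axis (`c ≤ r`), `k` is the size of `M`. -/
def schedule (r c k : ℕ) : List MoveKind :=
  if r ≤ k then
    List.replicate c .jumpFirst ++ List.replicate (r - c) .freeSlide
  else if c ≤ k then
    List.replicate c .jumpFirst ++ List.replicate (k - c) .freeMove ++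
      List.replicate (r - k) .slideMajor
  else
    List.replicate k .jump ++ List.replicate ((c - k) + (r - k)) .slideAny

/-- The schedule on the configuration `I`. -/
noncomputable def plan (I : IntConfig n) (M : Finset (Fin n)) (d : Fin 2) : List MoveKind :=
  schedule (I.gaps d).card (I.gaps d.rev).card M.card

/-- The initial state. -/
def start (I : IntConfig n) (M : Finset (Fin n)) : State n where
  pos := I.pos
  unused := M

/-- Legal moves of the listed kinds, one after the other, lead from `s` to `s'`. -/
def Run (I : IntConfig n) (M : Finset (Fin n)) (d : Fin 2) :
    List MoveKind → State n → State n → Prop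
  | [], s, s' => s = s'
  | a :: l, s, s' => ∃ u, Move I M d a s u ∧ Run I M d l u s'

/-- `M` and `d` are legitimate initial choices of the algorithm. -/
def Choice (I : IntConfig n) (M : Finset (Fin n)) (d : Fin 2) : Prop :=
  I.IsMaxFreeSet M ∧ (I.gaps d.rev).card ≤ (I.gaps d).card

/-- `p` is a possible list of final positions of the algorithm on the input `I`. -/
def IsOutput (I : IntConfig n) (p : Fin n → Fin 2 → ℤ) : Prop :=
  ∃ M d s, Choice I M d ∧ Run I M d (plan I M d) (start I M) s ∧ s.pos = p

end AlgorithmOne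

/-! ### Random access machines with uniform cost

The only arithmetic is addition and subtraction; control flow is structured. -/

namespace RAM

/-- Programs. The arguments `x y z` are names of registers. -/
inductive Program where
  | const (x : ℕ) (v : ℤ)
  | add (x y z : ℕ)
  | sub (x y z : ℕ)
  | load (x y : ℕ)
  | store (x y : ℕ)
  | seq (P Q : Program)
  | ifPos (x : ℕ) (P Q : Program)
  | whilePos (x : ℕ) (P : Program)

/-- A state of the machine: registers and memory cells, all holding integers. -/
structure State where
  reg : ℕ → ℤ
  mem : ℕ → ℤ

/-- Assign a value to a register. -/
def State.setReg (σ : State) (x : ℕ) (v : ℤ) : State :=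
  { σ with reg := Function.update σ.reg x v }

/-- Assign a value to a memory cell. -/
def State.setMem (σ : State) (a : ℕ) (v : ℤ) : State :=
  { σ with mem := Function.update σ.mem a v }

/-- `Exec P σ σ' t`: started in `σ`, the program `P` halts in `σ'` after `t` steps. Every
assignment, memory access and test is one step. An access to a negative address gets stuck. -/
inductive Exec : Program → State → State → ℕ → Prop
  | const (x : ℕ) (v : ℤ) (σ : State) : Exec (.const x v) σ (σ.setReg x v) 1
  | add (x y z : ℕ) (σ : State) : Exec (.add x y z) σ (σ.setReg x (σ.reg y + σ.reg z)) 1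
  | sub (x y z : ℕ) (σ : State) : Exec (.sub x y z) σ (σ.setReg x (σ.reg y - σ.reg z)) 1
  | load (x y a : ℕ) (σ : State) (ha : σ.reg y = (a : ℤ)) :
      Exec (.load x y) σ (σ.setReg x (σ.mem a)) 1
  | store (x y a : ℕ) (σ : State) (ha : σ.reg x = (a : ℤ)) :
      Exec (.store x y) σ (σ.setMem a (σ.reg y)) 1
  | seq {P Q : Program} {σ σ' σ'' : State} {t t' : ℕ} (hP : Exec P σ σ' t)
      (hQ : Exec Q σ' σ'' t') : Exec (.seq P Q) σ σ'' (t + t')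
  | ifTrue {x : ℕ} {P Q : Program} {σ σ' : State} {t : ℕ} (hx : 0 < σ.reg x)
      (hP : Exec P σ σ' t) : Exec (.ifPos x P Q) σ σ' (t + 1)
  | ifFalse {x : ℕ} {P Q : Program} {σ σ' : State} {t : ℕ} (hx : σ.reg x ≤ 0)
      (hQ : Exec Q σ σ' t) : Exec (.ifPos x P Q) σ σ' (t + 1)
  | whileTrue {x : ℕ} {P : Program} {σ σ' σ'' : State} {t t' : ℕ} (hx : 0 < σ.reg x)
      (hP : Exec P σ σ' t) (hrest : Exec (.whilePos x P) σ' σ'' t') :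
      Exec (.whilePos x P) σ σ'' (t + t' + 1)
  | whileFalse {x : ℕ} {P : Program} {σ : State} (hx : σ.reg x ≤ 0) :
      Exec (.whilePos x P) σ σ 1

/-- The memory cell for coordinate `d` of sensor number `k`. -/
def cell (k : ℕ) (d : Fin 2) : ℕ := 5 + 2 * k + d

/-- The initial state on the input `I`: cell `0` holds `n`, cells `1` to `4` describe the
rectangle, then come the coordinates of the sensors; everything else is `0`. -/
def input {n : ℕ} (I : IntConfig n) : State where
  reg := fun _ => 0
  mem := fun a =>
    match a with
    | 0 => (n : ℤ)
    | 1 => I.lo 0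
    | 2 => (I.side 0 : ℤ)
    | 3 => I.lo 1
    | 4 => (I.side 1 : ℤ)
    | b + 5 => if h : b / 2 < n then I.pos ⟨b / 2, h⟩ (if b % 2 = 0 then 0 else 1) else 0

/-- The positions that are stored in memory, in place of the initial ones. -/
def output (n : ℕ) (σ : State) : Fin n → Fin 2 → ℤ := fun k d => σ.mem (cell k d)

end RAM

/-!
The lines of the rectangle along the two axes are the nodes of a bipartite multigraph, and each
sensor is the edge that joins its row to its column. A set of sensors is free exactly when the
other sensors form an edge cover of the nodes that have edges (`IntConfig.isFreeSet_iff`), so a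
maximum free set is the complement of a minimum edge cover, whose components are stars.

**Optimality.** A blocking list of real positions can be rounded to integer points that meet all
lines, without touching the sensors that stay (`IntConfig.exists_integral_of_isBlocking`). Let `S`
be the set of moved sensors. Each gap needs a sensor of `S`, so `|S|` is at least the number of
gaps along either axis. Adding to the other sensors one sensor for each line emptied by the removal
of `S` gives an edge cover; comparing it with a minimum one bounds `|S| + k` below by the number of
all gaps (`IntConfig.card_gaps_add_card_gaps_le`, `IntConfig.le_numMoved_of_isBlocking`). The
algorithm moves just as many sensors as the larger of these bounds.

**The algorithm does not get stuck.** An invariant (`AlgorithmOne.Inv`) says that the unused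
sensors of the free set leave no gap behind and that the sensors outside it still form stars, so
each move fills gaps and opens none. When the free set is used up, every sensor of it lies alone
along the axes that matter. If there were no type 1 sensor for a gap that remains, then all sensors
would lie on different lines along that axis, and since there are at least as many sensors as
lines, no gap could remain (`AlgorithmOne.Inv.exists_isTypeOne`).

**Running time.** Programs are written in a small structured language of commands on variables and
arrays, with a clock. Their weakest preconditions `Imp.wp` bound the clock, and compilation to the
random access machine preserves results and bounds (`Imp.exec_of_wp`). The only part of the
computation that takes more than linear time is a maximum matching. An auction with about `√n`
price levels, each of which costs linear time, finds a matching that misses at most a fraction of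
about `1 / √n` of a maximum one; this is linear programming duality with the levels and prices as
dual variables (`Matching.Auction.matchSize_le`). Hence about `√n` searches for augmenting paths,
of linear time each, complete the matching. The search that fails leaves a vertex cover in the
sense of König, which certifies that no edge cover is smaller than the number of rows and columns
with edges minus the size of the matching (`Matching.Search.certified`). Adding one edge for each
node that the matching misses attains this bound (`Matching.Covering.card_kept_le`,
`AlgorithmOne.isMaxFreeSet_of_cover`). The moves are then made in three passes over the sensors
(`Imp.moveAll_spec`).
-/

/-! ### Free sets are complements of edge covers -/

theorem Fin.eq_or_eq_rev_of_two (d f : Fin 2) : f = d ∨ f = d.rev := by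
  revert d f; decide

theorem Fin.rev_ne_self_of_two (d : Fin 2) : d.rev ≠ d := by
  revert d; decide

namespace IntConfig

variable {n : ℕ}

theorem mem_lines {I : IntConfig n} {d : Fin 2} {i : ℤ} :
    i ∈ I.lines d ↔ I.lo d ≤ i ∧ i < I.lo d + I.side d := by
  simp [lines]

theorem card_lines (I : IntConfig n) (d : Fin 2) : (I.lines d).card = I.side d := by
  simp [lines]

theorem mem_gapsAt {I : IntConfig n} {p : Fin n → Fin 2 → ℤ} {S : Finset (Fin n)} {d : Fin 2}
    {i : ℤ} : i ∈ I.gapsAt p S d ↔ i ∈ I.lines d ∧ ∀ k ∈ S, p k d ≠ i := by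
  simp [gapsAt]

theorem mem_gaps {I : IntConfig n} {d : Fin 2} {i : ℤ} :
    i ∈ I.gaps d ↔ i ∈ I.lines d ∧ ∀ k, I.pos k d ≠ i := by
  simp [gaps, gapsAt]

theorem gridPoint_mem_carrier {I : IntConfig n} {p : Fin 2 → ℤ} :
    gridPoint p ∈ I.toConfiguration.rect.carrier ↔ ∀ d, p d ∈ I.lines d := by
  refine forall_congr' fun d => ?_
  simp only [toConfiguration, gridPoint, mem_lines]
  constructor
  · rintro ⟨h1, h2⟩
    constructor
    · have : (I.lo d : ℝ) < (p d : ℝ) + 1 := by linarith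
      exact_mod_cast Int.lt_add_one_iff.mp (by exact_mod_cast this)
    · have : (p d : ℝ) < (I.lo d : ℝ) + (I.side d : ℝ) := by linarith
      exact_mod_cast this
  · rintro ⟨h1, h2⟩
    have h1' : (I.lo d : ℝ) ≤ p d := by exact_mod_cast h1
    have h2' : (p d : ℝ) + 1 ≤ (I.lo d : ℝ) + (I.side d : ℝ) := by exact_mod_cast h2
    constructor <;> linarith

theorem pos_mem_lines_of_admissible {I : IntConfig n} (h : I.toConfiguration.Admissible)
    (k : Fin n) (d : Fin 2) : I.pos k d ∈ I.lines d :=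
  gridPoint_mem_carrier.mp (h.1 k) d

theorem side_le_of_admissible {I : IntConfig n} (h : I.toConfiguration.Admissible) (d : Fin 2) :
    I.side d ≤ n := by
  have := h.2 d
  simp only [toConfiguration] at this
  norm_num at this
  exact this

/-- A free set is the complement of an edge cover: seen as the edges of the bipartite multigraph of
rows and columns, the remaining sensors still meet every line that contains a sensor. -/
theorem isFreeSet_iff {I : IntConfig n} (hin : ∀ k d, I.pos k d ∈ I.lines d)
    {M : Finset (Fin n)} :
    I.IsFreeSet M ↔ ∀ k d, ∃ l ∈ Mᶜ, I.pos l d = I.pos k d := by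
  constructor
  · rintro ⟨-, h⟩ k d
    by_contra! hc
    have : I.pos k d ∈ I.gapsAt I.pos Mᶜ d := mem_gapsAt.mpr ⟨hin k d, hc⟩
    rw [h d] at this
    exact (mem_gaps.mp this).2 k rfl
  · intro h
    refine ⟨fun k hk d => ?_, fun d => ?_⟩
    · obtain ⟨l, hl, he⟩ := h k d
      exact ⟨l, fun hlk => by simp [hlk, hk] at hl, he⟩
    · ext i
      rw [mem_gapsAt, mem_gaps]
      refine and_congr_right fun _ => ⟨fun hi k hk => ?_, fun hi k _ => hi k⟩
      obtain ⟨l, hl, he⟩ := h k d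
      exact hi l hl (he.trans hk)

/-! ### Lower bounds on the number of moved sensors -/

/-- The sensors outside `S` stay, those of `S` end on arbitrary integer points: every line that
`S` leaves empty needs a sensor of `S`. -/
theorem card_gapsAt_compl_le {I : IntConfig n} {p : Fin n → Fin 2 → ℤ} {S : Finset (Fin n)}
    (hp : ∀ k ∉ S, p k = I.pos k) {d : Fin 2} (hcov : ∀ i ∈ I.lines d, ∃ k, p k d = i) :
    (I.gapsAt I.pos Sᶜ d).card ≤ S.card := by
  have : I.gapsAt I.pos Sᶜ d ⊆ S.image fun k => p k d := by
    intro i hi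
    obtain ⟨hi1, hi2⟩ := mem_gapsAt.mp hi
    obtain ⟨k, hk⟩ := hcov i hi1
    refine Finset.mem_image.mpr ⟨k, ?_, hk⟩
    by_contra hkS
    exact hi2 k (by simpa using hkS) (by rw [← hp k hkS]; exact hk)
  exact (Finset.card_le_card this).trans Finset.card_image_le

theorem gaps_subset_gapsAt (I : IntConfig n) (S : Finset (Fin n)) (d : Fin 2) :
    I.gaps d ⊆ I.gapsAt I.pos S d := fun i hi => by
  rw [mem_gaps] at hi
  exact mem_gapsAt.mpr ⟨hi.1, fun k _ => hi.2 k⟩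

/-- One sensor in each line that is emptied by removing `S`, though it is not a gap. -/
theorem exists_representatives (I : IntConfig n) (S : Finset (Fin n)) (d : Fin 2) :
    ∃ T : Finset (Fin n), T.card + (I.gaps d).card ≤ (I.gapsAt I.pos Sᶜ d).card ∧
      ∀ i ∈ I.gapsAt I.pos Sᶜ d, i ∉ I.gaps d → ∃ l ∈ T, I.pos l d = i := by
  classical
  have h : ∀ i ∈ I.gapsAt I.pos Sᶜ d \ I.gaps d, ∃ k, I.pos k d = i := by
    intro i hi
    rw [Finset.mem_sdiff, mem_gaps] at hi
    by_contra! hc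
    exact hi.2 ⟨(mem_gapsAt.mp hi.1).1, hc⟩
  choose e he using h
  refine ⟨(I.gapsAt I.pos Sᶜ d \ I.gaps d).attach.image
    fun i : {i // i ∈ I.gapsAt I.pos Sᶜ d \ I.gaps d} => e i.1 i.2, ?_, fun i hi hi' => ?_⟩
  · have h1 := Finset.card_sdiff_add_card_eq_card (I.gaps_subset_gapsAt Sᶜ d)
    have h2 := Finset.card_image_le (s := (I.gapsAt I.pos Sᶜ d \ I.gaps d).attach)
      (f := fun i => e i.1 i.2)
    rw [Finset.card_attach] at h2
    omega
  · have : i ∈ I.gapsAt I.pos Sᶜ d \ I.gaps d := Finset.mem_sdiff.mpr ⟨hi, hi'⟩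
    exact ⟨e i this, Finset.mem_image.mpr ⟨⟨i, this⟩, Finset.mem_attach _ _, rfl⟩, he i this⟩

/-- If moving the sensors of `S` fills all lines, then adding to the other sensors one sensor for
each line emptied by `S` gives an edge cover, so `S` cannot be small when free sets are small. -/
theorem card_gaps_add_card_gaps_le {I : IntConfig n} (hin : ∀ k d, I.pos k d ∈ I.lines d)
    {M : Finset (Fin n)} (hM : I.IsMaxFreeSet M) {p : Fin n → Fin 2 → ℤ} {S : Finset (Fin n)}
    (hp : ∀ k ∉ S, p k = I.pos k) (hcov : ∀ d, ∀ i ∈ I.lines d, ∃ k, p k d = i) :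
    (I.gaps 0).card + (I.gaps 1).card ≤ S.card + M.card := by
  classical
  obtain ⟨T, hT, hT'⟩ := I.exists_representatives S 0
  obtain ⟨U, hU, hU'⟩ := I.exists_representatives S 1
  have hfree : I.IsFreeSet (S \ (T ∪ U)) := by
    rw [isFreeSet_iff hin]
    intro k d
    by_cases hgap : I.pos k d ∈ I.gapsAt I.pos Sᶜ d
    · have hng : I.pos k d ∉ I.gaps d := fun h => (mem_gaps.mp h).2 k rfl
      have : ∃ l ∈ T ∪ U, I.pos l d = I.pos k d := by
        fin_cases d
        · obtain ⟨l, hl, he⟩ := hT' _ hgap hng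
          exact ⟨l, Finset.mem_union_left _ hl, he⟩
        · obtain ⟨l, hl, he⟩ := hU' _ hgap hng
          exact ⟨l, Finset.mem_union_right _ hl, he⟩
      obtain ⟨l, hl, he⟩ := this
      exact ⟨l, by simp [Finset.mem_union.mp hl], he⟩
    · rw [mem_gapsAt] at hgap
      push Not at hgap
      obtain ⟨l, hl, he⟩ := hgap (hin k d)
      refine ⟨l, ?_, he⟩
      rw [Finset.mem_compl] at hl
      simp [hl]
  have h0 := card_gapsAt_compl_le hp (hcov 0)
  have h1 := card_gapsAt_compl_le hp (hcov 1)
  have hM' := hM.2 _ hfree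
  have h2 := Finset.le_card_sdiff (T ∪ U) S
  have h3 := Finset.card_union_le T U
  omega

/-- A blocking list of real positions can be rounded to integer points that meet all lines, without
touching the sensors that stay. Two lines next to each other may share a sensor half-way between
them, so the rounding looks at the lines at a generic distance `θ` from the integers. -/
theorem exists_integral_of_isBlocking {I : IntConfig n} {q : Fin n → EuclideanSpace ℝ (Fin 2)}
    (hq : (I.toConfiguration.relocate q).IsBlocking) :
    ∃ p : Fin n → Fin 2 → ℤ, (∀ k, q k = gridPoint (I.pos k) → p k = I.pos k) ∧
      ∀ d, ∀ i ∈ I.lines d, ∃ k, p k d = i := by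
  have hθ : ∃ θ : ℝ, -(1 / 2) < θ ∧ θ < 1 / 2 ∧ ∀ k d (z : ℤ), q k d - θ - 1 / 2 ≠ z := by
    have hc : (Set.range fun x : Fin n × Fin 2 × ℤ => q x.1 x.2.1 - 1 / 2 - x.2.2).Countable :=
      Set.countable_range _
    obtain ⟨θ, h, h1, h2⟩ := (hc.dense_compl ℝ).exists_between
      (show -(1 / 2 : ℝ) < 1 / 2 by norm_num)
    refine ⟨θ, h1, h2, fun k d z hz => h ⟨(k, d, z), ?_⟩⟩
    simp only
    linarith
  obtain ⟨θ, hθ1, hθ2, hθ⟩ := hθ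
  refine ⟨fun k d => ⌈q k d - θ - 1 / 2⌉, fun k hk => ?_, fun d i hi => ?_⟩
  · ext d
    simp only [hk, gridPoint]
    rw [Int.ceil_eq_iff]
    constructor <;> linarith
  · rw [mem_lines] at hi
    have hi1 : (I.lo d : ℝ) ≤ i := by exact_mod_cast hi.1
    have hi2 : (i : ℝ) + 1 ≤ (I.lo d : ℝ) + (I.side d : ℝ) := by exact_mod_cast hi.2
    obtain ⟨k, z, hz, hz'⟩ := hq d (i + θ) ⟨WithLp.toLp 2
      (Function.update (fun f => (I.lo f : ℝ)) d (i + θ)), by simp, fun f => by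
        have hs : (1 : ℝ) ≤ I.side f := by exact_mod_cast I.side_pos f
        by_cases hf : f = d
        · subst hf
          simp only [Configuration.relocate, toConfiguration, Function.update_self]
          constructor <;> linarith
        · simp only [Configuration.relocate, toConfiguration, Function.update_of_ne hf]
          constructor <;> linarith⟩
    refine ⟨k, ?_⟩
    have hd : |z d - q k d| ≤ 1 / 2 := by
      have h1 := PiLp.norm_apply_le (z - q k) d
      have h2 : dist z (q k) ≤ 1 / 2 := hz'
      rw [dist_eq_norm] at h2
      exact h1.trans h2
    have hzd : z d = i + θ := hz
    rw [hzd, abs_le] at hd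
    rw [Int.ceil_eq_iff]
    have hne : q k d - θ - 1 / 2 ≠ ((i - 1 : ℤ) : ℝ) := hθ k d _
    push_cast at hne
    exact ⟨lt_of_le_of_ne (by linarith) (Ne.symm hne), by linarith⟩

theorem isBlocking_of_integral {I : IntConfig n} {p : Fin n → Fin 2 → ℤ}
    (hp : ∀ d, ∀ i ∈ I.lines d, ∃ k, p k d = i) :
    (I.toConfiguration.relocate fun k => gridPoint (p k)).IsBlocking := by
  rintro d t ⟨z, hz, hz'⟩
  have hz : z d = t := hz
  have ht := hz' d
  simp only [Configuration.relocate, toConfiguration, hz] at ht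
  have hs := I.side_pos d
  have : ∃ i ∈ I.lines d, |t - i| ≤ 1 / 2 := by
    by_cases h : t < I.lo d + I.side d - 1 / 2
    · refine ⟨⌊t + 1 / 2⌋, ?_, ?_⟩
      · rw [mem_lines, Int.le_floor, Int.floor_lt]
        push_cast
        constructor <;> linarith
      · have h1 := Int.floor_le (t + 1 / 2)
        have h2 := Int.lt_floor_add_one (t + 1 / 2)
        rw [abs_le]
        constructor <;> linarith
    · refine ⟨I.lo d + I.side d - 1, ?_, ?_⟩
      · rw [mem_lines]; omega
      · rw [abs_le]; push_cast; constructor <;> linarith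
  obtain ⟨i, hi, hti⟩ := this
  obtain ⟨k, hk⟩ := hp d i hi
  refine ⟨k, gridPoint (p k) + EuclideanSpace.single d (t - i), ?_, ?_⟩
  · simp [gridPoint, hk]
  · simp only [Configuration.sensingArea, Configuration.relocate, toConfiguration,
      Metric.mem_closedBall, dist_self_add_left]
    simpa using hti

theorem gridPoint_injective : Function.Injective gridPoint := by
  intro p q h
  ext d
  have := congrArg (fun z : EuclideanSpace ℝ (Fin 2) => z d) h
  simpa [gridPoint] using this

theorem numMoved_eq_card {I : IntConfig n} {p : Fin n → Fin 2 → ℤ} {S : Finset (Fin n)}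
    (h : ∀ k, k ∈ S ↔ p k ≠ I.pos k) :
    I.toConfiguration.numMoved (fun k => gridPoint (p k)) = S.card := by
  rw [Configuration.numMoved, ← Set.ncard_coe_finset]
  congr 1
  ext k
  simp only [toConfiguration, Set.mem_ofPred_eq, Finset.mem_coe, h, ne_eq, dist_eq_zero,
    gridPoint_injective.eq_iff, eq_comm (a := I.pos k)]

theorem le_numMoved_of_isBlocking {I : IntConfig n} (hin : ∀ k d, I.pos k d ∈ I.lines d)
    {M : Finset (Fin n)} (hM : I.IsMaxFreeSet M) {q : Fin n → EuclideanSpace ℝ (Fin 2)}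
    (hq : (I.toConfiguration.relocate q).IsBlocking) :
    (∀ d, (I.gaps d).card ≤ I.toConfiguration.numMoved q) ∧
      (I.gaps 0).card + (I.gaps 1).card ≤ I.toConfiguration.numMoved q + M.card := by
  classical
  obtain ⟨p, hp, hcov⟩ := exists_integral_of_isBlocking hq
  let S : Finset (Fin n) := Finset.univ.filter fun k => q k ≠ gridPoint (I.pos k)
  have hS : I.toConfiguration.numMoved q = S.card := by
    rw [Configuration.numMoved, ← Set.ncard_coe_finset]
    congr 1
    ext k
    simp [S, toConfiguration, eq_comm]
  have hpS : ∀ k ∉ S, p k = I.pos k := fun k hk => hp k (by simpa [S] using hk)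
  rw [hS]
  exact ⟨fun d => (Finset.card_le_card (I.gaps_subset_gapsAt Sᶜ d)).trans
    (card_gapsAt_compl_le hpS (hcov d)), card_gaps_add_card_gaps_le hin hM hpS hcov⟩

end IntConfig


/-! ### Runs of the algorithm -/

namespace AlgorithmOne

variable {n : ℕ}

/-- The kind of the `m`-th move when there are `r` and `c` gaps and `k` sensors in the free set. -/
def kindAt (r c k m : ℕ) : MoveKind :=
  if c ≤ k then
    if m < c then .jumpFirst else if r ≤ k then .freeSlide
    else if m < k then .freeMove else .slideMajor
  else if m < k then .jump else .slideAny

/-- The number of moves. -/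
def planLength (r c k : ℕ) : ℕ :=
  if c ≤ k then r else r + c - k

theorem schedule_eq_map {r c : ℕ} (hcr : c ≤ r) (k : ℕ) :
    schedule r c k = (List.range (planLength r c k)).map (kindAt r c k) := by
  apply List.ext_getElem
  · simp only [schedule, planLength]
    split_ifs <;> simp <;> omega
  · intro m h1 h2
    simp only [List.length_map, List.length_range, planLength] at h2
    simp only [List.getElem_map, List.getElem_range, kindAt, schedule]
    split_ifs at h2 ⊢ <;>
      simp only [List.getElem_append, List.length_append, List.length_replicate,
        List.getElem_replicate] <;>
      split_ifs <;> first | rfl | omega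

theorem run_append {I : IntConfig n} {M : Finset (Fin n)} {d : Fin 2} {l l' : List MoveKind}
    {s s' : State n} :
    Run I M d (l ++ l') s s' ↔ ∃ u, Run I M d l s u ∧ Run I M d l' u s' := by
  induction l generalizing s with
  | nil => simp [Run]
  | cons a l ih =>
    simp only [List.cons_append, Run, ih]
    constructor
    · rintro ⟨u, hu, v, hv, hv'⟩
      exact ⟨v, ⟨u, hu, hv⟩, hv'⟩
    · rintro ⟨v, ⟨u, hu, hv⟩, hv'⟩
      exact ⟨u, hu, v, hv, hv'⟩

/-- The first `m` moves of a sequence of moves of the given kinds. -/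
def Reach (I : IntConfig n) (M : Finset (Fin n)) (d : Fin 2) (κ : ℕ → MoveKind) (m : ℕ)
    (s : State n) : Prop :=
  Run I M d ((List.range m).map κ) (start I M) s

theorem reach_zero {I : IntConfig n} {M : Finset (Fin n)} {d : Fin 2} {κ : ℕ → MoveKind}
    {s : State n} : Reach I M d κ 0 s ↔ start I M = s := Iff.rfl

theorem reach_succ {I : IntConfig n} {M : Finset (Fin n)} {d : Fin 2} {κ : ℕ → MoveKind}
    {m : ℕ} {s : State n} :
    Reach I M d κ (m + 1) s ↔ ∃ u, Reach I M d κ m u ∧ Move I M d (κ m) u s := by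
  simp [Reach, List.range_succ, run_append, Run]

/-- What holds after the sensors of `moved` have been moved. `A` is a set of axes along which the
moved sensors of the free set `M` do not meet other sensors. By `cover`, taking away an unused
sensor of `M` opens no gap. By `star`, the sensors outside `M` form stars, as the edges of a minimum
edge cover do, and a sensor outside `M` that has company along one axis is of type 1. By `solo`,
such a sensor has not been moved yet. -/
structure Inv (I : IntConfig n) (M : Finset (Fin n)) (A : Set (Fin 2)) (s : State n)
    (moved : Finset (Fin n)) : Prop where
  unmoved : ∀ k ∉ moved, s.pos k = I.pos k
  moved_gap : ∀ k ∈ moved, ∃ f, s.pos k f ∈ I.gaps f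
  mem_lines : ∀ k f, s.pos k f ∈ I.lines f
  unused_eq : s.unused = M \ moved
  gaps_subset : ∀ f, s.gaps I f ⊆ I.gaps f
  cover : ∀ k ∈ s.unused, ∀ f, ∃ l ∈ Mᶜ, s.pos l f = s.pos k f
  star : ∀ k ∈ Mᶜ, ∃ f, ∀ l ∈ Mᶜ, l ≠ k → s.pos l f ≠ s.pos k f
  solo : ∀ k ∈ Mᶜ, k ∈ moved → ∀ f, ∀ l ∈ Mᶜ, l ≠ k → s.pos l f ≠ s.pos k f
  alone : ∀ k ∈ M, k ∈ moved → ∀ f ∈ A, ∀ l, l ≠ k → s.pos l f ≠ s.pos k f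

theorem State.mem_gaps {s : State n} {I : IntConfig n} {f : Fin 2} {i : ℤ} :
    i ∈ s.gaps I f ↔ i ∈ I.lines f ∧ ∀ k, s.pos k f ≠ i := by
  simp [State.gaps, IntConfig.gapsAt]

theorem State.place_pos_self (s : State n) (k : Fin n) (q : Fin 2 → ℤ) :
    (s.place k q).pos k = q := by simp [State.place]

theorem State.place_pos_of_ne (s : State n) {k l : Fin n} (q : Fin 2 → ℤ) (h : l ≠ k) :
    (s.place k q).pos l = s.pos l := by simp [State.place, h]

theorem State.gaps_place_of_company {s : State n} {I : IntConfig n} {f : Fin 2} {k : Fin n}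
    (q : Fin 2 → ℤ) (h : ∃ l, l ≠ k ∧ s.pos l f = s.pos k f) :
    (s.place k q).gaps I f = (s.gaps I f).erase (q f) := by
  ext i
  rw [Finset.mem_erase, State.mem_gaps, State.mem_gaps]
  constructor
  · rintro ⟨h1, h2⟩
    refine ⟨fun he => h2 k (by rw [State.place_pos_self, he]), h1, fun l hl => ?_⟩
    by_cases hlk : l = k
    · subst hlk
      obtain ⟨l', hl', he⟩ := h
      exact h2 l' (by rw [State.place_pos_of_ne _ _ hl', he, hl])
    · exact h2 l (by rw [State.place_pos_of_ne _ _ hlk, hl])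
  · rintro ⟨h1, h2, h3⟩
    refine ⟨h2, fun l hl => ?_⟩
    by_cases hlk : l = k
    · subst hlk
      rw [State.place_pos_self] at hl
      exact h1 hl.symm
    · rw [State.place_pos_of_ne _ _ hlk] at hl
      exact h3 l hl

theorem State.gaps_place_of_eq {s : State n} {I : IntConfig n} {f : Fin 2} {k : Fin n}
    {q : Fin 2 → ℤ} (h : q f = s.pos k f) : (s.place k q).gaps I f = s.gaps I f := by
  ext i
  rw [State.mem_gaps, State.mem_gaps]
  refine and_congr_right fun _ => forall_congr' fun l => ?_
  by_cases hlk : l = k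
  · subst hlk
    rw [State.place_pos_self, h]
  · rw [State.place_pos_of_ne _ _ hlk]

theorem Inv.start {I : IntConfig n} (hin : ∀ k d, I.pos k d ∈ I.lines d) {M : Finset (Fin n)}
    (hM : I.IsMaxFreeSet M) (A : Set (Fin 2)) : Inv I M A (start I M) ∅ where
  unmoved k _ := rfl
  moved_gap k hk := by simp at hk
  mem_lines := hin
  unused_eq := by simp [AlgorithmOne.start]
  gaps_subset f := subset_rfl
  cover k _ f := (IntConfig.isFreeSet_iff hin).mp hM.1 k f
  star k hk := by
    -- a sensor of the edge cover that has company on both axes could join the free set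
    by_contra! hc
    have hk' : k ∉ M := by simpa using hk
    have hfree : I.IsFreeSet (insert k M) := by
      rw [IntConfig.isFreeSet_iff hin]
      intro l f
      obtain ⟨l', hl', he⟩ := (IntConfig.isFreeSet_iff hin).mp hM.1 l f
      by_cases hlk : l' = k
      · subst hlk
        obtain ⟨l'', h1, h2, h3⟩ := hc f
        refine ⟨l'', ?_, ?_⟩
        · simpa [h2] using h1
        · exact h3.trans he
      · exact ⟨l', by simpa [hlk] using hl', he⟩
    have := hM.2 _ hfree
    rw [Finset.card_insert_of_notMem hk'] at this
    omega
  solo k _ hk := by simp at hk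
  alone k _ hk := by simp at hk

theorem Inv.not_mem_moved_of_mem_unused {I : IntConfig n} {M : Finset (Fin n)} {A : Set (Fin 2)}
    {s : State n} {moved : Finset (Fin n)} (h : Inv I M A s moved) {k : Fin n}
    (hk : k ∈ s.unused) : k ∈ M ∧ k ∉ moved := by
  rw [h.unused_eq, Finset.mem_sdiff] at hk
  exact hk

/-- An unused sensor of `M` leaves no gap behind. -/
theorem Inv.gaps_place {I : IntConfig n} {M : Finset (Fin n)} {A : Set (Fin 2)}
    {s : State n} {moved : Finset (Fin n)} (h : Inv I M A s moved) {k : Fin n}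
    (hk : k ∈ s.unused) (q : Fin 2 → ℤ) (f : Fin 2) :
    (s.place k q).gaps I f = (s.gaps I f).erase (q f) := by
  obtain ⟨l, hl, he⟩ := h.cover k hk f
  have hkM := (h.not_mem_moved_of_mem_unused hk).1
  exact State.gaps_place_of_company q ⟨l, fun hlk => by simp [hlk, hkM] at hl, he⟩

theorem Inv.place {I : IntConfig n} {M : Finset (Fin n)} {A : Set (Fin 2)}
    {s : State n} {moved : Finset (Fin n)} (h : Inv I M A s moved) {k : Fin n}
    (hk : k ∈ s.unused) {q : Fin 2 → ℤ} (hq : ∀ f, q f ∈ I.lines f)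
    (hgap : ∃ f, q f ∈ s.gaps I f) (hA : ∀ f ∈ A, q f ∈ s.gaps I f) :
    Inv I M A (s.place k q) (insert k moved) := by
  obtain ⟨hkM, hkm⟩ := h.not_mem_moved_of_mem_unused hk
  have hne : ∀ l ∈ Mᶜ, l ≠ k := fun l hl hlk => by simp [hlk, hkM] at hl
  have hpos : ∀ l ∈ Mᶜ, (s.place k q).pos l = s.pos l := fun l hl =>
    State.place_pos_of_ne _ _ (hne l hl)
  refine ⟨fun l hl => ?_, fun l hl => ?_, fun l f => ?_, ?_, fun f => ?_, fun l hl f => ?_,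
    fun l hl => ?_, fun l hl hl' f l' hl'' hne' => ?_, fun l hl hl' f hf l' hl'' => ?_⟩
  · rw [Finset.mem_insert, not_or] at hl
    rw [State.place_pos_of_ne _ _ hl.1, h.unmoved l hl.2]
  · by_cases hlk : l = k
    · subst hlk
      rw [State.place_pos_self]
      obtain ⟨f, hf⟩ := hgap
      exact ⟨f, h.gaps_subset f hf⟩
    · rw [State.place_pos_of_ne _ _ hlk]
      exact h.moved_gap l (Finset.mem_of_mem_insert_of_ne hl hlk)
  · by_cases hlk : l = k
    · subst hlk; rw [State.place_pos_self]; exact hq f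
    · rw [State.place_pos_of_ne _ _ hlk]; exact h.mem_lines l f
  · simp only [State.place, h.unused_eq]
    ext l
    simp only [Finset.mem_erase, Finset.mem_sdiff, Finset.mem_insert]
    tauto
  · rw [h.gaps_place hk]
    exact (Finset.erase_subset _ _).trans (h.gaps_subset f)
  · simp only [State.place, Finset.mem_erase] at hl
    obtain ⟨l', hl', he⟩ := h.cover l hl.2 f
    exact ⟨l', hl', by rw [hpos l' hl', State.place_pos_of_ne _ _ hl.1, he]⟩
  · obtain ⟨f, hf⟩ := h.star l hl
    exact ⟨f, fun l' hl' hne' => by rw [hpos l' hl', hpos l hl]; exact hf l' hl' hne'⟩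
  · rw [hpos l hl, hpos l' hl'']
    exact h.solo l hl (Finset.mem_of_mem_insert_of_ne hl' (hne l hl)) f l' hl'' hne'
  · by_cases hlk : l = k
    · subst hlk
      rw [State.place_pos_self, State.place_pos_of_ne _ _ hl'']
      exact (State.mem_gaps.mp (hA f hf)).2 l'
    · have hlm := Finset.mem_of_mem_insert_of_ne hl' hlk
      rw [State.place_pos_of_ne _ _ hlk]
      by_cases hlk' : l' = k
      · subst hlk'
        rw [State.place_pos_self]
        exact fun he => (State.mem_gaps.mp (hA f hf)).2 l he.symm
      · rw [State.place_pos_of_ne _ _ hlk']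
        exact h.alone l hl hlm f hf l' hl''

theorem State.slide_pos_self (s : State n) (k : Fin n) (f : Fin 2) (i : ℤ) :
    (s.slide k f i).pos k f = i := by simp [State.slide, State.place]

theorem State.slide_pos_rev (s : State n) (k l : Fin n) (f : Fin 2) (i : ℤ) :
    (s.slide k f i).pos l f.rev = s.pos l f.rev := by
  by_cases h : l = k
  · subst h
    simp [State.slide, State.place, Fin.rev_ne_self_of_two]
  · simp [State.slide, State.place, h]

theorem State.slide_pos_of_ne (s : State n) {k l : Fin n} (f : Fin 2) (i : ℤ) (h : l ≠ k) :
    (s.slide k f i).pos l = s.pos l := by simp [State.slide, State.place, h]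

theorem State.gaps_slide {s : State n} {I : IntConfig n} {S : Finset (Fin n)} {f : Fin 2}
    {k : Fin n} (hk : IsTypeOne s.pos S f k) (i : ℤ) :
    (s.slide k f i).gaps I f = (s.gaps I f).erase i ∧
      (s.slide k f i).gaps I f.rev = s.gaps I f.rev := by
  obtain ⟨-, ⟨l, -, hl⟩, -⟩ := hk
  constructor
  · rw [State.slide, State.gaps_place_of_company _ ⟨l, hl⟩, Function.update_self]
  · exact State.gaps_place_of_eq (by simp [Fin.rev_ne_self_of_two])

theorem Inv.not_mem_moved_of_isTypeOne {I : IntConfig n} {M : Finset (Fin n)} {A : Set (Fin 2)}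
    {s : State n} {moved : Finset (Fin n)} (h : Inv I M A s moved) {k : Fin n} {f : Fin 2}
    (hk : IsTypeOne s.pos Mᶜ f k) : k ∉ moved := fun hm => by
  obtain ⟨hkM, ⟨l, hl, hlk, he⟩, -⟩ := hk
  exact h.solo k hkM hm f l hl hlk he

/-- The slide of a type 1 sensor to a gap leaves it alone on both of its lines, and brings no two
sensors together. -/
theorem Inv.slide {I : IntConfig n} {M : Finset (Fin n)} {A : Set (Fin 2)}
    {s : State n} {moved : Finset (Fin n)} (h : Inv I M A s moved) {k : Fin n} {f : Fin 2}
    (hk : IsTypeOne s.pos Mᶜ f k) {i : ℤ} (hi : i ∈ s.gaps I f) :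
    Inv I M A (s.slide k f i) (insert k moved) := by
  have hgaps := State.gaps_slide (I := I) hk i
  obtain ⟨hkM, ⟨l₀, hl₀, hlk₀, he₀⟩, hrev⟩ := hk
  have hkM' : k ∉ M := by simpa using hkM
  obtain ⟨hil, hi'⟩ := State.mem_gaps.mp hi
  -- sensors that differed in a coordinate before the slide still differ
  have hsep : ∀ l l' g, l ≠ l' → s.pos l g ≠ s.pos l' g →
      (s.slide k f i).pos l g ≠ (s.slide k f i).pos l' g := by
    intro l l' g hll' hne
    obtain rfl | rfl := Fin.eq_or_eq_rev_of_two f g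
    · by_cases h1 : l = k
      · subst h1
        rw [State.slide_pos_self, State.slide_pos_of_ne _ _ _ hll'.symm]
        exact (hi' l').symm
      · by_cases h2 : l' = k
        · subst h2
          rw [State.slide_pos_self, State.slide_pos_of_ne _ _ _ hll']
          exact hi' l
        · rwa [State.slide_pos_of_ne _ _ _ h1, State.slide_pos_of_ne _ _ _ h2]
    · rwa [State.slide_pos_rev, State.slide_pos_rev]
  refine ⟨fun l hl => ?_, fun l hl => ?_, fun l g => ?_, ?_, fun g => ?_, fun l hl g => ?_,
    fun l hl => ?_, fun l hl hl' g l' hl'' hne' => ?_, fun l hl hl' g hg l' hl'' => ?_⟩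
  · rw [Finset.mem_insert, not_or] at hl
    rw [State.slide_pos_of_ne _ _ _ hl.1, h.unmoved l hl.2]
  · by_cases hlk : l = k
    · subst hlk
      exact ⟨f, by rw [State.slide_pos_self]; exact h.gaps_subset f hi⟩
    · rw [State.slide_pos_of_ne _ _ _ hlk]
      exact h.moved_gap l (Finset.mem_of_mem_insert_of_ne hl hlk)
  · by_cases hlk : l = k
    · subst hlk
      obtain rfl | rfl := Fin.eq_or_eq_rev_of_two f g
      · rw [State.slide_pos_self]; exact hil
      · rw [State.slide_pos_rev]; exact h.mem_lines l _
    · rw [State.slide_pos_of_ne _ _ _ hlk]; exact h.mem_lines l g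
  · simp only [State.slide, State.place, h.unused_eq]
    ext l
    simp only [Finset.mem_erase, Finset.mem_sdiff, Finset.mem_insert]
    by_cases hlk : l = k <;> simp [hlk, hkM']
  · obtain rfl | rfl := Fin.eq_or_eq_rev_of_two f g
    · rw [hgaps.1]; exact (Finset.erase_subset _ _).trans (h.gaps_subset _)
    · rw [hgaps.2]; exact h.gaps_subset _
  · simp only [State.slide, State.place, Finset.mem_erase] at hl
    obtain ⟨l', hl', he⟩ := h.cover l hl.2 g
    obtain rfl | rfl := Fin.eq_or_eq_rev_of_two f g
    · by_cases hlk : l' = k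
      · subst hlk
        exact ⟨l₀, hl₀, by
          rw [State.slide_pos_of_ne _ _ _ hlk₀, State.slide_pos_of_ne _ _ _ hl.1, he₀, he]⟩
      · exact ⟨l', hl', by
          rw [State.slide_pos_of_ne _ _ _ hlk, State.slide_pos_of_ne _ _ _ hl.1, he]⟩
    · exact ⟨l', hl', by rw [State.slide_pos_rev, State.slide_pos_rev, he]⟩
  · obtain ⟨g, hg⟩ := h.star l hl
    exact ⟨g, fun l' hl' hne' => hsep l' l g hne' (hg l' hl' hne')⟩
  · by_cases hlk : l = k
    · subst hlk
      obtain rfl | rfl := Fin.eq_or_eq_rev_of_two f g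
      · rw [State.slide_pos_self, State.slide_pos_of_ne _ _ _ hne']
        exact hi' l'
      · rw [State.slide_pos_rev, State.slide_pos_rev]
        exact hrev l' hl'' hne'
    · exact hsep l' l g hne'
        (h.solo l hl (Finset.mem_of_mem_insert_of_ne hl' hlk) g l' hl'' hne')
  · have hlk : l ≠ k := fun hlk => hkM' (hlk ▸ hl)
    exact hsep l' l g hl''
      (h.alone l hl (Finset.mem_of_mem_insert_of_ne hl' hlk) g hg l' hl'')

/-- When the free set is used up and a gap along `f` remains, two of the other sensors share a line
along `f`: otherwise no two of the `n` sensors would, and they would fill more lines than the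
rectangle has besides the gap. -/
theorem Inv.exists_isTypeOne {I : IntConfig n} (hside : ∀ d, I.side d ≤ n) {M : Finset (Fin n)}
    {A : Set (Fin 2)} {s : State n} {moved : Finset (Fin n)} (h : Inv I M A s moved)
    (hunused : s.unused.card = 0) {f : Fin 2} (hf : f ∈ A) (hgap : (s.gaps I f).Nonempty) :
    ∃ k, IsTypeOne s.pos Mᶜ f k := by
  by_contra! hc
  have hmoved : ∀ k ∈ M, k ∈ moved := by
    rw [Finset.card_eq_zero, h.unused_eq, Finset.sdiff_eq_empty_iff_subset] at hunused
    exact hunused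
  have hnc : ∀ k ∈ Mᶜ, ∀ l ∈ Mᶜ, l ≠ k → s.pos l f ≠ s.pos k f := by
    intro k hk l hl hlk he
    refine hc k ⟨hk, ⟨l, hl, hlk, he⟩, ?_⟩
    obtain ⟨g, hg⟩ := h.star k hk
    obtain rfl | rfl := Fin.eq_or_eq_rev_of_two f g
    · exact absurd he (hg l hl hlk)
    · exact hg
  have hinj : Function.Injective fun k => s.pos k f := by
    intro k l he
    by_contra hkl
    have he : s.pos k f = s.pos l f := he
    by_cases hk : k ∈ M
    · exact h.alone k hk (hmoved k hk) f hf l (Ne.symm hkl) he.symm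
    · by_cases hl : l ∈ M
      · exact h.alone l hl (hmoved l hl) f hf k hkl he
      · exact hnc l (by simpa using hl) k (by simpa using hk) hkl he
  have hsub : Finset.univ.image (fun k => s.pos k f) ⊆ I.lines f \ s.gaps I f := by
    intro i hi
    obtain ⟨k, -, rfl⟩ := Finset.mem_image.mp hi
    exact Finset.mem_sdiff.mpr ⟨h.mem_lines k f, fun hg => (State.mem_gaps.mp hg).2 k rfl⟩
  have h1 := Finset.card_le_card hsub
  have h2 : s.gaps I f ⊆ I.lines f := fun i hi => (State.mem_gaps.mp hi).1
  rw [Finset.card_image_of_injective _ hinj, Finset.card_univ, Fintype.card_fin,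
    Finset.card_sdiff_of_subset h2, IntConfig.card_lines] at h1
  have := hside f
  have := hgap.card_pos
  have := Finset.card_le_card h2
  rw [IntConfig.card_lines] at this
  omega

/-- The state of affairs after `m` moves, with the numbers of gaps and of unused sensors. -/
structure Stage (I : IntConfig n) (M : Finset (Fin n)) (d : Fin 2) (m : ℕ) (s : State n)
    (moved : Finset (Fin n)) : Prop where
  inv : Inv I M (if (I.gaps d.rev).card ≤ M.card then {d} else Set.univ) s moved
  card_moved : moved.card = m
  card_unused : s.unused.card = M.card - m
  gaps_of_le : (I.gaps d.rev).card ≤ M.card →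
    (s.gaps I d).card = (I.gaps d).card - m ∧ (s.gaps I d.rev).card = (I.gaps d.rev).card - m
  gaps_of_lt : M.card < (I.gaps d.rev).card → m ≤ M.card →
    (s.gaps I d).card = (I.gaps d).card - m ∧ (s.gaps I d.rev).card = (I.gaps d.rev).card - m
  gaps_of_lt' : M.card < (I.gaps d.rev).card → M.card ≤ m →
    (s.gaps I d).card + (s.gaps I d.rev).card =
      (I.gaps d).card + (I.gaps d.rev).card - M.card - m

theorem Stage.start {I : IntConfig n} (hin : ∀ k d, I.pos k d ∈ I.lines d) {M : Finset (Fin n)}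
    {d : Fin 2} (hM : Choice I M d) : Stage I M d 0 (start I M) ∅ := by
  have hg : ∀ f, (AlgorithmOne.start I M).gaps I f = I.gaps f := fun f => rfl
  refine ⟨Inv.start hin hM.1 _, rfl, rfl, fun _ => ?_, fun _ _ => ?_, fun _ h => ?_⟩
  · simp [hg]
  · simp [hg]
  · have : M.card = 0 := by omega
    simp [hg, this]

/-- The moves that relocate a sensor of the free set. -/
theorem Stage.place {I : IntConfig n} {M : Finset (Fin n)} {d : Fin 2} (hM : Choice I M d)
    {m : ℕ} {s : State n} {moved : Finset (Fin n)} (h : Stage I M d m s moved) {k : Fin n}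
    (hk : k ∈ s.unused) {q : Fin 2 → ℤ} (hq : ∀ f, q f ∈ I.lines f) (hd : q d ∈ s.gaps I d)
    (hrev : m < (I.gaps d.rev).card → q d.rev ∈ s.gaps I d.rev) :
    Stage I M d (m + 1) (s.place k q) (insert k moved) := by
  have hcr := hM.2
  have hkm := h.inv.not_mem_moved_of_mem_unused hk
  have hu : 0 < s.unused.card := Finset.card_pos.mpr ⟨k, hk⟩
  have hcu := h.card_unused
  have hg1 : ((s.place k q).gaps I d).card = (s.gaps I d).card - 1 := by
    rw [h.inv.gaps_place hk, Finset.card_erase_of_mem hd]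
  have hg2 : m < (I.gaps d.rev).card →
      ((s.place k q).gaps I d.rev).card = (s.gaps I d.rev).card - 1 := fun hm => by
    rw [h.inv.gaps_place hk, Finset.card_erase_of_mem (hrev hm)]
  have hg3 : ((s.place k q).gaps I d.rev).card ≤ (s.gaps I d.rev).card := by
    rw [h.inv.gaps_place hk]
    exact Finset.card_le_card (Finset.erase_subset _ _)
  refine ⟨?_, ?_, ?_, fun hc => ?_, fun hc hm => ?_, fun hc hm => ?_⟩
  · refine h.inv.place hk hq ⟨d, hd⟩ fun f hf => ?_
    split_ifs at hf with hc
    · rw [Set.mem_singleton_iff.mp hf]; exact hd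
    · obtain rfl | rfl := Fin.eq_or_eq_rev_of_two d f
      · exact hd
      · exact hrev (by omega)
  · rw [Finset.card_insert_of_notMem hkm.2, h.card_moved]
  · simp only [State.place, Finset.card_erase_of_mem hk]
    omega
  · have := h.gaps_of_le hc
    by_cases hm : m < (I.gaps d.rev).card
    · have := hg2 hm
      omega
    · omega
  · have := h.gaps_of_lt hc (by omega)
    have := hg2 (by omega)
    omega
  · have := h.gaps_of_lt hc (by omega)
    have := hg2 (by omega)
    omega

/-- The moves that slide a sensor of type 1. -/
theorem Stage.slide {I : IntConfig n} {M : Finset (Fin n)} {d : Fin 2}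
    {m : ℕ} {s : State n} {moved : Finset (Fin n)} (h : Stage I M d m s moved)
    (hm : M.card ≤ m) (hrm : (I.gaps d.rev).card ≤ m ∨ M.card < (I.gaps d.rev).card)
    {k : Fin n} {f : Fin 2} (hk : IsTypeOne s.pos Mᶜ f k) {i : ℤ}
    (hi : i ∈ s.gaps I f) (hf : (I.gaps d.rev).card ≤ M.card → f = d) :
    Stage I M d (m + 1) (s.slide k f i) (insert k moved) := by
  have hkm := h.inv.not_mem_moved_of_isTypeOne hk
  have hkM : k ∉ s.unused := fun hu => by
    have h1 := (h.inv.not_mem_moved_of_mem_unused hu).1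
    have h2 := hk.1
    simp [h1] at h2
  have hcu := h.card_unused
  obtain ⟨hg1, hg2⟩ := State.gaps_slide (I := I) hk i
  have hpos : 0 < (s.gaps I f).card := Finset.card_pos.mpr ⟨i, hi⟩
  have hg1' : ((s.slide k f i).gaps I f).card = (s.gaps I f).card - 1 := by
    rw [hg1, Finset.card_erase_of_mem hi]
  refine ⟨h.inv.slide hk hi, ?_, ?_, fun hc => ?_, fun hc hm => ?_, fun hc hm => ?_⟩
  · rw [Finset.card_insert_of_notMem hkm, h.card_moved]
  · simp only [State.slide, State.place, Finset.erase_eq_of_notMem hkM]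
    omega
  · have h1 := h.gaps_of_le hc
    have h2 := hf hc
    subst h2
    rw [hg2, hg1']
    omega
  · omega
  · have h1 := h.gaps_of_lt' hc (by omega)
    obtain rfl | rfl := Fin.eq_or_eq_rev_of_two d f
    · rw [hg2, hg1']
      omega
    · rw [Fin.rev_rev] at hg2
      rw [hg2, hg1']
      omega

/-- Whatever move is made, one gap is filled along each axis the move is meant for, and no gap
is opened. -/
theorem Stage.move {I : IntConfig n} {M : Finset (Fin n)} {d : Fin 2} (hM : Choice I M d) {m : ℕ}
    {s s' : State n} {moved : Finset (Fin n)} (h : Stage I M d m s moved)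
    (hmove : Move I M d (kindAt (I.gaps d).card (I.gaps d.rev).card M.card m) s s') :
    ∃ moved', Stage I M d (m + 1) s' moved' := by
  have hcr := hM.2
  generalize hκ : kindAt (I.gaps d).card (I.gaps d.rev).card M.card m = κ at hmove
  have hlines : ∀ {f i}, i ∈ s.gaps I f → i ∈ I.lines f := fun hi => (State.mem_gaps.mp hi).1
  have both : ∀ {q : Fin 2 → ℤ}, q d ∈ I.lines d → q d.rev ∈ I.lines d.rev →
      ∀ f, q f ∈ I.lines f := by
    intro q h1 h2 f
    obtain rfl | rfl := Fin.eq_or_eq_rev_of_two d f <;> assumption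
  cases hmove with
  | jumpFirst _ k q hk hfirst hq =>
    exact ⟨_, h.place hM hk (both (hlines hfirst.1) (hlines hq)) hfirst.1 fun _ => hq⟩
  | jump _ k q hk hq =>
    exact ⟨_, h.place hM hk (fun f => hlines (hq f)) (hq d) fun _ => hq _⟩
  | freeSlide _ k i hk hi =>
    refine ⟨_, h.place hM hk (both ?_ ?_) ?_ fun hm => ?_⟩
    · simpa using hlines hi
    · simpa [Fin.rev_ne_self_of_two] using h.inv.mem_lines k d.rev
    · simpa using hi
    · simp only [kindAt] at hκ
      split_ifs at hκ
  | freeMove _ k q hk hq hin =>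
    refine ⟨_, h.place hM hk (both (hlines hq) hin) hq fun hm => ?_⟩
    simp only [kindAt] at hκ
    split_ifs at hκ
  | slideMajor _ k i hk hi =>
    refine ⟨_, h.slide ?_ ?_ hk hi fun _ => rfl⟩ <;>
    · simp only [kindAt] at hκ
      split_ifs at hκ
      omega
  | slideAny _ k f i hk hi =>
    refine ⟨_, h.slide ?_ ?_ hk hi ?_⟩ <;>
    · simp only [kindAt] at hκ
      split_ifs at hκ
      omega

theorem exists_stage_of_reach {I : IntConfig n} (hin : ∀ k d, I.pos k d ∈ I.lines d)
    {M : Finset (Fin n)} {d : Fin 2} (hM : Choice I M d) {m : ℕ} {s : State n}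
    (h : Reach I M d (kindAt (I.gaps d).card (I.gaps d.rev).card M.card) m s) :
    ∃ moved, Stage I M d m s moved := by
  induction m generalizing s with
  | zero =>
    obtain rfl := reach_zero.mp h
    exact ⟨∅, Stage.start hin hM⟩
  | succ m ih =>
    obtain ⟨u, hu, hmove⟩ := reach_succ.mp h
    obtain ⟨moved, hst⟩ := ih hu
    exact hst.move hM hmove

/-- The algorithm does not get stuck. -/
theorem Stage.exists_move {I : IntConfig n} (hside : ∀ d, I.side d ≤ n) {M : Finset (Fin n)}
    {d : Fin 2} (hM : Choice I M d) {m : ℕ} {s : State n} {moved : Finset (Fin n)}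
    (h : Stage I M d m s moved)
    (hm : m < planLength (I.gaps d).card (I.gaps d.rev).card M.card) :
    ∃ s', Move I M d (kindAt (I.gaps d).card (I.gaps d.rev).card M.card m) s s' := by
  have hcr := hM.2
  have hu := h.card_unused
  have hg := h.gaps_of_le
  have hg' := h.gaps_of_lt
  have hg'' := h.gaps_of_lt'
  have hd : ∀ x y : ℤ, ∃ q : Fin 2 → ℤ, q d = x ∧ q d.rev = y := fun x y =>
    ⟨Function.update (fun _ => y) d x, by simp, by simp [Fin.rev_ne_self_of_two]⟩
  simp only [planLength] at hm
  simp only [kindAt]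
  split_ifs at hm ⊢ with h1 h2 h3 h4 h5
  · have hg := hg h1
    obtain ⟨k, hk⟩ := Finset.card_pos.mp (show 0 < s.unused.card by omega)
    have hne := Finset.card_pos.mp (show 0 < (s.gaps I d).card by omega)
    obtain ⟨j, hj⟩ := Finset.card_pos.mp (show 0 < (s.gaps I d.rev).card by omega)
    obtain ⟨q, hq1, hq2⟩ := hd ((s.gaps I d).min' hne) j
    exact ⟨_, .jumpFirst s k q hk (by rw [hq1]; exact Finset.isLeast_min' _ hne)
      (by rw [hq2]; exact hj)⟩
  · have hg := hg h1
    obtain ⟨k, hk⟩ := Finset.card_pos.mp (show 0 < s.unused.card by omega)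
    obtain ⟨i, hi⟩ := Finset.card_pos.mp (show 0 < (s.gaps I d).card by omega)
    exact ⟨_, .freeSlide s k i hk hi⟩
  · have hg := hg h1
    obtain ⟨k, hk⟩ := Finset.card_pos.mp (show 0 < s.unused.card by omega)
    obtain ⟨i, hi⟩ := Finset.card_pos.mp (show 0 < (s.gaps I d).card by omega)
    obtain ⟨q, hq1, hq2⟩ := hd i (s.pos k d.rev)
    exact ⟨_, .freeMove s k q hk (by rw [hq1]; exact hi)
      (by rw [hq2]; exact h.inv.mem_lines k _)⟩
  · have hg := hg h1
    have hne := Finset.card_pos.mp (show 0 < (s.gaps I d).card by omega)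
    obtain ⟨k, hk⟩ := h.inv.exists_isTypeOne hside (by omega) (by simp [h1]) hne
    obtain ⟨i, hi⟩ := hne
    exact ⟨_, .slideMajor s k i hk hi⟩
  · have hg := hg' (by omega) (by omega)
    obtain ⟨k, hk⟩ := Finset.card_pos.mp (show 0 < s.unused.card by omega)
    obtain ⟨i, hi⟩ := Finset.card_pos.mp (show 0 < (s.gaps I d).card by omega)
    obtain ⟨j, hj⟩ := Finset.card_pos.mp (show 0 < (s.gaps I d.rev).card by omega)
    obtain ⟨q, hq1, hq2⟩ := hd i j
    refine ⟨_, .jump s k q hk fun f => ?_⟩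
    obtain rfl | rfl := Fin.eq_or_eq_rev_of_two d f
    · rw [hq1]; exact hi
    · rw [hq2]; exact hj
  · have hg := hg'' (by omega) (by omega)
    have : ∃ f, (s.gaps I f).Nonempty := by
      by_contra! hc
      have h1 := Finset.card_eq_zero.mpr (hc d)
      have h2 := Finset.card_eq_zero.mpr (hc d.rev)
      omega
    obtain ⟨f, hne⟩ := this
    obtain ⟨k, hk⟩ := h.inv.exists_isTypeOne hside (by omega) (f := f) (by simp [h1]) hne
    obtain ⟨i, hi⟩ := hne
    exact ⟨_, .slideAny s k f i hk hi⟩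

/-- When the algorithm ends, the gaps are closed. -/
theorem Stage.gaps_eq_empty {I : IntConfig n} {M : Finset (Fin n)} {d : Fin 2}
    (hM : Choice I M d) {m : ℕ} {s : State n} {moved : Finset (Fin n)}
    (h : Stage I M d m s moved)
    (hm : m = planLength (I.gaps d).card (I.gaps d.rev).card M.card) (f : Fin 2) :
    s.gaps I f = ∅ := by
  have hcr := hM.2
  have hg := h.gaps_of_le
  have hg'' := h.gaps_of_lt'
  simp only [planLength] at hm
  have : (s.gaps I d).card = 0 ∧ (s.gaps I d.rev).card = 0 := by
    split_ifs at hm with h1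
    · have := hg h1
      omega
    · have := hg'' (by omega) (by omega)
      omega
  rw [← Finset.card_eq_zero]
  obtain rfl | rfl := Fin.eq_or_eq_rev_of_two d f
  · exact this.1
  · exact this.2

theorem run_plan_iff {I : IntConfig n} {M : Finset (Fin n)} {d : Fin 2} (hM : Choice I M d)
    {s : State n} : Run I M d (plan I M d) (start I M) s ↔
      Reach I M d (kindAt (I.gaps d).card (I.gaps d.rev).card M.card)
        (planLength (I.gaps d).card (I.gaps d.rev).card M.card) s := by
  rw [plan, schedule_eq_map hM.2, Reach]

theorem exists_move_of_run {I : IntConfig n} (hin : ∀ k d, I.pos k d ∈ I.lines d)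
    (hside : ∀ d, I.side d ≤ n) {M : Finset (Fin n)} {d : Fin 2} (hM : Choice I M d)
    {l₁ l₂ : List MoveKind} {a : MoveKind} {s : State n} (hplan : plan I M d = l₁ ++ a :: l₂)
    (hrun : Run I M d l₁ (start I M) s) : ∃ s', Move I M d a s s' := by
  rw [plan, schedule_eq_map hM.2] at hplan
  have hlen := congrArg List.length hplan
  simp only [List.length_map, List.length_range, List.length_append, List.length_cons] at hlen
  have hl₁ : l₁ = (List.range l₁.length).map
      (kindAt (I.gaps d).card (I.gaps d.rev).card M.card) := by
    have := congrArg (List.take l₁.length) hplan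
    rw [List.take_left, ← List.map_take, List.take_range, Nat.min_eq_left (by omega)] at this
    exact this.symm
  have ha : a = kindAt (I.gaps d).card (I.gaps d.rev).card M.card l₁.length := by
    have := congrArg (fun l => l[l₁.length]?) hplan
    simpa [show l₁.length < planLength (I.gaps d).card (I.gaps d.rev).card M.card by omega]
      using this.symm
  rw [hl₁] at hrun
  obtain ⟨moved, hst⟩ := exists_stage_of_reach hin hM hrun
  rw [ha]
  exact hst.exists_move hside hM (by omega)

theorem solves_of_run {I : IntConfig n} (hin : ∀ k d, I.pos k d ∈ I.lines d)
    {M : Finset (Fin n)} {d : Fin 2} (hM : Choice I M d)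
    {s : State n} (hrun : Run I M d (plan I M d) (start I M) s) :
    (∀ k, gridPoint (s.pos k) ∈ I.toConfiguration.rect.carrier) ∧
      I.toConfiguration.SolvesMinNum (fun k => gridPoint (s.pos k)) ∧
      I.toConfiguration.numMoved (fun k => gridPoint (s.pos k)) =
        if min (I.gaps 0).card (I.gaps 1).card ≤ M.card then
          max (I.gaps 0).card (I.gaps 1).card
        else (I.gaps 0).card + (I.gaps 1).card - M.card := by
  obtain ⟨moved, hst⟩ := exists_stage_of_reach hin hM ((run_plan_iff hM).mp hrun)
  have hempty := hst.gaps_eq_empty hM rfl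
  have hmoved : ∀ k, k ∈ moved ↔ s.pos k ≠ I.pos k := by
    refine fun k => ⟨fun hk he => ?_, fun hk => ?_⟩
    · obtain ⟨f, hf⟩ := hst.inv.moved_gap k hk
      rw [he] at hf
      exact (IntConfig.mem_gaps.mp hf).2 k rfl
    · by_contra hkm
      exact hk (hst.inv.unmoved k hkm)
  have hnum := IntConfig.numMoved_eq_card hmoved
  rw [hst.card_moved] at hnum
  have hcr := hM.2
  have hval : planLength (I.gaps d).card (I.gaps d.rev).card M.card =
      if min (I.gaps 0).card (I.gaps 1).card ≤ M.card then
        max (I.gaps 0).card (I.gaps 1).card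
      else (I.gaps 0).card + (I.gaps 1).card - M.card := by
    have hd : d = 0 ∨ d = 1 := by omega
    rcases hd with rfl | rfl
    · rw [show Fin.rev (0 : Fin 2) = 1 from rfl] at *
      rw [planLength, min_eq_right hcr, max_eq_left hcr]
    · rw [show Fin.rev (1 : Fin 2) = 0 from rfl] at *
      rw [planLength, min_eq_left hcr, max_eq_right hcr, add_comm]
  refine ⟨fun k => IntConfig.gridPoint_mem_carrier.mpr (hst.inv.mem_lines k), ⟨?_, ?_⟩,
    hnum.trans hval⟩
  · refine IntConfig.isBlocking_of_integral fun f i hi => ?_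
    by_contra! hc
    have : i ∈ s.gaps I f := State.mem_gaps.mpr ⟨hi, hc⟩
    simp [hempty f] at this
  · intro q hq
    obtain ⟨h1, h2⟩ := IntConfig.le_numMoved_of_isBlocking hin hM.1 hq
    have h3 := h1 0
    have h4 := h1 1
    rw [hnum, hval]
    split_ifs <;> omega

end AlgorithmOne


/-! ### A structured language with arrays of natural numbers, compiled to the machine -/

namespace Imp

/-- The variables of the program. -/
inductive Var where
  | n | a | b | r | c | sw | i | e | L | sq | cur | i0 | o | j | base | st | qh | qt | fnd | run
  | go | u | w
  deriving DecidableEq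

/-- The arrays of the program. -/
inductive Fld where
  | X | Y | nxt | head | mr | mc | pr | lv | pt | qu | vis | par | keep | dr | dc | rg | cg | mark
  deriving DecidableEq

theorem Var.ctorIdx_injective : Function.Injective Var.ctorIdx := by
  intro x y h
  cases x <;> cases y <;> first | rfl | cases h

theorem Fld.ctorIdx_injective : Function.Injective Fld.ctorIdx := by
  intro x y h
  cases x <;> cases y <;> first | rfl | cases h

theorem Fld.ctorIdx_lt (F : Fld) : F.ctorIdx < 32 := by
  cases F <;> decide

/-- A state of the structured language: variables, arrays, the positions of the sensors relative to
the lower corner of the rectangle (`io d e` for sensor number `e`, counted from `1`), the number of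
sensors, and a clock that bounds the steps of the compiled program. -/
structure Store where
  v : Var → ℕ
  f : Fld → ℕ → ℕ
  io : Fin 2 → ℕ → ℕ
  size : ℕ
  clock : ℕ

namespace Store

/-- Advance the clock. -/
def tick (s : Store) (t : ℕ) : Store := { s with clock := s.clock + t }

/-- Assign to a variable. -/
def set (s : Store) (x : Var) (m t : ℕ) : Store :=
  { s with v := Function.update s.v x m, clock := s.clock + t }

/-- Assign to an entry of an array. -/
def put (s : Store) (F : Fld) (i m t : ℕ) : Store :=
  { s with f := Function.update s.f F (Function.update (s.f F) i m), clock := s.clock + t }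

/-- Change a coordinate of a sensor. -/
def out (s : Store) (d : Fin 2) (e m t : ℕ) : Store :=
  { s with io := Function.update s.io d (Function.update (s.io d) e m), clock := s.clock + t }

end Store

/-- Arithmetic expressions; subtraction is truncated. -/
inductive Expr where
  | lit (m : ℕ)
  | var (x : Var)
  | add (p q : Expr)
  | sub (p q : Expr)
  | get (F : Fld) (p : Expr)

/-- Programs. The commands `inp` and `out` read and write a coordinate of a sensor; conditionals
and loops test whether `p < q`. -/
inductive Cmd where
  | set (x : Var) (p : Expr)
  | put (F : Fld) (p q : Expr)
  | inp (x : Var) (d : Fin 2) (p : Expr)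
  | out (d : Fin 2) (p q : Expr)
  | seq (P Q : Cmd)
  | ite (p q : Expr) (P Q : Cmd)
  | loop (p q : Expr) (P : Cmd)
  | skip

instance : Coe Var Expr := ⟨Expr.var⟩

infixr:30 " ;; " => Cmd.seq

namespace Expr

/-- The value of an expression. -/
def eval (s : Store) : Expr → ℕ
  | lit m => m
  | var x => s.v x
  | add p q => p.eval s + q.eval s
  | sub p q => p.eval s - q.eval s
  | get F p => s.f F (p.eval s)

/-- The number of machine steps that evaluate an expression. -/
def cost : Expr → ℕ
  | lit _ => 1
  | var _ => 2
  | add p q => p.cost + (q.cost + 1)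
  | sub p q => p.cost + (q.cost + 3)
  | get _ p => p.cost + 9

end Expr

/-- The weakest precondition of a program. A loop is described by an invariant that bounds the
clock, which also makes it terminate. -/
def wp : Cmd → (Store → Prop) → Store → Prop
  | .set x p, Q, s => Q (s.set x (p.eval s) (p.cost + 2))
  | .put F p q, Q, s => Q (s.put F (p.eval s) (q.eval s) (p.cost + q.cost + 9))
  | .inp x d p, Q, s => (1 ≤ p.eval s ∧ p.eval s ≤ s.size) ∧
      Q (s.set x (s.io d (p.eval s)) (p.cost + 7))
  | .out d p q, Q, s => (1 ≤ p.eval s ∧ p.eval s ≤ s.size) ∧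
      Q (s.out d (p.eval s) (q.eval s) (p.cost + q.cost + 7))
  | .seq P R, Q, s => wp P (wp R Q) s
  | .ite p q P R, Q, s =>
      (p.eval s < q.eval s → wp P Q (s.tick (p.cost + q.cost + 2))) ∧
        (¬ p.eval s < q.eval s → wp R Q (s.tick (p.cost + q.cost + 2)))
  | .loop p q P, Q, s => ∃ (J : Store → Prop) (T : ℕ), J s ∧ ∀ s, J s → s.clock ≤ T ∧
      (p.eval s < q.eval s → wp P J (s.tick (p.cost + q.cost + 2))) ∧
        (¬ p.eval s < q.eval s → Q (s.tick (p.cost + q.cost + 2)))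
  | .skip, Q, s => Q (s.tick 1)

/-- Whether a program assigns to a variable. -/
def Cmd.modV : Cmd → Var → Bool
  | .set x _, y => x = y
  | .inp x _ _, y => x = y
  | .seq P Q, y => P.modV y || Q.modV y
  | .ite _ _ P Q, y => P.modV y || Q.modV y
  | .loop _ _ P, y => P.modV y
  | _, _ => false

/-- Whether a program writes to an array. -/
def Cmd.modF : Cmd → Fld → Bool
  | .put F _ _, G => F = G
  | .seq P Q, y => P.modF y || Q.modF y
  | .ite _ _ P Q, y => P.modF y || Q.modF y
  | .loop _ _ P, y => P.modF y
  | _, _ => false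

/-- Whether a program moves sensors along an axis. -/
def Cmd.modPos : Cmd → Fin 2 → Bool
  | .out d _ _, d' => d = d'
  | .seq P Q, y => P.modPos y || Q.modPos y
  | .ite _ _ P Q, y => P.modPos y || Q.modPos y
  | .loop _ _ P, y => P.modPos y
  | _, _ => false

/-- The parts of the state that `P` does not touch agree. -/
structure Frame (P : Cmd) (s s' : Store) : Prop where
  v : ∀ x, P.modV x = false → s'.v x = s.v x
  f : ∀ F, P.modF F = false → s'.f F = s.f F
  io : ∀ d, P.modPos d = false → s'.io d = s.io d
  size : s'.size = s.size

theorem Frame.refl (P : Cmd) (s : Store) : Frame P s s :=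
  ⟨fun _ _ => rfl, fun _ _ => rfl, fun _ _ => rfl, rfl⟩

theorem Frame.trans {P : Cmd} {s s' s'' : Store} (h : Frame P s s') (h' : Frame P s' s'') :
    Frame P s s'' :=
  ⟨fun x hx => (h'.v x hx).trans (h.v x hx), fun x hx => (h'.f x hx).trans (h.f x hx),
    fun x hx => (h'.io x hx).trans (h.io x hx), h'.size.trans h.size⟩

theorem Frame.mono {P Q : Cmd} {s s' : Store} (h : Frame P s s')
    (hv : ∀ x, Q.modV x = false → P.modV x = false) (hf : ∀ x, Q.modF x = false → P.modF x = false)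
    (hio : ∀ x, Q.modPos x = false → P.modPos x = false) : Frame Q s s' :=
  ⟨fun x hx => h.v x (hv x hx), fun x hx => h.f x (hf x hx), fun x hx => h.io x (hio x hx),
    h.size⟩

theorem wp_mono {P : Cmd} {Q Q' : Store → Prop} {s : Store} (h : wp P Q s)
    (hQ : ∀ s, Q s → Q' s) : wp P Q' s := by
  induction P generalizing Q Q' s with
  | set | put => exact hQ _ h
  | inp | out => exact ⟨h.1, hQ _ h.2⟩
  | skip => exact hQ _ h
  | seq P R ihP ihR => exact ihP h fun s hs => ihR hs hQ
  | ite p q P R ihP ihR => exact ⟨fun hc => ihP (h.1 hc) hQ, fun hc => ihR (h.2 hc) hQ⟩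
  | loop p q P ih =>
    obtain ⟨J, T, h0, h1⟩ := h
    exact ⟨J, T, h0, fun s hs => ⟨(h1 s hs).1, (h1 s hs).2.1, fun hc => hQ _ ((h1 s hs).2.2 hc)⟩⟩

theorem wp_frame {P : Cmd} {Q : Store → Prop} {s : Store} (h : wp P Q s) :
    wp P (fun s' => Q s' ∧ Frame P s s') s := by
  induction P generalizing Q s with
  | set x p =>
    refine ⟨h, fun y hy => ?_, fun _ _ => rfl, fun _ _ => rfl, rfl⟩
    have hy : ¬ x = y := by simpa [Cmd.modV] using hy
    exact Function.update_of_ne (Ne.symm hy) _ _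
  | put F p q =>
    refine ⟨h, fun _ _ => rfl, fun G hG => ?_, fun _ _ => rfl, rfl⟩
    have hG : ¬ F = G := by simpa [Cmd.modF] using hG
    exact Function.update_of_ne (Ne.symm hG) _ _
  | inp x d p =>
    refine ⟨h.1, h.2, fun y hy => ?_, fun _ _ => rfl, fun _ _ => rfl, rfl⟩
    have hy : ¬ x = y := by simpa [Cmd.modV] using hy
    exact Function.update_of_ne (Ne.symm hy) _ _
  | out d p q =>
    refine ⟨h.1, h.2, fun _ _ => rfl, fun _ _ => rfl, fun d' hd => ?_, rfl⟩
    have hd : ¬ d = d' := by simpa [Cmd.modPos] using hd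
    exact Function.update_of_ne (Ne.symm hd) _ _
  | skip => exact ⟨h, fun _ _ => rfl, fun _ _ => rfl, fun _ _ => rfl, rfl⟩
  | seq P R ihP ihR =>
    refine wp_mono (P := P) (ihP h) fun s' hs' => wp_mono (ihR hs'.1) fun s'' hs'' => ⟨hs''.1, ?_⟩
    refine Frame.trans (hs'.2.mono ?_ ?_ ?_) (hs''.2.mono ?_ ?_ ?_) <;>
    · intro x hx
      simp only [Cmd.modV, Cmd.modF, Cmd.modPos, Bool.or_eq_false_iff] at hx
      first | exact hx.1 | exact hx.2
  | ite p q P R ihP ihR =>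
    refine ⟨fun hc => wp_mono (ihP (h.1 hc)) fun s' hs' => ⟨hs'.1, ?_⟩,
      fun hc => wp_mono (ihR (h.2 hc)) fun s' hs' => ⟨hs'.1, ?_⟩⟩
    · refine Frame.trans ?_ (hs'.2.mono ?_ ?_ ?_)
      · exact ⟨fun _ _ => rfl, fun _ _ => rfl, fun _ _ => rfl, rfl⟩
      all_goals
        intro x hx
        simp only [Cmd.modV, Cmd.modF, Cmd.modPos, Bool.or_eq_false_iff] at hx
        exact hx.1
    · refine Frame.trans ?_ (hs'.2.mono ?_ ?_ ?_)
      · exact ⟨fun _ _ => rfl, fun _ _ => rfl, fun _ _ => rfl, rfl⟩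
      all_goals
        intro x hx
        simp only [Cmd.modV, Cmd.modF, Cmd.modPos, Bool.or_eq_false_iff] at hx
        exact hx.2
  | loop p q P ih =>
    obtain ⟨J, T, h0, h1⟩ := h
    have htick : ∀ (s : Store) (t : ℕ), Frame (.loop p q P) s (s.tick t) := fun s t =>
      ⟨fun _ _ => rfl, fun _ _ => rfl, fun _ _ => rfl, rfl⟩
    refine ⟨fun s' => J s' ∧ Frame (.loop p q P) s s', T, ⟨h0, Frame.refl _ _⟩,
      fun s' hs' => ⟨(h1 s' hs'.1).1, fun hc => ?_, fun hc => ?_⟩⟩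
    · refine wp_mono (ih ((h1 s' hs'.1).2.1 hc)) fun s'' hs'' => ⟨hs''.1, ?_⟩
      exact (hs'.2.trans (htick _ _)).trans
        (hs''.2.mono (fun _ h => h) (fun _ h => h) fun _ h => h)
    · exact ⟨(h1 s' hs'.1).2.2 hc, hs'.2.trans (htick _ _)⟩

/-- The rule for loops; what the body does not touch need not be part of the invariant. -/
theorem wp_loop {p q : Expr} {P : Cmd} {Q : Store → Prop} {s : Store} (J : Store → Prop) (T : ℕ)
    (h0 : J s) (h1 : ∀ s', Frame P s s' → J s' → s'.clock ≤ T ∧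
      (p.eval s' < q.eval s' → wp P J (s'.tick (p.cost + q.cost + 2))) ∧
        (¬ p.eval s' < q.eval s' → Q (s'.tick (p.cost + q.cost + 2)))) :
    wp (.loop p q P) Q s := by
  refine ⟨fun s' => J s' ∧ Frame P s s', T, ⟨h0, Frame.refl _ _⟩,
      fun s' hs' => ⟨(h1 s' hs'.2 hs'.1).1, fun hc => ?_, (h1 s' hs'.2 hs'.1).2.2⟩⟩
  refine wp_mono (wp_frame ((h1 s' hs'.2 hs'.1).2.1 hc)) fun s'' hs'' => ⟨hs''.1, ?_⟩
  refine Frame.trans (hs'.2.trans ?_) hs''.2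
  exact ⟨fun _ _ => rfl, fun _ _ => rfl, fun _ _ => rfl, rfl⟩

/-- The rule for a part of a program that has been verified separately. -/
theorem wp_of_wp {P : Cmd} {Q R : Store → Prop} {s : Store} (h : wp P Q s)
    (hQ : ∀ s', Frame P s s' → Q s' → R s') : wp P R s :=
  wp_mono (wp_frame h) fun s' hs' => hQ s' hs'.2 hs'.1

theorem wp_seq {P R : Cmd} {Q : Store → Prop} {s : Store} :
    wp (P ;; R) Q s = wp P (wp R Q) s := rfl

theorem wp_set {x : Var} {p : Expr} {Q : Store → Prop} {s : Store} :
    wp (.set x p) Q s = Q (s.set x (p.eval s) (p.cost + 2)) := rfl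

theorem wp_put {F : Fld} {p q : Expr} {Q : Store → Prop} {s : Store} :
    wp (.put F p q) Q s = Q (s.put F (p.eval s) (q.eval s) (p.cost + q.cost + 9)) := rfl

theorem wp_inp {x : Var} {d : Fin 2} {p : Expr} {Q : Store → Prop} {s : Store} :
    wp (.inp x d p) Q s = ((1 ≤ p.eval s ∧ p.eval s ≤ s.size) ∧
      Q (s.set x (s.io d (p.eval s)) (p.cost + 7))) := rfl

theorem wp_out {d : Fin 2} {p q : Expr} {Q : Store → Prop} {s : Store} :
    wp (.out d p q) Q s = ((1 ≤ p.eval s ∧ p.eval s ≤ s.size) ∧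
      Q (s.out d (p.eval s) (q.eval s) (p.cost + q.cost + 7))) := rfl

theorem wp_ite {p q : Expr} {P R : Cmd} {Q : Store → Prop} {s : Store} :
    wp (.ite p q P R) Q s =
      ((p.eval s < q.eval s → wp P Q (s.tick (p.cost + q.cost + 2))) ∧
        (¬ p.eval s < q.eval s → wp R Q (s.tick (p.cost + q.cost + 2)))) := rfl

theorem wp_skip {Q : Store → Prop} {s : Store} : wp .skip Q s = Q (s.tick 1) := rfl

/-! ### The compiler -/

open RAM (Program Exec)

/-- The register of a variable. The even registers hold intermediate results. -/
def Var.reg (x : Var) : ℕ := 2 * x.ctorIdx + 3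

/-- Replace the index in register `2 * k` by the address of an entry of the array `F`. Register `1`
holds the address where the arrays begin, interleaved with stride `32`. -/
def address (k : ℕ) (F : Fld) : Program :=
  .seq (.add (2 * k) (2 * k) (2 * k)) <| .seq (.add (2 * k) (2 * k) (2 * k)) <|
  .seq (.add (2 * k) (2 * k) (2 * k)) <| .seq (.add (2 * k) (2 * k) (2 * k)) <|
  .seq (.add (2 * k) (2 * k) (2 * k)) <| .seq (.add (2 * k) (2 * k) 1) <|
  .seq (.const (2 * k + 2) F.ctorIdx) (.add (2 * k) (2 * k) (2 * k + 2))

/-- Evaluate an expression into register `2 * k`. -/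
def Expr.compile : Expr → ℕ → Program
  | lit m, k => .const (2 * k) m
  | var x, k => .seq (.const (2 * k) 0) (.add (2 * k) (2 * k) x.reg)
  | add p q, k => .seq (p.compile k) <| .seq (q.compile (k + 1)) <|
      .add (2 * k) (2 * k) (2 * (k + 1))
  | sub p q, k => .seq (p.compile k) <| .seq (q.compile (k + 1)) <|
      .seq (.sub (2 * k) (2 * k) (2 * (k + 1))) <|
      .ifPos (2 * k) (.const (2 * (k + 1)) 0) (.const (2 * k) 0)
  | get F p, k => .seq (p.compile k) <| .seq (address k F) (.load (2 * k) (2 * k))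

/-- Evaluate `q - p` into register `0`. -/
def compileTest (p q : Expr) : Program :=
  .seq (q.compile 0) <| .seq (p.compile 1) (.sub 0 0 2)

/-- The machine program for a program of the structured language. -/
def Cmd.compile : Cmd → Program
  | set x p => .seq (p.compile 0) <| .seq (.const 2 0) (.add x.reg 0 2)
  | put F p q => .seq (q.compile 0) <| .seq (p.compile 1) <| .seq (address 1 F) (.store 2 0)
  | inp x d p => .seq (p.compile 0) <| .seq (.add 0 0 0) <| .seq (.const 2 (3 + d : ℕ)) <|
      .seq (.add 0 0 2) <| .seq (.load 0 0) <| .seq (.const 2 (1 + 2 * d : ℕ)) <|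
      .seq (.load 2 2) (.sub x.reg 0 2)
  | out d p q => .seq (p.compile 0) <| .seq (q.compile 1) <| .seq (.add 0 0 0) <|
      .seq (.const 4 (3 + d : ℕ)) <| .seq (.add 0 0 4) <| .seq (.const 4 (1 + 2 * d : ℕ)) <|
      .seq (.load 4 4) <| .seq (.add 2 2 4) (.store 0 2)
  | seq P Q => .seq P.compile Q.compile
  | ite p q P Q => .seq (compileTest p q) (.ifPos 0 P.compile Q.compile)
  | .loop p q P => .seq (compileTest p q) (.whilePos 0 (.seq P.compile (compileTest p q)))
  | skip => .const 0 0

variable {n : ℕ}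

/-- The machine state `σ` represents the store `s`, on an input with the rectangle of `I`. -/
structure Rep (I : IntConfig n) (s : Store) (σ : RAM.State) : Prop where
  size : s.size = n
  var : ∀ x : Var, σ.reg x.reg = s.v x
  base : σ.reg 1 = (5 + 2 * n : ℕ)
  fld : ∀ (F : Fld) (i : ℕ), σ.mem (5 + 2 * n + 32 * i + F.ctorIdx) = s.f F i
  lo : ∀ d : Fin 2, σ.mem (1 + 2 * d) = I.lo d
  io : ∀ (d : Fin 2) (e : ℕ), 1 ≤ e → e ≤ n → σ.mem (3 + 2 * e + d) = I.lo d + s.io d e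

theorem Rep.of_agree {I : IntConfig n} {s : Store} {σ σ' : RAM.State} (h : Rep I s σ)
    (hmem : σ'.mem = σ.mem) (hreg : ∀ x, x % 2 = 1 → σ'.reg x = σ.reg x) : Rep I s σ' where
  size := h.size
  var x := by rw [hreg _ (by simp only [Var.reg]; omega), h.var]
  base := by rw [hreg 1 rfl, h.base]
  fld F i := by rw [hmem, h.fld]
  lo d := by rw [hmem, h.lo]
  io d e h1 h2 := by rw [hmem, h.io d e h1 h2]

theorem Rep.tick {I : IntConfig n} {s : Store} {σ : RAM.State} (h : Rep I s σ) (t : ℕ) :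
    Rep I (s.tick t) σ := ⟨h.size, h.var, h.base, h.fld, h.lo, h.io⟩

theorem exec_address {σ : RAM.State} {k v D : ℕ} (F : Fld) (hv : σ.reg (2 * k) = v)
    (hD : σ.reg 1 = D) : ∃ σ', Exec (address k F) σ σ' 8 ∧ σ'.mem = σ.mem ∧
      σ'.reg (2 * k) = (D + 32 * v + F.ctorIdx : ℕ) ∧
      ∀ x, x ≠ 2 * k → x ≠ 2 * k + 2 → σ'.reg x = σ.reg x := by
  refine ⟨_, .seq (.add ..) <| .seq (.add ..) <| .seq (.add ..) <| .seq (.add ..) <|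
    .seq (.add ..) <| .seq (.add ..) <| .seq (.const ..) (.add ..), rfl, ?_, ?_⟩
  · have h1 : 1 ≠ 2 * k := by omega
    simp [RAM.State.setReg, hv, hD, h1]
    ring
  · intro x h1 h2
    simp [RAM.State.setReg, h1, h2]

theorem Expr.exec_compile {I : IntConfig n} {s : Store} (p : Expr) :
    ∀ {k : ℕ} {σ : RAM.State}, Rep I s σ → ∃ σ', Exec (p.compile k) σ σ' p.cost ∧
      σ'.mem = σ.mem ∧ σ'.reg (2 * k) = p.eval s ∧
      ∀ x, x < 2 * k ∨ x % 2 = 1 → σ'.reg x = σ.reg x := by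
  induction p with
  | lit m =>
    intro k σ h
    refine ⟨_, .const .., rfl, by simp [RAM.State.setReg, eval], fun x hx => ?_⟩
    have : x ≠ 2 * k := by omega
    simp [RAM.State.setReg, this]
  | var y =>
    intro k σ h
    have hy : y.reg ≠ 2 * k := by simp only [Var.reg]; omega
    refine ⟨_, .seq (.const ..) (.add ..), rfl, ?_, fun x hx => ?_⟩
    · simp [RAM.State.setReg, eval, hy, h.var]
    · have : x ≠ 2 * k := by omega
      simp [RAM.State.setReg, this]
  | add p q ihp ihq =>
    intro k σ h
    obtain ⟨σ₁, he₁, hm₁, hv₁, hr₁⟩ := ihp (k := k) h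
    have h₁ := h.of_agree hm₁ fun x hx => hr₁ x (Or.inr hx)
    obtain ⟨σ₂, he₂, hm₂, hv₂, hr₂⟩ := ihq (k := k + 1) h₁
    refine ⟨_, .seq he₁ (.seq he₂ (.add ..)), hm₂.trans hm₁, ?_, fun x hx => ?_⟩
    · simp [RAM.State.setReg, eval, hv₂, hr₂ (2 * k) (by omega), hv₁]
    · have : x ≠ 2 * k := by omega
      simp [RAM.State.setReg, this, hr₂ x (by omega), hr₁ x hx]
  | sub p q ihp ihq =>
    intro k σ h
    obtain ⟨σ₁, he₁, hm₁, hv₁, hr₁⟩ := ihp (k := k) h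
    have h₁ := h.of_agree hm₁ fun x hx => hr₁ x (Or.inr hx)
    obtain ⟨σ₂, he₂, hm₂, hv₂, hr₂⟩ := ihq (k := k + 1) h₁
    by_cases hpq : q.eval s < p.eval s
    · refine ⟨_, .seq he₁ (.seq he₂ (.seq (.sub ..) (.ifTrue ?_ (.const ..)))),
        hm₂.trans hm₁, ?_, fun x hx => ?_⟩
      · simp [RAM.State.setReg, hv₂, hr₂ (2 * k) (by omega), hv₁, hpq]
      · simp [RAM.State.setReg, hv₂, hr₂ (2 * k) (by omega), hv₁, eval]
        omega
      · have : x ≠ 2 * k := by omega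
        have : x ≠ 2 * (k + 1) := by omega
        simp [RAM.State.setReg, *, hr₂ x (by omega), hr₁ x hx]
    · refine ⟨_, .seq he₁ (.seq he₂ (.seq (.sub ..) (.ifFalse ?_ (.const ..)))),
        hm₂.trans hm₁, ?_, fun x hx => ?_⟩
      · simp [RAM.State.setReg, hv₂, hr₂ (2 * k) (by omega), hv₁]
        omega
      · simp [RAM.State.setReg, eval]
        omega
      · have : x ≠ 2 * k := by omega
        simp [RAM.State.setReg, *, hr₂ x (by omega), hr₁ x hx]
  | get F p ih =>
    intro k σ h
    obtain ⟨σ₁, he₁, hm₁, hv₁, hr₁⟩ := ih (k := k) h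
    have h₁ := h.of_agree hm₁ fun x hx => hr₁ x (Or.inr hx)
    obtain ⟨σ₂, he₂, hm₂, hv₂, hr₂⟩ := exec_address F hv₁ h₁.base
    refine ⟨_, .seq he₁ (.seq he₂ (.load _ _ _ _ hv₂)), hm₂.trans hm₁, ?_, fun x hx => ?_⟩
    · simp [RAM.State.setReg, hm₂, h₁.fld, eval]
    · simp [RAM.State.setReg, show x ≠ 2 * k by omega,
        hr₂ x (by omega) (by omega), hr₁ x hx]

theorem Rep.set {I : IntConfig n} {s : Store} {σ : RAM.State} (h : Rep I s σ) (x : Var)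
    (m t : ℕ) : Rep I (s.set x m t) (σ.setReg x.reg m) where
  size := h.size
  var y := by
    by_cases hy : y = x
    · subst hy
      simp [RAM.State.setReg, Store.set]
    · have : y.reg ≠ x.reg := fun h => hy (Var.ctorIdx_injective (by
        simp only [Var.reg] at h
        omega))
      simp [RAM.State.setReg, Store.set, this, hy, h.var]
  base := by
    have : 1 ≠ x.reg := by simp only [Var.reg]; omega
    simp [RAM.State.setReg, this, h.base]
  fld := h.fld
  lo := h.lo
  io := h.io

theorem Rep.put {I : IntConfig n} {s : Store} {σ : RAM.State} (h : Rep I s σ) (F : Fld)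
    (i m t : ℕ) : Rep I (s.put F i m t) (σ.setMem (5 + 2 * n + 32 * i + F.ctorIdx) m) where
  size := h.size
  var := h.var
  base := h.base
  fld G j := by
    have hF := F.ctorIdx_lt
    have hG := G.ctorIdx_lt
    by_cases hGF : G = F
    · subst hGF
      by_cases hj : j = i
      · subst hj
        simp [RAM.State.setMem, Store.put]
      · simp [RAM.State.setMem, Store.put, hj, h.fld]
    · have hne : G.ctorIdx ≠ F.ctorIdx := fun h => hGF (Fld.ctorIdx_injective h)
      have : 5 + 2 * n + 32 * j + G.ctorIdx ≠ 5 + 2 * n + 32 * i + F.ctorIdx := by omega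
      simp [RAM.State.setMem, Store.put, this, hGF, h.fld]
  lo d := by
    have : 1 + 2 * (d : ℕ) ≠ 5 + 2 * n + 32 * i + F.ctorIdx := by omega
    simp [RAM.State.setMem, this, h.lo]
  io d e h1 h2 := by
    have : 3 + 2 * e + (d : ℕ) ≠ 5 + 2 * n + 32 * i + F.ctorIdx := by omega
    simp [RAM.State.setMem, this, h.io d e h1 h2, Store.put]

theorem Rep.out {I : IntConfig n} {s : Store} {σ : RAM.State} (h : Rep I s σ) (d : Fin 2)
    {e : ℕ} (h1 : 1 ≤ e) (h2 : e ≤ n) (m t : ℕ) :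
    Rep I (s.out d e m t) (σ.setMem (3 + 2 * e + d) (I.lo d + m)) where
  size := h.size
  var := h.var
  base := h.base
  fld G j := by
    have : 5 + 2 * n + 32 * j + G.ctorIdx ≠ 3 + 2 * e + d := by omega
    simp [RAM.State.setMem, Store.out, this, h.fld]
  lo d' := by
    have : 1 + 2 * (d' : ℕ) ≠ 3 + 2 * e + d := by omega
    simp [RAM.State.setMem, this, h.lo]
  io d' e' h1' h2' := by
    by_cases hd : d' = d
    · subst hd
      by_cases he : e' = e
      · subst he
        simp [RAM.State.setMem, Store.out]
      · simp [RAM.State.setMem, Store.out, he, h.io d' e' h1' h2']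
    · have : 3 + 2 * e' + (d' : ℕ) ≠ 3 + 2 * e + d := by omega
      simp [RAM.State.setMem, Store.out, this, hd, h.io d' e' h1' h2']

theorem exec_compileTest {I : IntConfig n} {s : Store} {σ : RAM.State} (h : Rep I s σ)
    (p q : Expr) : ∃ σ', Exec (compileTest p q) σ σ' (p.cost + q.cost + 1) ∧ Rep I s σ' ∧
      σ'.reg 0 = (q.eval s : ℤ) - p.eval s := by
  obtain ⟨σ₁, he₁, hm₁, hv₁, hr₁⟩ := q.exec_compile (k := 0) h
  have h₁ := h.of_agree hm₁ fun x hx => hr₁ x (Or.inr hx)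
  obtain ⟨σ₂, he₂, hm₂, hv₂, hr₂⟩ := p.exec_compile (k := 1) h₁
  have h₂ := h₁.of_agree hm₂ fun x hx => hr₂ x (Or.inr hx)
  refine ⟨σ₂.setReg 0 (σ₂.reg 0 - σ₂.reg 2), ?_, h₂.of_agree rfl fun x hx => ?_, ?_⟩
  · have : Exec (compileTest p q) σ _ _ := .seq he₁ (.seq he₂ (.sub ..))
    convert this using 1
    ring
  · have : x ≠ 0 := by omega
    simp [RAM.State.setReg, this]
  · have h0 := hr₂ 0 (by omega)
    simp only [Nat.mul_zero] at hv₁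
    simp only [Nat.mul_one] at hv₂
    simp [RAM.State.setReg, hv₂, h0, hv₁]

/-- The compiled program does what the weakest precondition promises, within the time on the
clock. -/
theorem exec_of_wp {I : IntConfig n} {P : Cmd} : ∀ {Q : Store → Prop} {s : Store}
    {σ : RAM.State}, wp P Q s → Rep I s σ →
    ∃ σ' s' t, Exec P.compile σ σ' t ∧ Rep I s' σ' ∧ s.clock + t ≤ s'.clock ∧ Q s' := by
  induction P with
  | set x p =>
    intro Q s σ hQ h
    obtain ⟨σ₁, he₁, hm₁, hv₁, hr₁⟩ := p.exec_compile (k := 0) h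
    have h₁ := h.of_agree hm₁ fun x hx => hr₁ x (Or.inr hx)
    refine ⟨_, _, _, .seq he₁ (.seq (.const ..) (.add ..)), ?_, ?_, hQ⟩
    · have h₂ : Rep I s (σ₁.setReg 2 0) := h₁.of_agree rfl fun y hy => by
        have : y ≠ 2 := by omega
        simp [RAM.State.setReg, this]
      have hv : (σ₁.setReg 2 0).reg 0 + (σ₁.setReg 2 0).reg 2 = (p.eval s : ℤ) := by
        simp only [Nat.mul_zero] at hv₁
        simp [RAM.State.setReg, hv₁]
      rw [hv]
      exact h₂.set x _ _
    · simp only [Store.set]; omega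
  | put F p q =>
    intro Q s σ hQ h
    obtain ⟨σ₁, he₁, hm₁, hv₁, hr₁⟩ := q.exec_compile (k := 0) h
    have h₁ := h.of_agree hm₁ fun x hx => hr₁ x (Or.inr hx)
    obtain ⟨σ₂, he₂, hm₂, hv₂, hr₂⟩ := p.exec_compile (k := 1) h₁
    have h₂ := h₁.of_agree hm₂ fun x hx => hr₂ x (Or.inr hx)
    obtain ⟨σ₃, he₃, hm₃, hv₃, hr₃⟩ := exec_address F hv₂ h₂.base
    have h₃ := h₂.of_agree hm₃ fun x hx => hr₃ x (by omega) (by omega)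
    refine ⟨_, _, _, .seq he₁ (.seq he₂ (.seq he₃ (.store 2 0 _ _ hv₃))), ?_, ?_, hQ⟩
    · have hv : σ₃.reg 0 = q.eval s := by
        rw [hr₃ 0 (by omega) (by omega), hr₂ 0 (by omega)]
        exact hv₁
      rw [hv]
      exact h₃.put F _ _ _
    · simp only [Store.put]; omega
  | inp x d p =>
    intro Q s σ hQ h
    obtain ⟨⟨hp1, hp2⟩, hQ⟩ := hQ
    obtain ⟨σ₁, he₁, hm₁, hv₁, hr₁⟩ := p.exec_compile (k := 0) h
    have h₁ := h.of_agree hm₁ fun x hx => hr₁ x (Or.inr hx)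
    simp only [Nat.mul_zero] at hv₁
    have hio := h₁.io d _ hp1 (h.size ▸ hp2)
    refine ⟨_, _, _, .seq he₁ (.seq (.add ..) (.seq (.const ..) (.seq (.add ..)
      (.seq (.load 0 0 (3 + 2 * p.eval s + d) _ ?_) (.seq (.const ..)
      (.seq (.load 2 2 (1 + 2 * d) _ ?_) (.sub ..))))))), ?_, ?_, hQ⟩
    · simp [RAM.State.setReg, hv₁]
      ring
    · simp [RAM.State.setReg]
    · have h₂ : ∀ a b c d e f g, Rep I s
          (((((((σ₁.setReg 0 a).setReg 2 b).setReg 0 c).setReg 0 d).setReg 2 e).setReg 2 f).setReg 0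
            g) := by
        intro a b c d e f g
        refine h₁.of_agree rfl fun y hy => ?_
        have h0 : y ≠ 0 := by omega
        have h2 : y ≠ 2 := by omega
        simp [RAM.State.setReg, h0, h2]
      refine Rep.of_agree (σ := (σ₁.setReg x.reg (s.io d (p.eval s) : ℕ))) (h₁.set x _ _) rfl
        fun y hy => ?_
      have h0 : y ≠ 0 := by omega
      have h2 : y ≠ 2 := by omega
      by_cases hyx : y = x.reg
      · subst hyx
        simp [RAM.State.setReg, hio, h₁.lo]
      · simp [RAM.State.setReg, h0, h2, hyx]
    · simp only [Store.set]; omega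
  | out d p q =>
    intro Q s σ hQ h
    obtain ⟨⟨hp1, hp2⟩, hQ⟩ := hQ
    obtain ⟨σ₁, he₁, hm₁, hv₁, hr₁⟩ := p.exec_compile (k := 0) h
    have h₁ := h.of_agree hm₁ fun x hx => hr₁ x (Or.inr hx)
    obtain ⟨σ₂, he₂, hm₂, hv₂, hr₂⟩ := q.exec_compile (k := 1) h₁
    have h₂ := h₁.of_agree hm₂ fun x hx => hr₂ x (Or.inr hx)
    simp only [Nat.mul_zero] at hv₁
    simp only [Nat.mul_one] at hv₂
    have hv₁' : σ₂.reg 0 = p.eval s := (hr₂ 0 (by omega)).trans hv₁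
    have hv2 : (((((σ₂.setReg 0 (σ₂.reg 0 + σ₂.reg 0)).setReg 4 (3 + d : ℕ)).setReg 0
      (p.eval s + p.eval s + (3 + d : ℕ))).setReg 4 (1 + 2 * d : ℕ)).setReg 4 (I.lo d)).reg 2 =
        q.eval s := by simp [RAM.State.setReg, hv₂]
    refine ⟨_, _, _, .seq he₁ (.seq he₂ (.seq (.add ..) (.seq (.const ..) (.seq (.add ..)
      (.seq (.const ..) (.seq (.load 4 4 (1 + 2 * d) _ ?_) (.seq (.add ..)
      (.store 0 2 (3 + 2 * p.eval s + d) _ ?_)))))))), ?_, ?_, hQ⟩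
    · simp [RAM.State.setReg]
    · simp [RAM.State.setReg, hv₁']
      ring
    · refine Rep.of_agree (σ := (σ₂.setMem (3 + 2 * p.eval s + d) (I.lo d + q.eval s)))
        (h₂.out d hp1 (h.size ▸ hp2) _ _) ?_ fun y hy => ?_
      · simp [RAM.State.setReg, RAM.State.setMem, hv₂, h₂.lo, add_comm]
      · have h0 : y ≠ 0 := by omega
        have h2 : y ≠ 2 := by omega
        have h4 : y ≠ 4 := by omega
        simp [RAM.State.setReg, RAM.State.setMem, h0, h2, h4]
    · simp only [Store.out]; omega
  | skip =>
    intro Q s σ hQ h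
    refine ⟨_, _, _, .const .., ?_, le_refl _, hQ⟩
    refine (h.tick 1).of_agree rfl fun y hy => ?_
    have h0 : y ≠ 0 := by omega
    simp [RAM.State.setReg, h0]
  | seq P R ihP ihR =>
    intro Q s σ hQ h
    obtain ⟨σ₁, s₁, t₁, he₁, h₁, ht₁, hQ₁⟩ := ihP hQ h
    obtain ⟨σ₂, s₂, t₂, he₂, h₂, ht₂, hQ₂⟩ := ihR hQ₁ h₁
    exact ⟨σ₂, s₂, _, .seq he₁ he₂, h₂, by omega, hQ₂⟩
  | ite p q P R ihP ihR =>
    intro Q s σ hQ h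
    obtain ⟨σ₁, he₁, h₁, hv₁⟩ := exec_compileTest h p q
    by_cases hpq : p.eval s < q.eval s
    · obtain ⟨σ₂, s₂, t₂, he₂, h₂, ht₂, hQ₂⟩ := ihP (hQ.1 hpq) (h₁.tick _)
      refine ⟨σ₂, s₂, _, .seq he₁ (.ifTrue (by omega) he₂), h₂, ?_, hQ₂⟩
      simp only [Store.tick] at ht₂
      omega
    · obtain ⟨σ₂, s₂, t₂, he₂, h₂, ht₂, hQ₂⟩ := ihR (hQ.2 hpq) (h₁.tick _)
      refine ⟨σ₂, s₂, _, .seq he₁ (.ifFalse (by omega) he₂), h₂, ?_, hQ₂⟩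
      simp only [Store.tick] at ht₂
      omega
  | loop p q P ih =>
    intro Q s σ hQ h
    obtain ⟨J, T, h0, h1⟩ := hQ
    obtain ⟨σ₁, he₁, h₁, hv₁⟩ := exec_compileTest h p q
    -- the clock advances in every iteration, so `T - clock` decreases
    have key : ∀ (m : ℕ) (s : Store) (σ : RAM.State), T - s.clock ≤ m → J s → Rep I s σ →
        σ.reg 0 = (q.eval s : ℤ) - p.eval s →
        ∃ σ' s' t, Exec (.whilePos 0 (.seq P.compile (compileTest p q))) σ σ' t ∧ Rep I s' σ' ∧
          s.clock + (p.cost + q.cost + 1) + t ≤ s'.clock ∧ Q s' := by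
      intro m
      induction m with
      | zero =>
        intro s σ hm hJ h hv
        obtain ⟨hT, hpos, hneg⟩ := h1 s hJ
        by_cases hpq : p.eval s < q.eval s
        · obtain ⟨σ₁, s₁, t₁, he₁, h₁, ht₁, hJ₁⟩ := ih (hpos hpq) (h.tick _)
          have hT₁ := (h1 s₁ hJ₁).1
          simp only [Store.tick] at ht₁
          omega
        · refine ⟨σ, _, 1, .whileFalse (by omega), h.tick _, ?_, hneg hpq⟩
          simp only [Store.tick]; omega
      | succ m ihm =>
        intro s σ hm hJ h hv
        obtain ⟨hT, hpos, hneg⟩ := h1 s hJ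
        by_cases hpq : p.eval s < q.eval s
        · obtain ⟨σ₁, s₁, t₁, he₁, h₁, ht₁, hJ₁⟩ := ih (hpos hpq) (h.tick _)
          simp only [Store.tick] at ht₁
          obtain ⟨σ₂, he₂, h₂, hv₂⟩ := exec_compileTest h₁ p q
          obtain ⟨σ₃, s₃, t₃, he₃, h₃, ht₃, hQ₃⟩ := ihm s₁ σ₂ (by omega) hJ₁ h₂ hv₂
          exact ⟨σ₃, s₃, _, .whileTrue (by omega) (.seq he₁ he₂) he₃, h₃, by omega, hQ₃⟩
        · refine ⟨σ, _, 1, .whileFalse (by omega), h.tick _, ?_, hneg hpq⟩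
          simp only [Store.tick]; omega
    obtain ⟨σ₂, s₂, t₂, he₂, h₂, ht₂, hQ₂⟩ := key _ s σ₁ le_rfl h0 h₁ hv₁
    exact ⟨σ₂, s₂, _, .seq he₁ he₂, h₂, by omega, hQ₂⟩

end Imp


/-! ### Edge lists of a bipartite multigraph -/

namespace Matching

/-- Edges `1, …, n` with ends `X e < a` (the row) and `Y e < b` (the column). -/
structure Graph (n a b : ℕ) (X Y : ℕ → ℕ) : Prop where
  row_lt : ∀ e, 1 ≤ e → e ≤ n → X e < a
  col_lt : ∀ e, 1 ≤ e → e ≤ n → Y e < b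

theorem Graph.symm {n a b : ℕ} {X Y : ℕ → ℕ} (h : Graph n a b X Y) : Graph n b a Y X :=
  ⟨h.col_lt, h.row_lt⟩

/-- The last edge up to `k` that starts in `i`, or `0`. -/
def last (X : ℕ → ℕ) (i : ℕ) : ℕ → ℕ
  | 0 => 0
  | k + 1 => if X (k + 1) = i then k + 1 else last X i k

/-- The number of edges up to `k` that start in `i`. -/
def cnt (X : ℕ → ℕ) (i k : ℕ) : ℕ := ((Finset.Icc 1 k).filter fun e => X e = i).card

theorem last_le (X : ℕ → ℕ) (i k : ℕ) : last X i k ≤ k := by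
  induction k with
  | zero => rfl
  | succ k ih => rw [last]; split_ifs <;> omega

theorem apply_last {X : ℕ → ℕ} {i k : ℕ} (h : last X i k ≠ 0) : X (last X i k) = i := by
  induction k with
  | zero => exact absurd rfl h
  | succ k ih =>
    rw [last] at h ⊢
    split_ifs at h ⊢ with hk
    · exact hk
    · exact ih h

theorem le_last {X : ℕ → ℕ} {i k e : ℕ} (h1 : 1 ≤ e) (hk : e ≤ k) (he : X e = i) :
    e ≤ last X i k := by
  induction k with
  | zero => omega
  | succ k ih =>
    rw [last]
    split_ifs with h
    · exact hk
    · refine ih ?_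
      by_contra hc
      exact h (by rwa [show k + 1 = e by omega])

theorem cnt_zero (X : ℕ → ℕ) (i : ℕ) : cnt X i 0 = 0 := rfl

theorem cnt_succ (X : ℕ → ℕ) (i k : ℕ) :
    cnt X i (k + 1) = cnt X i k + if X (k + 1) = i then 1 else 0 := by
  rw [cnt, ← Finset.insert_Icc_right_eq_Icc_add_one (by omega), Finset.filter_insert]
  split_ifs
  · rw [Finset.card_insert_of_notMem (by simp)]; rfl
  · rfl

theorem cnt_last (X : ℕ → ℕ) (i k : ℕ) : cnt X i (last X i k) = cnt X i k := by
  induction k with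
  | zero => rfl
  | succ k ih =>
    rw [last]
    split_ifs with h
    · rfl
    · rw [ih, cnt_succ, if_neg h, add_zero]

theorem cnt_eq_cnt_last_add_one {X : ℕ → ℕ} {i e : ℕ} (h1 : 1 ≤ e) (he : X e = i) :
    cnt X i e = cnt X i (last X i (e - 1)) + 1 := by
  obtain ⟨k, rfl⟩ : ∃ k, e = k + 1 := ⟨e - 1, by omega⟩
  rw [cnt_last, cnt_succ, if_pos he, Nat.add_sub_cancel]

theorem sum_cnt {n a b : ℕ} {X Y : ℕ → ℕ} (h : Graph n a b X Y) :
    ∑ i ∈ Finset.range a, cnt X i n = n := by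
  have := Finset.card_eq_sum_card_fiberwise (s := Finset.Icc 1 n) (t := Finset.range a) (f := X)
    fun e he => by
      have he := Finset.mem_Icc.mp (Finset.mem_coe.mp he)
      exact Finset.mem_coe.mpr (Finset.mem_range.mpr (h.row_lt e he.1 he.2))
  rw [Nat.card_Icc] at this
  simp only [cnt]
  omega

/-- Linked lists of the edges that start in each row. -/
structure Lists (n a : ℕ) (X nxt head : ℕ → ℕ) : Prop where
  nxt_eq : ∀ e, 1 ≤ e → e ≤ n → nxt e = last X (X e) (e - 1)
  head_eq : ∀ i, i < a → head i = last X i n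

/-- One summand drops by `w`, the others do not grow. -/
theorem sum_add_le_sum {s : Finset ℕ} {f g : ℕ → ℕ} {i w : ℕ} (hi : i ∈ s)
    (hw : f i + w ≤ g i) (hle : ∀ j ∈ s, j ≠ i → f j ≤ g j) :
    ∑ j ∈ s, f j + w ≤ ∑ j ∈ s, g j := by
  rw [← Finset.add_sum_erase s f hi, ← Finset.add_sum_erase s g hi]
  have := Finset.sum_le_sum fun j (hj : j ∈ s.erase i) =>
    hle j (Finset.mem_of_mem_erase hj) (Finset.ne_of_mem_erase hj)
  omega

/-! ### Matchings -/

/-- A matching: `mr i` is the edge at row `i`, and `mc j` the edge at column `j`; `0` stands for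
no edge. -/
structure IsMate (n a b : ℕ) (X Y mr mc : ℕ → ℕ) : Prop where
  row : ∀ i < a, mr i ≠ 0 → mr i ≤ n ∧ X (mr i) = i ∧ mc (Y (mr i)) = mr i
  col : ∀ j < b, mc j ≠ 0 → mc j ≤ n ∧ Y (mc j) = j ∧ mr (X (mc j)) = mc j

/-- The number of edges of a matching. -/
def matchSize (a : ℕ) (mr : ℕ → ℕ) : ℕ := ((Finset.range a).filter fun i => mr i ≠ 0).card

theorem IsMate.symm {n a b : ℕ} {X Y mr mc : ℕ → ℕ} (h : IsMate n a b X Y mr mc) :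
    IsMate n b a Y X mc mr := ⟨h.col, h.row⟩

theorem IsMate.zero (n a b : ℕ) (X Y : ℕ → ℕ) :
    IsMate n a b X Y (fun _ => 0) (fun _ => 0) :=
  ⟨fun _ _ h => absurd rfl h, fun _ _ h => absurd rfl h⟩

/-- Match the free row of the edge `e` along `e`; the present partner of its column becomes
free. -/
theorem IsMate.insert {n a b : ℕ} {X Y mr mc : ℕ → ℕ} (hG : Graph n a b X Y)
    (h : IsMate n a b X Y mr mc) {e : ℕ} (h1 : 1 ≤ e) (hn : e ≤ n) (hfree : mr (X e) = 0) :
    IsMate n a b X Y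
      (fun i => if i = X e then e else if mc (Y e) ≠ 0 ∧ i = X (mc (Y e)) then 0 else mr i)
      (fun j => if j = Y e then e else mc j) := by
  have hY := hG.col_lt e h1 hn
  constructor
  · intro i hi hne
    beta_reduce at hne ⊢
    by_cases hiX : i = X e
    · subst hiX
      simp [hn]
    · rw [if_neg hiX] at hne ⊢
      by_cases hd : mc (Y e) ≠ 0 ∧ i = X (mc (Y e))
      · rw [if_pos hd] at hne
        exact absurd rfl hne
      · rw [if_neg hd] at hne ⊢
        obtain ⟨h2, h3, h4⟩ := h.row i hi hne
        refine ⟨h2, h3, ?_⟩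
        by_cases hj : Y (mr i) = Y e
        · exfalso
          rw [hj] at h4
          exact hd ⟨by rw [h4]; exact hne, by rw [h4, h3]⟩
        · rw [if_neg hj, h4]
  · intro j hj hne
    beta_reduce at hne ⊢
    by_cases hjY : j = Y e
    · subst hjY
      simp [hn]
    · rw [if_neg hjY] at hne ⊢
      obtain ⟨h2, h3, h4⟩ := h.col j hj hne
      refine ⟨h2, h3, ?_⟩
      have hX : X (mc j) ≠ X e := fun hX => hne (by rw [← h4, hX, hfree])
      rw [if_neg hX, if_neg, h4]
      rintro ⟨h5, h6⟩
      have h7 := (h.col (Y e) hY h5).2.2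
      rw [← h6, h4] at h7
      exact hjY (by rw [← h3, h7]; exact (h.col (Y e) hY h5).2.1)

/-- Sums over matched columns are sums over matched rows. -/
theorem IsMate.sum_eq {n a b : ℕ} {X Y mr mc : ℕ → ℕ} (hG : Graph n a b X Y)
    (h : IsMate n a b X Y mr mc) (g : ℕ → ℕ) :
    ∑ i ∈ (Finset.range a).filter (fun i => mr i ≠ 0), g (Y (mr i)) =
      ∑ j ∈ (Finset.range b).filter (fun j => mc j ≠ 0), g j := by
  refine Finset.sum_bij' (fun i _ => Y (mr i)) (fun j _ => X (mc j)) ?_ ?_ ?_ ?_ fun _ _ => rfl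
  · intro i hi
    simp only [Finset.mem_filter, Finset.mem_range] at hi ⊢
    obtain ⟨h1, h2, h3⟩ := h.row i hi.1 hi.2
    exact ⟨hG.col_lt _ (Nat.pos_of_ne_zero hi.2) h1, by rw [h3]; exact hi.2⟩
  · intro j hj
    simp only [Finset.mem_filter, Finset.mem_range] at hj ⊢
    obtain ⟨h1, h2, h3⟩ := h.col j hj.1 hj.2
    exact ⟨hG.row_lt _ (Nat.pos_of_ne_zero hj.2) h1, by rw [h3]; exact hj.2⟩
  · intro i hi
    simp only [Finset.mem_filter, Finset.mem_range] at hi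
    obtain ⟨h1, h2, h3⟩ := h.row i hi.1 hi.2
    rw [h3, h2]
  · intro j hj
    simp only [Finset.mem_filter, Finset.mem_range] at hj
    obtain ⟨h1, h2, h3⟩ := h.col j hj.1 hj.2
    rw [h3, h2]

theorem matchSize_le (a : ℕ) (mr : ℕ → ℕ) : matchSize a mr ≤ a := by
  exact (Finset.card_filter_le _ _).trans (Finset.card_range a).le

/-! ### The auction

Rows bid for columns. The price of a column rises by one with each bid that it accepts. A row
bids at its level, which is at most the least price among its neighbours, and drops out when its
level reaches `L`. Prices and levels form a dual solution, which shows that at most a fraction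
`1 / L` of a maximum matching is missing at the end. -/

/-- The state of the auction between two steps. `pt i` is the first edge of row `i` that has not
been examined at the present level; the rows after `i0` have not started, and row `cur` is about to
bid, unless `i0 = a`. -/
structure Auction (n a b : ℕ) (X Y : ℕ → ℕ) (L : ℕ) (mr mc pr lv pt : ℕ → ℕ) (i0 cur : ℕ) :
    Prop where
  mate : IsMate n a b X Y mr mc
  lv_le : ∀ i < a, lv i ≤ L
  pr_le : ∀ j < b, pr j ≤ L
  edge : ∀ e, 1 ≤ e → e ≤ n → lv (X e) ≤ pr (Y e)
  scanned : ∀ e, 1 ≤ e → e ≤ n → pt (X e) < e → lv (X e) < pr (Y e)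
  matched : ∀ i < a, mr i ≠ 0 → pr (Y (mr i)) = lv i + 1
  free_col : ∀ j < b, mc j = 0 → pr j = 0
  pt_valid : ∀ i < a, pt i ≠ 0 → pt i ≤ n ∧ X (pt i) = i
  cur_le : cur ≤ i0
  le_rows : i0 ≤ a
  active : i0 < a → mr cur = 0 ∧ lv cur < L
  dropped : ∀ i < a, i ≤ i0 → i ≠ cur → mr i = 0 → lv i = L
  later : ∀ i < a, i0 < i → mr i = 0 ∧ lv i = 0
  cur_eq : i0 = a → cur = a

/-- The number of steps that the auction can still take, apart from the starts of rows. -/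
def auctionPot (n a L : ℕ) (X lv pt : ℕ → ℕ) : ℕ :=
  ∑ i ∈ Finset.range a, ((L - lv i) * (cnt X i n + 1) + cnt X i (pt i))

namespace Auction

variable {n a b L i0 cur : ℕ} {X Y nxt head mr mc pr lv pt : ℕ → ℕ}

/-- The row `cur` has examined all its edges and raises its level. -/
theorem raise_level (hl : Lists n a X nxt head)
    (h : Auction n a b X Y L mr mc pr lv pt i0 cur) (hi0 : i0 < a) (hpt : pt cur = 0) :
    (lv cur + 1 < L → Auction n a b X Y L mr mc pr (Function.update lv cur (lv cur + 1))
      (Function.update pt cur (head cur)) i0 cur) ∧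
    (¬ lv cur + 1 < L → Auction n a b X Y L mr mc pr (Function.update lv cur (lv cur + 1))
      (Function.update pt cur (head cur)) (i0 + 1) (i0 + 1)) ∧
    auctionPot n a L X (Function.update lv cur (lv cur + 1))
      (Function.update pt cur (head cur)) + 1 ≤ auctionPot n a L X lv pt := by
  have hcur : cur < a := by have := h.cur_le; omega
  obtain ⟨hmr, hlv⟩ := h.active hi0
  have hedge : ∀ e, 1 ≤ e → e ≤ n → Function.update lv cur (lv cur + 1) (X e) ≤ pr (Y e) := by
    intro e h1 h2
    by_cases hX : X e = cur
    · have := h.scanned e h1 h2 (by rw [hX, hpt]; exact h1)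
      rw [hX] at this ⊢
      simpa using this
    · rw [Function.update_of_ne hX]; exact h.edge e h1 h2
  have hscan : ∀ e, 1 ≤ e → e ≤ n → Function.update pt cur (head cur) (X e) < e →
      Function.update lv cur (lv cur + 1) (X e) < pr (Y e) := by
    intro e h1 h2 h3
    by_cases hX : X e = cur
    · rw [hX, Function.update_self, hl.head_eq cur hcur] at h3
      have := le_last h1 h2 hX
      omega
    · rw [Function.update_of_ne hX] at h3 ⊢; exact h.scanned e h1 h2 h3
  have hmatched : ∀ i < a, mr i ≠ 0 →
      pr (Y (mr i)) = Function.update lv cur (lv cur + 1) i + 1 := by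
    intro i hi h1
    rw [Function.update_of_ne (by rintro rfl; exact h1 hmr)]
    exact h.matched i hi h1
  have hvalid : ∀ i < a, Function.update pt cur (head cur) i ≠ 0 →
      Function.update pt cur (head cur) i ≤ n ∧ X (Function.update pt cur (head cur) i) = i := by
    intro i hi h1
    by_cases hic : i = cur
    · subst hic
      rw [Function.update_self, hl.head_eq i hi] at h1 ⊢
      exact ⟨last_le _ _ _, apply_last h1⟩
    · rw [Function.update_of_ne hic] at h1 ⊢
      exact h.pt_valid i hi h1
  have hle : ∀ i < a, Function.update lv cur (lv cur + 1) i ≤ L := by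
    intro i hi
    by_cases hic : i = cur
    · subst hic; rw [Function.update_self]; omega
    · rw [Function.update_of_ne hic]; exact h.lv_le i hi
  have hlater : ∀ i < a, i0 < i → mr i = 0 ∧ Function.update lv cur (lv cur + 1) i = 0 := by
    intro i hi h1
    rw [Function.update_of_ne (by have := h.cur_le; omega)]
    exact h.later i hi h1
  refine ⟨fun hlt => ⟨h.mate, hle, h.pr_le, hedge, hscan, hmatched, h.free_col, hvalid, h.cur_le,
    h.le_rows, fun _ => ⟨hmr, by simpa using hlt⟩, fun i hi h1 h2 h3 => ?_, hlater, h.cur_eq⟩,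
    fun hlt => ⟨h.mate, hle, h.pr_le, hedge, hscan, hmatched, h.free_col, hvalid, le_rfl,
    hi0, fun hi => ?_, fun i hi h1 h2 h3 => ?_, fun i hi h1 => hlater i hi (by omega), id⟩, ?_⟩
  · rw [Function.update_of_ne h2]
    exact h.dropped i hi h1 h2 h3
  · have := hlater _ hi (by omega)
    omega
  · by_cases hic : i = cur
    · subst hic; rw [Function.update_self]; omega
    · rw [Function.update_of_ne hic]
      exact h.dropped i hi (by omega) hic h3
  · refine sum_add_le_sum (Finset.mem_range.mpr hcur) ?_ fun i _ hic => ?_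
    · rw [Function.update_self, Function.update_self, hl.head_eq cur hcur, cnt_last, hpt, cnt_zero]
      obtain ⟨m, hm⟩ : ∃ m, L - lv cur = m + 1 := ⟨L - lv cur - 1, by omega⟩
      rw [show L - (lv cur + 1) = m by omega, hm]
      ring_nf
      rfl
    · rw [Function.update_of_ne hic, Function.update_of_ne hic]

/-- The next edge leads to a column whose price is above the level. -/
theorem skip (hl : Lists n a X nxt head)
    (h : Auction n a b X Y L mr mc pr lv pt i0 cur) (hi0 : i0 < a) (hpt : pt cur ≠ 0)
    (hpr : lv cur < pr (Y (pt cur))) :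
    Auction n a b X Y L mr mc pr lv (Function.update pt cur (nxt (pt cur))) i0 cur ∧
    auctionPot n a L X lv (Function.update pt cur (nxt (pt cur))) + 1 ≤
      auctionPot n a L X lv pt := by
  have hcur : cur < a := by have := h.cur_le; omega
  obtain ⟨hn, hX⟩ := h.pt_valid cur hcur hpt
  have hnxt : nxt (pt cur) = last X cur (pt cur - 1) := by
    rw [hl.nxt_eq _ (Nat.pos_of_ne_zero hpt) hn, hX]
  refine ⟨{ h with scanned := fun e h1 h2 h3 => ?_, pt_valid := fun i hi h1 => ?_ }, ?_⟩
  · by_cases hXe : X e = cur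
    · rw [hXe, Function.update_self, hnxt] at h3
      rcases lt_trichotomy e (pt cur) with hlt | heq | hgt
      · have := le_last (k := pt cur - 1) h1 (by omega) hXe
        omega
      · rw [heq, hX]; exact hpr
      · exact h.scanned e h1 h2 (by rwa [hXe])
    · rw [Function.update_of_ne hXe] at h3; exact h.scanned e h1 h2 h3
  · by_cases hic : i = cur
    · subst hic
      rw [Function.update_self, hnxt] at h1 ⊢
      exact ⟨(last_le _ _ _).trans (by omega), apply_last h1⟩
    · rw [Function.update_of_ne hic] at h1 ⊢
      exact h.pt_valid i hi h1
  · refine sum_add_le_sum (Finset.mem_range.mpr hcur) ?_ fun i _ hic => ?_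
    · rw [Function.update_self, hnxt,
        cnt_eq_cnt_last_add_one (i := cur) (Nat.pos_of_ne_zero hpt) hX]
      omega
    · rw [Function.update_of_ne hic]

/-- The row `cur` takes the column `j` at the end of its next edge; the previous partner of the
column, if there is one, gets the turn. -/
theorem bid (hG : Graph n a b X Y) (hl : Lists n a X nxt head)
    (h : Auction n a b X Y L mr mc pr lv pt i0 cur) (hi0 : i0 < a) (hpt : pt cur ≠ 0)
    (hpr : ¬ lv cur < pr (Y (pt cur))) :
    (mc (Y (pt cur)) = 0 → Auction n a b X Y L (Function.update mr cur (pt cur))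
      (Function.update mc (Y (pt cur)) (pt cur))
      (Function.update pr (Y (pt cur)) (lv cur + 1)) lv
      (Function.update pt cur (nxt (pt cur))) (i0 + 1) (i0 + 1)) ∧
    (mc (Y (pt cur)) ≠ 0 → Auction n a b X Y L
      (Function.update (Function.update mr cur (pt cur)) (X (mc (Y (pt cur)))) 0)
      (Function.update mc (Y (pt cur)) (pt cur))
      (Function.update pr (Y (pt cur)) (lv cur + 1)) lv
      (Function.update pt cur (nxt (pt cur))) i0 (X (mc (Y (pt cur))))) ∧
    auctionPot n a L X lv (Function.update pt cur (nxt (pt cur))) + 1 ≤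
      auctionPot n a L X lv pt := by
  have hcur : cur < a := by have := h.cur_le; omega
  obtain ⟨hn, hX⟩ := h.pt_valid cur hcur hpt
  obtain ⟨hmr, hlv⟩ := h.active hi0
  set e := pt cur with he
  have he1 : 1 ≤ e := Nat.pos_of_ne_zero hpt
  have hY := hG.col_lt e he1 hn
  have hpre : pr (Y e) = lv cur := by
    have := h.edge e he1 hn
    rw [hX] at this
    omega
  have hins := h.mate.insert hG he1 hn (by rw [hX]; exact hmr)
  have hmono : ∀ j, pr j ≤ Function.update pr (Y e) (lv cur + 1) j := by
    intro j
    by_cases hj : j = Y e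
    · subst hj; rw [Function.update_self]; omega
    · rw [Function.update_of_ne hj]
  have hprle : ∀ j < b, Function.update pr (Y e) (lv cur + 1) j ≤ L := by
    intro j hj
    by_cases hjY : j = Y e
    · subst hjY; rw [Function.update_self]; omega
    · rw [Function.update_of_ne hjY]; exact h.pr_le j hj
  have hscan : ∀ e', 1 ≤ e' → e' ≤ n → Function.update pt cur (nxt e) (X e') < e' →
      lv (X e') < Function.update pr (Y e) (lv cur + 1) (Y e') := by
    intro e' h1 h2 h3
    by_cases hXe : X e' = cur
    · rw [hXe, Function.update_self, hl.nxt_eq _ he1 hn, hX] at h3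
      rcases lt_trichotomy e' e with hlt | heq | hgt
      · have := le_last (k := e - 1) h1 (by omega) hXe
        omega
      · rw [heq, hX, Function.update_self]; omega
      · exact (h.scanned e' h1 h2 (by rwa [hXe])).trans_le (hmono _)
    · rw [Function.update_of_ne hXe] at h3
      exact (h.scanned e' h1 h2 h3).trans_le (hmono _)
  have hvalid : ∀ i < a, Function.update pt cur (nxt e) i ≠ 0 →
      Function.update pt cur (nxt e) i ≤ n ∧ X (Function.update pt cur (nxt e) i) = i := by
    intro i hi h1
    by_cases hic : i = cur
    · subst hic
      rw [Function.update_self, hl.nxt_eq _ he1 hn, hX] at h1 ⊢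
      exact ⟨(last_le _ _ _).trans (by omega), apply_last h1⟩
    · rw [Function.update_of_ne hic] at h1 ⊢
      exact h.pt_valid i hi h1
  have hmc : (fun j => if j = Y e then e else mc j) = Function.update mc (Y e) e := by
    ext j
    rw [Function.update_apply]
  have hfree : ∀ j < b, Function.update mc (Y e) e j = 0 →
      Function.update pr (Y e) (lv cur + 1) j = 0 := by
    intro j hj h1
    by_cases hjY : j = Y e
    · subst hjY; rw [Function.update_self] at h1; omega
    · rw [Function.update_of_ne hjY] at h1 ⊢; exact h.free_col j hj h1
  refine ⟨fun h0 => ?_, fun h0 => ?_, ?_⟩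
  · have hmr' : (fun i => if i = X e then e else if mc (Y e) ≠ 0 ∧ i = X (mc (Y e)) then 0
        else mr i) = Function.update mr cur e := by
      ext i
      rw [Function.update_apply, hX]
      simp [h0]
    rw [hmc, hmr'] at hins
    refine ⟨hins, h.lv_le, hprle, fun e' h1 h2 => (h.edge e' h1 h2).trans (hmono _), hscan,
      fun i hi h1 => ?_, hfree, hvalid, le_rfl, hi0, fun hi => ?_, fun i hi h1 h2 h3 => ?_,
      fun i hi h1 => ?_, id⟩
    · by_cases hic : i = cur
      · subst hic; simp
      · rw [Function.update_of_ne hic] at h1 ⊢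
        rw [Function.update_of_ne]
        · exact h.matched i hi h1
        · intro hYe
          have := (h.mate.row i hi h1).2.2
          rw [hYe, h0] at this
          exact h1 this.symm
    · have h1 := h.later _ hi (by omega)
      have h2 := h.cur_le
      rw [Function.update_of_ne (by omega)]
      omega
    · by_cases hic : i = cur
      · subst hic; rw [Function.update_self] at h3; omega
      · rw [Function.update_of_ne hic] at h3
        exact h.dropped i hi (by omega) hic h3
    · have h2 := h.cur_le
      rw [Function.update_of_ne (by omega)]
      exact h.later i hi (by omega)
  · obtain ⟨h1, h2, h3⟩ := h.mate.col _ hY h0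
    have ho1 : 1 ≤ mc (Y e) := Nat.pos_of_ne_zero h0
    have hoa : X (mc (Y e)) < a := hG.row_lt _ ho1 h1
    have hne : X (mc (Y e)) ≠ cur := fun hc => h0 (by rw [← h3, hc, hmr])
    have hmr' : (fun i => if i = X e then e else if mc (Y e) ≠ 0 ∧ i = X (mc (Y e)) then 0
        else mr i) = Function.update (Function.update mr cur e) (X (mc (Y e))) 0 := by
      ext i
      rw [Function.update_apply, Function.update_apply, hX]
      by_cases hic : i = cur
      · subst hic; simp [hne.symm]
      · simp [hic, h0]
    rw [hmc, hmr'] at hins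
    have hmo : pr (Y e) = lv (X (mc (Y e))) + 1 := by
      have := h.matched _ hoa (by rw [h3]; exact h0)
      rwa [h3, h2] at this
    have hoi : X (mc (Y e)) ≤ i0 := by
      by_contra hc
      have := (h.later _ hoa (by omega)).1
      rw [h3] at this
      exact h0 this
    refine ⟨hins, h.lv_le, hprle, fun e' h1 h2 => (h.edge e' h1 h2).trans (hmono _), hscan,
      fun i hi h1 => ?_, hfree, hvalid, hoi, h.le_rows, fun hi => ?_, fun i hi h1 h2 h3 => ?_,
      fun i hi h1 => ?_, fun hi => absurd hi hi0.ne⟩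
    · by_cases hio : i = X (mc (Y e))
      · subst hio; rw [Function.update_self] at h1; exact absurd rfl h1
      · rw [Function.update_of_ne hio] at h1 ⊢
        by_cases hic : i = cur
        · subst hic; simp
        · rw [Function.update_of_ne hic] at h1 ⊢
          rw [Function.update_of_ne]
          · exact h.matched i hi h1
          · intro hYe
            have := h.mate.row i hi h1
            rw [hYe] at this
            exact hio (by rw [this.2.2, this.2.1])
    · rw [Function.update_self]
      exact ⟨rfl, by omega⟩
    · rw [Function.update_of_ne h2] at h3
      by_cases hic : i = cur
      · subst hic; rw [Function.update_self] at h3; omega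
      · rw [Function.update_of_ne hic] at h3
        exact h.dropped i hi h1 hic h3
    · have h2 := h.cur_le
      rw [Function.update_of_ne (by omega), Function.update_of_ne (by omega)]
      exact h.later i hi h1
  · refine sum_add_le_sum (Finset.mem_range.mpr hcur) ?_ fun i _ hic => ?_
    · rw [Function.update_self, hl.nxt_eq _ he1 hn, hX, ← he,
        cnt_eq_cnt_last_add_one (i := cur) (e := e) he1 hX]
      omega
    · rw [Function.update_of_ne hic]

theorem start (hG : Graph n a b X Y) (hL : 0 < L) (hl : Lists n a X nxt head)
    (hpt : ∀ i < a, pt i = head i) :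
    Auction n a b X Y L (fun _ => 0) (fun _ => 0) (fun _ => 0) (fun _ => 0) pt 0 0 := by
  refine ⟨IsMate.zero _ _ _ _ _, fun _ _ => Nat.zero_le _, fun _ _ => Nat.zero_le _,
    fun _ _ _ => le_rfl, fun e h1 h2 h3 => ?_, fun _ _ h => absurd rfl h, fun _ _ _ => rfl,
    fun i hi h1 => ?_, le_rfl, Nat.zero_le _, fun _ => ⟨rfl, hL⟩,
    fun i _ h1 h2 _ => absurd (Nat.le_zero.mp h1) h2, fun _ _ _ => ⟨rfl, rfl⟩, id⟩
  · have hX := hG.row_lt e h1 h2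
    rw [hpt _ hX, hl.head_eq _ hX] at h3
    have := le_last h1 h2 (rfl : X e = X e)
    omega
  · rw [hpt i hi, hl.head_eq i hi] at h1 ⊢
    exact ⟨last_le _ _ _, apply_last h1⟩

theorem pot_start (hG : Graph n a b X Y) (hl : Lists n a X nxt head)
    (hpt : ∀ i < a, pt i = head i) :
    auctionPot n a L X (fun _ => 0) pt = L * (n + a) + n := by
  have : auctionPot n a L X (fun _ => 0) pt =
      ∑ i ∈ Finset.range a, (L * (cnt X i n + 1) + cnt X i n) := by
    refine Finset.sum_congr rfl fun i hi => ?_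
    rw [hpt i (Finset.mem_range.mp hi), hl.head_eq i (Finset.mem_range.mp hi), cnt_last,
      Nat.sub_zero]
  rw [this, Finset.sum_add_distrib, ← Finset.mul_sum, Finset.sum_add_distrib, sum_cnt hG]
  simp

/-- When the auction is over, the complementary slackness of prices and levels bounds every other
matching. -/
theorem matchSize_le (hG : Graph n a b X Y) (h : Auction n a b X Y L mr mc pr lv pt a cur)
    {mr' mc' : ℕ → ℕ} (h' : IsMate n a b X Y mr' mc') :
    L * matchSize a mr' ≤ matchSize a mr * (L + 1) := by
  -- the prices sum to `∑ (lv i + 1)` over the matched rows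
  have hpr : ∑ j ∈ Finset.range b, pr j =
      ∑ i ∈ (Finset.range a).filter (fun i => mr i ≠ 0), (lv i + 1) := by
    have h1 := h.mate.sum_eq hG pr
    have h2 : ∑ j ∈ (Finset.range b).filter (fun j => mc j ≠ 0), pr j =
        ∑ j ∈ Finset.range b, pr j := by
      rw [Finset.sum_filter]
      refine Finset.sum_congr rfl fun j hj => ?_
      split_ifs with hc
      · rfl
      · rw [h.free_col j (Finset.mem_range.mp hj) (not_not.mp hc)]
    rw [← h2, ← h1]
    refine Finset.sum_congr rfl fun i hi => ?_
    simp only [Finset.mem_filter, Finset.mem_range] at hi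
    exact h.matched i hi.1 hi.2
  -- rows that are not matched have reached level `L`
  have hlv : ∑ i ∈ Finset.range a, (L - lv i) =
      ∑ i ∈ (Finset.range a).filter (fun i => mr i ≠ 0), (L - lv i) := by
    rw [Finset.sum_filter]
    refine Finset.sum_congr rfl fun i hi => ?_
    split_ifs with hc
    · rfl
    · have hi := Finset.mem_range.mp hi
      have hcur := h.cur_eq rfl
      rw [h.dropped i hi hi.le (by omega) (not_not.mp hc), Nat.sub_self]
  have hsum : ∑ i ∈ (Finset.range a).filter (fun i => mr' i ≠ 0), L ≤
      ∑ i ∈ (Finset.range a).filter (fun i => mr' i ≠ 0), (pr (Y (mr' i)) + (L - lv i)) := by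
    refine Finset.sum_le_sum fun i hi => ?_
    simp only [Finset.mem_filter, Finset.mem_range] at hi
    obtain ⟨h1, h2, h3⟩ := h'.row i hi.1 hi.2
    have := h.edge _ (Nat.pos_of_ne_zero hi.2) h1
    rw [h2] at this
    omega
  have h1 : ∑ i ∈ (Finset.range a).filter (fun i => mr' i ≠ 0), pr (Y (mr' i)) ≤
      ∑ j ∈ Finset.range b, pr j := by
    rw [h'.sum_eq hG pr]
    exact Finset.sum_le_sum_of_subset (Finset.filter_subset _ _)
  have h2 : ∑ i ∈ (Finset.range a).filter (fun i => mr' i ≠ 0), (L - lv i) ≤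
      ∑ i ∈ Finset.range a, (L - lv i) :=
    Finset.sum_le_sum_of_subset (Finset.filter_subset _ _)
  have h3 : ∑ i ∈ (Finset.range a).filter (fun i => mr i ≠ 0), (lv i + 1) +
      ∑ i ∈ (Finset.range a).filter (fun i => mr i ≠ 0), (L - lv i) =
      matchSize a mr * (L + 1) := by
    rw [← Finset.sum_add_distrib, matchSize, ← smul_eq_mul, ← Finset.sum_const]
    refine Finset.sum_congr rfl fun i hi => ?_
    simp only [Finset.mem_filter, Finset.mem_range] at hi
    have := h.lv_le i hi.1
    omega
  rw [Finset.sum_const, smul_eq_mul, Finset.sum_add_distrib] at hsum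
  rw [matchSize, mul_comm]
  omega

end Auction

end Matching


/-! ### Augmenting paths -/

namespace Matching

theorem matchSize_update_of_ne {a : ℕ} {mr : ℕ → ℕ} {i e : ℕ} (h : mr i ≠ 0)
    (he : e ≠ 0) : matchSize a (Function.update mr i e) = matchSize a mr := by
  rw [matchSize, matchSize]
  congr 1
  refine Finset.filter_congr fun i' _ => ?_
  by_cases hi' : i' = i
  · subst hi'; simp [h, he]
  · rw [Function.update_of_ne hi']

theorem matchSize_update_of_eq {a : ℕ} {mr : ℕ → ℕ} {i e : ℕ} (hi : i < a) (h : mr i = 0)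
    (he : e ≠ 0) : matchSize a (Function.update mr i e) = matchSize a mr + 1 := by
  rw [matchSize, matchSize, ← Finset.card_insert_of_notMem (a := i) (by simp [h])]
  congr 1
  ext i'
  by_cases hi' : i' = i
  · subst hi'; simp [hi, he]
  · simp [hi']

/-- The search tree below rank `m`. A column `j` is visited if its stamp `vis j` exceeds `base`; it
has been reached along the edge `par j` from a row that is free or matched to a column visited
before. -/
def Chain (n b : ℕ) (X Y mr : ℕ → ℕ) (base : ℕ) (vis par : ℕ → ℕ) (m : ℕ) : Prop :=
  ∀ j < b, base < vis j → vis j ≤ m → (1 ≤ par j ∧ par j ≤ n ∧ Y (par j) = j) ∧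
    (mr (X (par j)) ≠ 0 → base < vis (Y (mr (X (par j)))) ∧ vis (Y (mr (X (par j)))) < vis j)

/-- The state of the augmentation: the column `j` is free and is the end of an alternating path
that starts in a free row. -/
structure Augmenting (n a b : ℕ) (X Y mr mc : ℕ → ℕ) (base : ℕ) (vis par : ℕ → ℕ) (j : ℕ) :
    Prop where
  mate : IsMate n a b X Y mr mc
  lt : j < b
  free : mc j = 0
  visited : base < vis j
  chain : Chain n b X Y mr base vis par (vis j)

namespace Augmenting

variable {n a b base j : ℕ} {X Y mr mc vis par : ℕ → ℕ}

theorem par_spec (h : Augmenting n a b X Y mr mc base vis par j) :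
    1 ≤ par j ∧ par j ≤ n ∧ Y (par j) = j :=
  (h.chain j h.lt h.visited le_rfl).1

theorem insert (hG : Graph n a b X Y) (h : Augmenting n a b X Y mr mc base vis par j) :
    IsMate n a b X Y (Function.update mr (X (par j)) (par j))
      (fun j' => if j' = j then par j else
        if mr (X (par j)) ≠ 0 ∧ j' = Y (mr (X (par j))) then 0 else mc j') := by
  obtain ⟨h1, h2, h3⟩ := h.par_spec
  have := (h.mate.symm.insert hG.symm h1 h2 (by rw [h3]; exact h.free)).symm
  rw [h3] at this
  convert this using 1
  ext i
  rw [Function.update_apply]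

/-- The path ends in a free row. -/
theorem finish (hG : Graph n a b X Y) (h : Augmenting n a b X Y mr mc base vis par j)
    (h0 : mr (X (par j)) = 0) :
    IsMate n a b X Y (Function.update mr (X (par j)) (par j)) (Function.update mc j (par j)) ∧
      matchSize a (Function.update mr (X (par j)) (par j)) = matchSize a mr + 1 := by
  obtain ⟨h1, h2, h3⟩ := h.par_spec
  refine ⟨?_, matchSize_update_of_eq (hG.row_lt _ h1 h2) h0 (by omega)⟩
  convert h.insert hG using 1
  ext j'
  simp [Function.update_apply, h0]

/-- The row on the path gives up its column. -/
theorem step (hG : Graph n a b X Y) (h : Augmenting n a b X Y mr mc base vis par j)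
    (h0 : mr (X (par j)) ≠ 0) :
    Augmenting n a b X Y (Function.update mr (X (par j)) (par j))
        (Function.update (Function.update mc j (par j)) (Y (mr (X (par j)))) 0)
        base vis par (Y (mr (X (par j)))) ∧
      vis (Y (mr (X (par j)))) < vis j ∧
      matchSize a (Function.update mr (X (par j)) (par j)) = matchSize a mr := by
  obtain ⟨h1, h2, h3⟩ := h.par_spec
  have hXa := hG.row_lt _ h1 h2
  obtain ⟨h4, h5, h6⟩ := h.mate.row _ hXa h0
  obtain ⟨h7, h8⟩ := (h.chain j h.lt h.visited le_rfl).2 h0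
  have hne : Y (mr (X (par j))) ≠ j := fun hc => by rw [hc] at h8; omega
  refine ⟨⟨?_, hG.col_lt _ (by omega) h4, by simp, h7, ?_⟩, h8,
    matchSize_update_of_ne h0 (by omega)⟩
  · convert h.insert hG using 1
    ext j'
    by_cases hj : j' = j
    · subst hj; simp [Function.update_of_ne hne.symm]
    · by_cases hj' : j' = Y (mr (X (par j)))
      · subst hj'; simp [h0, hj]
      · simp [hj, hj']
  · intro j' hj1 hj2 hj3
    obtain ⟨hp, hq⟩ := h.chain j' hj1 hj2 (by omega)
    refine ⟨hp, ?_⟩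
    have hX : X (par j') ≠ X (par j) := fun hc => by
      rw [hc] at hq
      have := hq h0
      omega
    rw [Function.update_of_ne hX]
    exact hq

end Augmenting

/-! ### The search for an augmenting path -/

/-- The state of the search. The queue `qu` holds the rows reached so far, among them all free rows;
those before position `qh` have been taken out, and their edges lead to visited columns, except for
the edges of the last one from the edge `e` on, down its list. -/
structure Search (n a b : ℕ) (X Y mr mc : ℕ → ℕ) (base : ℕ) (vis par qu : ℕ → ℕ)
    (st qh qt e : ℕ) : Prop where
  mate : IsMate n a b X Y mr mc
  base_le : base ≤ st
  vis_le : ∀ j < b, vis j ≤ st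
  qh_le : qh ≤ qt
  queue : ∀ p < qt, qu p < a ∧ (mr (qu p) = 0 ∨ base < vis (Y (mr (qu p))))
  free : ∀ i < a, mr i = 0 → ∃ p < qt, qu p = i
  chain : Chain n b X Y mr base vis par st
  partner : ∀ j < b, base < vis j → mc j ≠ 0 ∧ ∃ p < qt, qu p = X (mc j)
  scanned : ∀ p < qh, ∀ e', 1 ≤ e' → e' ≤ n → X e' = qu p →
    base < vis (Y e') ∨ (p + 1 = qh ∧ e' ≤ e)
  edge : e ≠ 0 → e ≤ n ∧ 1 ≤ qh ∧ X e = qu (qh - 1)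

/-- The number of edges to be examined if row `i` is not yet reached. -/
def searchWeight (n : ℕ) (X Y mr : ℕ → ℕ) (base : ℕ) (vis : ℕ → ℕ) (i : ℕ) : ℕ :=
  if mr i = 0 ∨ base < vis (Y (mr i)) then 0 else cnt X i n + 1

/-- The number of steps that the search can still take. -/
def searchPot (n a : ℕ) (X Y mr : ℕ → ℕ) (base : ℕ) (vis qu : ℕ → ℕ) (qh qt e : ℕ) : ℕ :=
  ∑ i ∈ Finset.range a, searchWeight n X Y mr base vis i +
    ∑ p ∈ Finset.Ico qh qt, (cnt X (qu p) n + 1) + cnt X (X e) e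

/-- No edge cover is smaller than the number of rows and columns with edges minus the number of
edges of the matching. -/
def Certified (n a : ℕ) (X Y mr : ℕ → ℕ) : Prop :=
  ∀ F ⊆ Finset.Icc 1 n, (∀ e ∈ Finset.Icc 1 n, ∃ e' ∈ F, X e' = X e) →
    (∀ e ∈ Finset.Icc 1 n, ∃ e' ∈ F, Y e' = Y e) →
    ((Finset.Icc 1 n).image X).card + ((Finset.Icc 1 n).image Y).card ≤
      F.card + matchSize a mr

namespace Search

variable {n a b base st qh qt e : ℕ} {X Y nxt head mr mc vis par qu : ℕ → ℕ}

theorem nxt_valid (hl : Lists n a X nxt head)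
    (h : Search n a b X Y mr mc base vis par qu st qh qt e) (he : e ≠ 0) (h0 : nxt e ≠ 0) :
    nxt e ≤ n ∧ X (nxt e) = X e := by
  have hn := (h.edge he).1
  rw [hl.nxt_eq e (by omega) hn] at h0 ⊢
  exact ⟨(last_le _ _ _).trans (by omega), apply_last h0⟩

theorem cnt_nxt (hl : Lists n a X nxt head)
    (h : Search n a b X Y mr mc base vis par qu st qh qt e) (he : e ≠ 0) :
    cnt X (X (nxt e)) (nxt e) + 1 = cnt X (X e) e := by
  have hn := (h.edge he).1
  rw [cnt_eq_cnt_last_add_one (e := e) (by omega) rfl, ← hl.nxt_eq e (by omega) hn]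
  by_cases h0 : nxt e = 0
  · rw [h0, cnt_zero, cnt_zero]
  · rw [(h.nxt_valid hl he h0).2]

/-- The edge `e` leads to a visited column. -/
theorem skip (hl : Lists n a X nxt head)
    (h : Search n a b X Y mr mc base vis par qu st qh qt e) (he : e ≠ 0)
    (hv : base < vis (Y e)) :
    Search n a b X Y mr mc base vis par qu st qh qt (nxt e) ∧
      searchPot n a X Y mr base vis qu qh qt (nxt e) + 1 ≤
        searchPot n a X Y mr base vis qu qh qt e := by
  obtain ⟨hn, hq, hX⟩ := h.edge he
  refine ⟨{ h with scanned := fun p hp e' h1 h2 h3 => ?_, edge := fun h0 => ?_ }, ?_⟩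
  · rcases h.scanned p hp e' h1 h2 h3 with h4 | ⟨h4, h5⟩
    · exact Or.inl h4
    · rcases h5.lt_or_eq with h6 | rfl
      · right
        refine ⟨h4, ?_⟩
        rw [hl.nxt_eq e (by omega) hn]
        exact le_last h1 (by omega) (by rw [h3, hX, ← h4]; rfl)
      · exact Or.inl hv
  · obtain ⟨h1, h2⟩ := h.nxt_valid hl he h0
    exact ⟨h1, hq, h2.trans hX⟩
  · have := h.cnt_nxt hl he
    simp only [searchPot]
    omega

theorem chain_visit (hG : Graph n a b X Y)
    (h : Search n a b X Y mr mc base vis par qu st qh qt e) (he : e ≠ 0)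
    (hv : ¬ base < vis (Y e)) :
    Chain n b X Y mr base (Function.update vis (Y e) (st + 1)) (Function.update par (Y e) e)
      (st + 1) := by
  obtain ⟨hn, hq, hX⟩ := h.edge he
  have hqh := h.qh_le
  intro j hj h1 h2
  by_cases hjY : j = Y e
  · subst hjY
    simp only [Function.update_self]
    refine ⟨⟨by omega, hn, trivial⟩, fun h0 => ?_⟩
    obtain ⟨h3, h4⟩ := h.queue (qh - 1) (by omega)
    rw [← hX] at h3 h4
    have h5 := h4.resolve_left h0
    have h6 : Y (mr (X e)) ≠ Y e := fun hc => hv (hc ▸ h5)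
    rw [Function.update_of_ne h6]
    have := h.vis_le _ (hG.col_lt _ (by omega) (h.mate.row _ h3 h0).1)
    exact ⟨h5, by omega⟩
  · rw [Function.update_of_ne hjY] at h1 ⊢
    rw [Function.update_of_ne hjY]
    obtain ⟨h3, h4⟩ := h.chain j hj h1 (h.vis_le j hj)
    refine ⟨h3, fun h0 => ?_⟩
    obtain ⟨h5, h6⟩ := h4 h0
    have h7 : Y (mr (X (par j))) ≠ Y e := fun hc => hv (hc ▸ h5)
    rw [Function.update_of_ne h7]
    exact ⟨h5, h6⟩

/-- The edge `e` leads to a free column. -/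
theorem found (hG : Graph n a b X Y)
    (h : Search n a b X Y mr mc base vis par qu st qh qt e) (he : e ≠ 0)
    (hv : ¬ base < vis (Y e)) (hfree : mc (Y e) = 0) :
    Augmenting n a b X Y mr mc base (Function.update vis (Y e) (st + 1))
      (Function.update par (Y e) e) (Y e) := by
  have hb := h.base_le
  refine ⟨h.mate, hG.col_lt e (by omega) (h.edge he).1, hfree, ?_, ?_⟩
  · rw [Function.update_self]; omega
  · rw [Function.update_self]; exact h.chain_visit hG he hv

/-- The edge `e` leads to a matched column that has not been visited; its row is reached. -/
theorem visit (hG : Graph n a b X Y) (hl : Lists n a X nxt head)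
    (h : Search n a b X Y mr mc base vis par qu st qh qt e) (he : e ≠ 0)
    (hv : ¬ base < vis (Y e)) (hmc : mc (Y e) ≠ 0) :
    Search n a b X Y mr mc base (Function.update vis (Y e) (st + 1))
        (Function.update par (Y e) e) (Function.update qu qt (X (mc (Y e)))) (st + 1) qh (qt + 1)
        (nxt e) ∧
      searchPot n a X Y mr base (Function.update vis (Y e) (st + 1))
        (Function.update qu qt (X (mc (Y e)))) qh (qt + 1) (nxt e) + 1 ≤
        searchPot n a X Y mr base vis qu qh qt e := by
  obtain ⟨hn, hq, hX⟩ := h.edge he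
  have hb := h.base_le
  have hqh := h.qh_le
  have hYb := hG.col_lt e (by omega) hn
  obtain ⟨ho1, ho2, ho3⟩ := h.mate.col _ hYb hmc
  have hoa : X (mc (Y e)) < a := hG.row_lt _ (by omega) ho1
  have hmono : ∀ j, base < vis j → base < Function.update vis (Y e) (st + 1) j := by
    intro j hj
    by_cases hjY : j = Y e
    · subst hjY; exact absurd hj hv
    · rwa [Function.update_of_ne hjY]
  have hqu : ∀ p < qt, Function.update qu qt (X (mc (Y e))) p = qu p := fun p hp =>
    Function.update_of_ne hp.ne _ _
  refine ⟨⟨h.mate, by omega, fun j hj => ?_, by omega, fun p hp => ?_, fun i hi h0 => ?_,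
    h.chain_visit hG he hv, fun j hj h1 => ?_, fun p hp e' h1 h2 h3 => ?_, fun h0 => ?_⟩, ?_⟩
  · by_cases hjY : j = Y e
    · subst hjY; rw [Function.update_self]
    · rw [Function.update_of_ne hjY]; have := h.vis_le j hj; omega
  · by_cases hpq : p = qt
    · subst hpq
      rw [Function.update_self, ho3, ho2, Function.update_self]
      exact ⟨hoa, Or.inr (by omega)⟩
    · rw [hqu p (by omega)]
      obtain ⟨h1, h2⟩ := h.queue p (by omega)
      exact ⟨h1, h2.imp_right (hmono _)⟩
  · obtain ⟨p, hp, hpi⟩ := h.free i hi h0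
    exact ⟨p, by omega, by rw [hqu p hp, hpi]⟩
  · by_cases hjY : j = Y e
    · subst hjY
      exact ⟨hmc, qt, by omega, Function.update_self _ _ _⟩
    · rw [Function.update_of_ne hjY] at h1
      obtain ⟨h2, p, hp, h3⟩ := h.partner j hj h1
      exact ⟨h2, p, by omega, by rw [hqu p hp, h3]⟩
  · rw [hqu p (by omega)] at h3
    rcases h.scanned p hp e' h1 h2 h3 with h4 | ⟨h4, h5⟩
    · exact Or.inl (hmono _ h4)
    · rcases h5.lt_or_eq with h6 | rfl
      · right
        refine ⟨h4, ?_⟩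
        rw [hl.nxt_eq e (by omega) hn]
        exact le_last h1 (by omega) (by rw [h3, hX, ← h4]; rfl)
      · left
        rw [Function.update_self]; omega
  · obtain ⟨h1, h2⟩ := h.nxt_valid hl he h0
    exact ⟨h1, hq, by rw [hqu _ (by omega), h2, hX]⟩
  · have h1 := h.cnt_nxt hl he
    have h2 : ∑ i ∈ Finset.range a,
        searchWeight n X Y mr base (Function.update vis (Y e) (st + 1)) i +
          (cnt X (X (mc (Y e))) n + 1) ≤
        ∑ i ∈ Finset.range a, searchWeight n X Y mr base vis i := by
      refine sum_add_le_sum (Finset.mem_range.mpr hoa) ?_ fun i _ _ => ?_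
      · have h3 : ¬ (mr (X (mc (Y e))) = 0 ∨ base < vis (Y (mr (X (mc (Y e)))))) := by
          rw [ho3, ho2]; tauto
        have h4 : base < Function.update vis (Y e) (st + 1) (Y (mr (X (mc (Y e))))) := by
          rw [ho3, ho2, Function.update_self]; omega
        rw [searchWeight, searchWeight, if_neg h3, if_pos (Or.inr h4), zero_add]
      · by_cases h5 : mr i = 0 ∨ base < vis (Y (mr i))
        · rw [searchWeight, if_pos (h5.imp_right (hmono _))]
          exact Nat.zero_le _
        · rw [searchWeight, searchWeight, if_neg h5]
          split_ifs <;> omega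
    have h3 : ∑ p ∈ Finset.Ico qh (qt + 1),
        (cnt X (Function.update qu qt (X (mc (Y e))) p) n + 1) =
        ∑ p ∈ Finset.Ico qh qt, (cnt X (qu p) n + 1) + (cnt X (X (mc (Y e))) n + 1) := by
      rw [Finset.sum_Ico_succ_top (by omega), Function.update_self]
      congr 1
      refine Finset.sum_congr rfl fun p hp => ?_
      rw [hqu p (Finset.mem_Ico.mp hp).2]
    simp only [searchPot, h3]
    omega

/-- The next row is taken from the queue. -/
theorem pop (hl : Lists n a X nxt head)
    (h : Search n a b X Y mr mc base vis par qu st qh qt 0) (hq : qh < qt) :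
    Search n a b X Y mr mc base vis par qu st (qh + 1) qt (head (qu qh)) ∧
      searchPot n a X Y mr base vis qu (qh + 1) qt (head (qu qh)) + 1 ≤
        searchPot n a X Y mr base vis qu qh qt 0 := by
  have ha := (h.queue qh hq).1
  have hh := hl.head_eq _ ha
  refine ⟨{ h with
    qh_le := hq
    scanned := fun p hp e' h1 h2 h3 => ?_
    edge := fun h0 => ?_ }, ?_⟩
  · rcases Nat.lt_succ_iff_lt_or_eq.mp hp with h4 | rfl
    · rcases h.scanned p h4 e' h1 h2 h3 with h5 | ⟨-, h6⟩
      · exact Or.inl h5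
      · omega
    · right
      refine ⟨rfl, ?_⟩
      rw [hh]
      exact le_last h1 h2 h3
  · rw [hh] at h0 ⊢
    exact ⟨last_le _ _ _, by omega, by rw [apply_last h0, Nat.add_sub_cancel]⟩
  · have h1 : cnt X (X (head (qu qh))) (head (qu qh)) = cnt X (qu qh) n := by
      rw [hh]
      by_cases h0 : last X (qu qh) n = 0
      · rw [← cnt_last X (qu qh), h0, cnt_zero, cnt_zero]
      · rw [apply_last h0, cnt_last]
    simp only [searchPot, h1, cnt_zero, Finset.sum_eq_sum_Ico_succ_bot hq]
    omega

/-- The queue is exhausted. The visited columns and the rows that were not reached then form a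
vertex cover with as many elements as the matching; the other rows and columns with edges are
pairwise not adjacent, so an edge cover needs an edge for each of them. -/
theorem certified (hG : Graph n a b X Y)
    (h : Search n a b X Y mr mc base vis par qu st qh qt 0) (hq : ¬ qh < qt) :
    Certified n a X Y mr := by
  classical
  intro F hF hFX hFY
  let reached : ℕ → Prop := fun i => mr i = 0 ∨ base < vis (Y (mr i))
  have hreach : ∀ i < a, reached i → ∃ p < qh, qu p = i := by
    intro i hi hr
    have hqq : qh = qt := le_antisymm h.qh_le (not_lt.mp hq)
    rw [hqq]
    by_cases h0 : mr i = 0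
    · exact h.free i hi h0
    · obtain ⟨h1, h2, h3⟩ := h.mate.row i hi h0
      have hc := hG.col_lt _ (Nat.pos_of_ne_zero h0) h1
      obtain ⟨-, p, hp, hp'⟩ := h.partner _ hc (hr.resolve_left h0)
      exact ⟨p, hp, by rw [hp', h3, h2]⟩
  have hedge : ∀ e', 1 ≤ e' → e' ≤ n → reached (X e') → base < vis (Y e') := by
    intro e' h1 h2 hr
    obtain ⟨p, hp, hpe⟩ := hreach _ (hG.row_lt e' h1 h2) hr
    rcases h.scanned p hp e' h1 h2 hpe.symm with h4 | ⟨-, h5⟩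
    · exact h4
    · omega
  have hI : ∀ {e'}, e' ∈ Finset.Icc 1 n ↔ 1 ≤ e' ∧ e' ≤ n := Finset.mem_Icc
  set PX := (Finset.Icc 1 n).image X
  set PY := (Finset.Icc 1 n).image Y
  have hX : (PX.filter reached).card ≤ (F.filter fun e' => base < vis (Y e')).card := by
    refine (Finset.card_le_card (t := (F.filter fun e' => base < vis (Y e')).image X)
      fun i hi => ?_).trans Finset.card_image_le
    obtain ⟨hi, hr⟩ := Finset.mem_filter.mp hi
    obtain ⟨e', he', rfl⟩ := Finset.mem_image.mp hi
    obtain ⟨e'', he'', hXX⟩ := hFX e' he'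
    have hb := hI.mp (hF he'')
    exact Finset.mem_image.mpr ⟨e'', Finset.mem_filter.mpr ⟨he'',
      hedge e'' hb.1 hb.2 (by rw [hXX]; exact hr)⟩, hXX⟩
  have hY : (PY.filter fun j => ¬ base < vis j).card ≤
      (F.filter fun e' => ¬ base < vis (Y e')).card := by
    refine (Finset.card_le_card (t := (F.filter fun e' => ¬ base < vis (Y e')).image Y)
      fun j hj => ?_).trans Finset.card_image_le
    obtain ⟨hj, hr⟩ := Finset.mem_filter.mp hj
    obtain ⟨e', he', rfl⟩ := Finset.mem_image.mp hj
    obtain ⟨e'', he'', hYY⟩ := hFY e' he'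
    exact Finset.mem_image.mpr ⟨e'', Finset.mem_filter.mpr ⟨he'', by rw [hYY]; exact hr⟩, hYY⟩
  set MR := (Finset.range a).filter fun i => mr i ≠ 0
  have hX' : (PX.filter fun i => ¬ reached i).card ≤
      (MR.filter fun i => ¬ base < vis (Y (mr i))).card := by
    refine Finset.card_le_card fun i hi => ?_
    obtain ⟨hi, hr⟩ := Finset.mem_filter.mp hi
    obtain ⟨e', he', rfl⟩ := Finset.mem_image.mp hi
    have hb := hI.mp he'
    simp only [reached, not_or] at hr
    exact Finset.mem_filter.mpr ⟨Finset.mem_filter.mpr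
      ⟨Finset.mem_range.mpr (hG.row_lt _ hb.1 hb.2), hr.1⟩, hr.2⟩
  have hY' : (PY.filter fun j => base < vis j).card ≤
      (MR.filter fun i => base < vis (Y (mr i))).card := by
    refine (Finset.card_le_card
      (t := (MR.filter fun i => base < vis (Y (mr i))).image fun i => Y (mr i))
      fun j hj => ?_).trans Finset.card_image_le
    obtain ⟨hj, hr⟩ := Finset.mem_filter.mp hj
    obtain ⟨e', he', rfl⟩ := Finset.mem_image.mp hj
    have hb := hI.mp he'
    have hjb := hG.col_lt _ hb.1 hb.2
    have h0 := (h.partner _ hjb hr).1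
    obtain ⟨h1, h2, h3⟩ := h.mate.col _ hjb h0
    refine Finset.mem_image.mpr ⟨X (mc (Y e')), Finset.mem_filter.mpr ⟨Finset.mem_filter.mpr
      ⟨Finset.mem_range.mpr (hG.row_lt _ (Nat.pos_of_ne_zero h0) h1), ?_⟩, ?_⟩, ?_⟩
    · rw [h3]; exact h0
    · rw [h3, h2]; exact hr
    · rw [h3, h2]
  have e1 := Finset.card_filter_add_card_filter_not (s := PX) reached
  have e2 := Finset.card_filter_add_card_filter_not (s := PY) fun j => base < vis j
  have e3 := Finset.card_filter_add_card_filter_not (s := F) fun e' => base < vis (Y e')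
  have e4 := Finset.card_filter_add_card_filter_not (s := MR) fun i => base < vis (Y (mr i))
  have e5 : matchSize a mr = MR.card := rfl
  omega

theorem start (hm : IsMate n a b X Y mr mc) (hv : ∀ j < b, vis j ≤ base)
    (hq : ∀ p < qt, qu p < a ∧ mr (qu p) = 0) (hf : ∀ i < a, mr i = 0 → ∃ p < qt, qu p = i) :
    Search n a b X Y mr mc base vis par qu base 0 qt 0 :=
  ⟨hm, le_rfl, hv, Nat.zero_le _, fun p hp => ⟨(hq p hp).1, Or.inl (hq p hp).2⟩, hf,
    fun j hj h1 => by have := hv j hj; omega, fun j hj h1 => by have := hv j hj; omega,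
    fun p hp => by omega, fun h => absurd rfl h⟩

theorem pot_start (hG : Graph n a b X Y)
    (hq : ∑ p ∈ Finset.range qt, (cnt X (qu p) n + 1) ≤
      ∑ i ∈ Finset.range a, if mr i = 0 then cnt X i n + 1 else 0) :
    searchPot n a X Y mr base vis qu 0 qt 0 ≤ n + a := by
  have h1 : ∑ i ∈ Finset.range a, searchWeight n X Y mr base vis i +
      ∑ i ∈ Finset.range a, (if mr i = 0 then cnt X i n + 1 else 0) ≤
      ∑ i ∈ Finset.range a, (cnt X i n + 1) := by
    rw [← Finset.sum_add_distrib]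
    refine Finset.sum_le_sum fun i _ => ?_
    rw [searchWeight]
    split_ifs <;> omega
  rw [Finset.sum_add_distrib, sum_cnt hG] at h1
  simp only [Finset.sum_const, Finset.card_range, smul_eq_mul, mul_one] at h1
  rw [searchPot, cnt_zero, ← Finset.range_eq_Ico]
  omega

end Search

end Matching


/-! ### Counting loops -/

namespace Imp

/-- The loop `for x = p, …, q - 1`. -/
def Cmd.for (x : Var) (p q : Expr) (B : Cmd) : Cmd :=
  .set x p ;; .loop x q (B ;; .set x (.add x (.lit 1)))

/-- The rule for counting loops, with a bound `K` on the time of the body. -/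
theorem wp_for {x : Var} {p q : Expr} {B : Cmd} {Q : Store → Prop} {s : Store}
    (J : ℕ → Store → Prop) (lo hi K : ℕ) (hlo : p.eval s = lo) (hle : lo ≤ hi)
    (hx : B.modV x = false) (hq : ∀ s', Frame (.for x p q B) s s' → q.eval s' = hi)
    (htick : ∀ k s t, J k s → J k (s.tick t)) (h0 : J lo (s.set x lo (p.cost + 2)))
    (hstep : ∀ k s', lo ≤ k → k < hi → Frame (.for x p q B) s s' → s'.v x = k → J k s' →
      wp B (fun s'' => J (k + 1) (s''.set x (k + 1) 6) ∧ s''.clock ≤ s'.clock + K) s')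
    (hpost : ∀ s', Frame (.for x p q B) s s' → J hi s' →
      s'.clock ≤ s.clock + (hi - lo) * (K + q.cost + 10) + (p.cost + q.cost + 6) → Q s') :
    wp (.for x p q B) Q s := by
  have hF : ∀ {P s s'}, Frame P s s' → (∀ y, (Cmd.for x p q B).modV y = false → P.modV y = false) →
      (∀ y, (Cmd.for x p q B).modF y = false → P.modF y = false) →
      (∀ y, (Cmd.for x p q B).modPos y = false → P.modPos y = false) →
      Frame (.for x p q B) s s' := fun h h1 h2 h3 => h.mono h1 h2 h3
  have hset : Frame (.for x p q B) s (s.set x lo (p.cost + 2)) := by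
    refine ⟨fun y hy => ?_, fun _ _ => rfl, fun _ _ => rfl, rfl⟩
    simp only [Cmd.for, Cmd.modV, Bool.or_eq_false_iff, decide_eq_false_iff_not] at hy
    exact Function.update_of_ne (Ne.symm hy.1) _ _
  have htk : ∀ (s : Store) t, Frame (.for x p q B) s (s.tick t) := fun s t =>
    ⟨fun _ _ => rfl, fun _ _ => rfl, fun _ _ => rfl, rfl⟩
  rw [Cmd.for, wp_seq, wp_set, hlo]
  refine wp_loop (fun s' => ∃ k, lo ≤ k ∧ k ≤ hi ∧ s'.v x = k ∧ J k s' ∧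
    Frame (.for x p q B) s s' ∧
    s'.clock + (hi - k) * (K + q.cost + 10) ≤
      s.clock + (hi - lo) * (K + q.cost + 10) + p.cost + 2)
    (s.clock + (hi - lo) * (K + q.cost + 10) + p.cost + 2)
    ⟨lo, le_rfl, hle, by simp [Store.set], h0, hset, by simp only [Store.set]; omega⟩
    fun s' _ ⟨k, hk1, hk2, hk, hJ, hfr, hc⟩ => ⟨by omega, fun hlt => ?_, fun hlt => ?_⟩
  · have hqe := hq s' hfr
    have hkh : k < hi := by simpa [Expr.eval, hk, hqe] using hlt
    rw [wp_seq]
    refine wp_mono (wp_frame (hstep k _ hk1 hkh (hfr.trans (htk _ _)) hk (htick _ _ _ hJ)))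
      fun s'' ⟨⟨hJ'', hc''⟩, hfr''⟩ => ?_
    have hk'' : s''.v x = k := by rw [hfr''.v x hx]; exact hk
    have hfr2 : Frame (.for x p q B) s s'' := (hfr.trans (htk _ _)).trans (hF hfr''
      (fun y hy => by
        simp only [Cmd.for, Cmd.modV, Bool.or_eq_false_iff] at hy; exact hy.2.1)
      (fun y hy => by
        simp only [Cmd.for, Cmd.modF, Bool.or_eq_false_iff] at hy; exact hy.2.1)
      fun y hy => by
        simp only [Cmd.for, Cmd.modPos, Bool.or_eq_false_iff] at hy; exact hy.2.1)
    rw [wp_set]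
    simp only [Expr.eval, hk'']
    refine ⟨k + 1, by omega, hkh, by simp [Store.set], hJ'', hfr2.trans ?_, ?_⟩
    · refine ⟨fun y hy => ?_, fun _ _ => rfl, fun _ _ => rfl, rfl⟩
      simp only [Cmd.for, Cmd.modV, Bool.or_eq_false_iff, decide_eq_false_iff_not] at hy
      exact Function.update_of_ne (Ne.symm hy.1) _ _
    · simp only [Store.tick, Expr.cost] at hc''
      simp only [Store.set, Expr.cost]
      obtain ⟨m, hm⟩ : ∃ m, hi - k = m + 1 := ⟨hi - k - 1, by omega⟩
      rw [show hi - (k + 1) = m by omega]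
      rw [hm, add_mul, one_mul] at hc
      omega
  · have hqe := hq s' hfr
    have hkh : k = hi := by
      have : ¬ k < hi := by simpa [Expr.eval, hk, hqe] using hlt
      omega
    subst hkh
    refine hpost _ (hfr.trans (htk _ _)) (htick _ _ _ hJ) ?_
    simp only [Store.tick, Expr.cost]
    omega

/-! ### Counting the gaps and choosing the axis -/

/-- The indices below `m` that the values `g 1, …, g n` leave free. -/
def freeSet (m n : ℕ) (g : ℕ → ℕ) : Finset ℕ :=
  (Finset.range m).filter fun i => i ∉ (Finset.Icc 1 n).image g

/-- Count the gaps along the axis `d` into `res`; the lines are numbered up to `bd`. -/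
def countGaps (d : Fin 2) (bd res : Var) : Cmd :=
  .for .e (.lit 1) (.add Var.n (.lit 1)) (.inp .o d Var.e ;; .put .mark Var.o (.lit (d + 1))) ;;
  .set res (.lit 0) ;;
  .for .i (.lit 0) bd
    (.ite (.get .mark Var.i) (.lit (d + 1)) (.set res (.add res (.lit 1))) .skip)

theorem countGaps_spec {d : Fin 2} {bd res : Var} (hv : bd = .a ∧ res = .r ∨ bd = .b ∧ res = .c)
    {s : Store} (hn : s.size = s.v .n) (hmark : ∀ i, s.f .mark i < d + 1) :
    wp (countGaps d bd res) (fun s' => s'.v res = (freeSet (s.v bd) (s.v .n) (s.io d)).card ∧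
      (∀ i, s'.f .mark i < d + 2) ∧ s'.clock ≤ s.clock + 100 * (s.v .n + s.v bd + 1)) s := by
  have hri : res ≠ .i := by rcases hv with ⟨rfl, rfl⟩ | ⟨rfl, rfl⟩ <;> decide
  have hbr : bd ≠ res := by rcases hv with ⟨rfl, rfl⟩ | ⟨rfl, rfl⟩ <;> decide
  have hbi : bd ≠ .i := by rcases hv with ⟨rfl, rfl⟩ | ⟨rfl, rfl⟩ <;> decide
  have hb : ∀ x ∈ ([.e, .o, .i] : List Var), x ≠ bd ∧ x ≠ res := by
    rcases hv with ⟨rfl, rfl⟩ | ⟨rfl, rfl⟩ <;> decide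
  rw [countGaps, wp_seq]
  refine wp_for (fun k s' => (∀ i, s'.f .mark i < d + 2) ∧
    ∀ i, s'.f .mark i = d + 1 ↔ ∃ e, 1 ≤ e ∧ e < k ∧ s.io d e = i)
    1 (s.v .n + 1) 30 rfl (by omega) rfl (fun s' hfr => ?_) (fun _ _ _ h => h) ⟨?_, ?_⟩ ?_ ?_
  · simp [Expr.eval, hfr.v .n rfl]
  · intro i; exact (hmark i).trans (Nat.lt_succ_self _)
  · intro i
    have := hmark i
    simp only [Store.set]
    constructor
    · intro h; omega
    · rintro ⟨e, h1, h2, -⟩; omega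
  · intro k s' hk1 hk2 hfr hke ⟨hJ1, hJ2⟩
    have hio : s'.io = s.io := funext fun d' => hfr.io d' rfl
    have hsz := hfr.size
    simp only [wp_seq, wp_inp, wp_put, Expr.eval, Expr.cost, Store.set, Store.put, hke, hio,
      Function.update_self]
    refine ⟨by omega, ⟨fun i => ?_, fun i => ?_⟩, by omega⟩
    · by_cases hi : i = s.io d k
      · subst hi; simp
      · rw [Function.update_of_ne hi]; exact hJ1 i
    · by_cases hi : i = s.io d k
      · subst hi
        simp only [Function.update_self, true_iff]
        exact ⟨k, hk1, by omega, rfl⟩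
      · rw [Function.update_of_ne hi, hJ2]
        constructor
        · rintro ⟨e, h1, h2, h3⟩
          exact ⟨e, h1, by omega, h3⟩
        · rintro ⟨e, h1, h2, h3⟩
          have : e ≠ k := by rintro rfl; exact hi h3.symm
          exact ⟨e, h1, by omega, h3⟩
  · intro s₁ hfr₁ ⟨hJ1, hJ2⟩ hc₁
    have hmk : ∀ i, s₁.f .mark i < d + 1 ↔ i ∉ (Finset.Icc 1 (s.v .n)).image (s.io d) := by
      intro i
      have h1 := hJ1 i
      have h2 : s₁.f .mark i < d + 1 ↔ ¬ s₁.f .mark i = d + 1 := by omega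
      rw [h2, hJ2]
      simp only [Finset.mem_image, Finset.mem_Icc, Nat.lt_succ_iff, and_assoc]
    rw [wp_seq, wp_set]
    refine wp_for (fun k s' => s'.v res = (freeSet k (s.v .n) (s.io d)).card) 0 (s.v bd) 30 rfl
      (by omega) (by simp [Cmd.modV, hri]) (fun s' hfr => ?_) (fun _ _ _ h => h) ?_ ?_ ?_
    · simp only [Expr.eval]
      rw [hfr.v bd (by simp [Cmd.for, Cmd.modV, hbi.symm, hbr.symm])]
      simp only [Store.set]
      rw [Function.update_of_ne hbr, hfr₁.v bd (by simp [Cmd.for, Cmd.modV, hb])]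
    · simp [Store.set, Expr.eval, freeSet, hri]
    · intro k s' _ hk2 hfr hke hJ
      have hm : s'.f .mark = s₁.f .mark := hfr.f .mark rfl
      simp only [wp_ite, wp_set, wp_skip, Expr.eval, Expr.cost, Store.set, Store.tick, hke, hm]
      rw [freeSet, Finset.range_add_one, Finset.filter_insert, ← freeSet]
      refine ⟨fun h => ?_, fun h => ?_⟩
      · rw [if_pos ((hmk k).mp h), Finset.card_insert_of_notMem (by simp [freeSet])]
        exact ⟨by simp [hJ, hri], by omega⟩
      · rw [if_neg (mt (hmk k).mpr h)]
        exact ⟨by simp [hJ, hri], by omega⟩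
    · intro s₂ hfr₂ hJ hc₂
      refine ⟨hJ, fun i => ?_, ?_⟩
      · rw [hfr₂.f .mark rfl]; exact hJ1 i
      · simp only [Store.set, Expr.cost] at hc₁ hc₂
        omega

/-- Copy the coordinates along `d` to `X` and the other ones to `Y`. -/
def load (d : Fin 2) : Cmd :=
  .for .e (.lit 1) (.add Var.n (.lit 1)) (.inp .o d Var.e ;; .put .X Var.e Var.o ;;
    .inp .o d.rev Var.e ;; .put .Y Var.e Var.o)

theorem load_spec {d : Fin 2} {s : Store} (hn : s.size = s.v .n) :
    wp (load d) (fun s' => (∀ e, 1 ≤ e → e ≤ s.v .n → s'.f .X e = s.io d e) ∧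
      (∀ e, 1 ≤ e → e ≤ s.v .n → s'.f .Y e = s.io d.rev e) ∧
      s'.clock ≤ s.clock + 100 * (s.v .n + 1)) s := by
  refine wp_for (fun k s' => (∀ e, 1 ≤ e → e < k → s'.f .X e = s.io d e) ∧
      (∀ e, 1 ≤ e → e < k → s'.f .Y e = s.io d.rev e))
      1 (s.v .n + 1) 60 rfl (by omega) rfl (fun s' hfr => ?_) (fun _ _ _ h => h)
      ⟨fun _ _ _ => by omega, fun _ _ _ => by omega⟩ ?_ ?_
  · simp [Expr.eval, hfr.v .n rfl]
  · intro k s' hk1 hk2 hfr hke ⟨hJ1, hJ2⟩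
    have hio : s'.io = s.io := funext fun d' => hfr.io d' rfl
    have hsz := hfr.size
    simp only [wp_seq, wp_inp, wp_put, Expr.eval, Expr.cost, Store.set, Store.put, hke, hio,
      Function.update_self, ne_eq, reduceCtorEq, not_false_eq_true, Function.update_of_ne]
    refine ⟨by omega, by omega, ⟨fun e h1 h2 => ?_, fun e h1 h2 => ?_⟩, by omega⟩
    · by_cases he : e = k
      · subst he; simp
      · rw [Function.update_of_ne he]; exact hJ1 e h1 (by omega)
    · by_cases he : e = k
      · subst he; simp
      · rw [Function.update_of_ne he]; exact hJ2 e h1 (by omega)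
  · intro s' _ ⟨hJ1, hJ2⟩ hc
    simp only [Expr.cost] at hc
    exact ⟨fun e h1 h2 => hJ1 e h1 (by omega), fun e h1 h2 => hJ2 e h1 (by omega), by omega⟩

/-- Let the rows be the lines along the axis with more gaps; `sw` records that axis. -/
def chooseAxis : Cmd :=
  countGaps 0 .a .r ;; countGaps 1 .b .c ;;
  .ite Var.r Var.c
    (.set .o Var.a ;; .set .a Var.b ;; .set .b Var.o ;; .set .sw (.lit 1) ;; load 1)
    (.set .sw (.lit 0) ;; load 0)

theorem chooseAxis_spec {s : Store} {side : Fin 2 → ℕ} (hn : s.size = s.v .n)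
    (ha : s.v .a = side 0) (hb : s.v .b = side 1) (hmark : ∀ i, s.f .mark i = 0) :
    wp chooseAxis (fun s' => ∃ d : Fin 2, s'.v .sw = d ∧ s'.v .a = side d ∧
      s'.v .b = side d.rev ∧
      (∀ e, 1 ≤ e → e ≤ s.v .n → s'.f .X e = s.io d e) ∧
      (∀ e, 1 ≤ e → e ≤ s.v .n → s'.f .Y e = s.io d.rev e) ∧
      (freeSet (side d.rev) (s.v .n) (s.io d.rev)).card ≤
        (freeSet (side d) (s.v .n) (s.io d)).card ∧
      s'.clock ≤ s.clock + 400 * (s.v .n + side 0 + side 1 + 1)) s := by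
  rw [chooseAxis, wp_seq]
  refine wp_of_wp (countGaps_spec (Or.inl ⟨rfl, rfl⟩) hn fun i => by rw [hmark]; omega)
    fun s₁ hfr₁ ⟨hr, hm₁, hc₁⟩ => ?_
  rw [wp_seq]
  have hn₁ : s₁.v .n = s.v .n := hfr₁.v .n rfl
  have hb₁ : s₁.v .b = s.v .b := hfr₁.v .b rfl
  have ha₁ : s₁.v .a = s.v .a := hfr₁.v .a rfl
  have hio₁ : s₁.io = s.io := funext fun d' => hfr₁.io d' rfl
  have hs₁ := hfr₁.size
  refine wp_of_wp (countGaps_spec (Or.inr ⟨rfl, rfl⟩) (by omega) fun i => hm₁ i)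
    fun s₂ hfr₂ ⟨hc, hm₂, hc₂⟩ => ?_
  have hn₂ : s₂.v .n = s₁.v .n := hfr₂.v .n rfl
  have hb₂ : s₂.v .b = s₁.v .b := hfr₂.v .b rfl
  have ha₂ : s₂.v .a = s₁.v .a := hfr₂.v .a rfl
  have hr₂ : s₂.v .r = s₁.v .r := hfr₂.v .r rfl
  have hio₂ : s₂.io = s₁.io := funext fun d' => hfr₂.io d' rfl
  have hs₂ := hfr₂.size
  rw [hn₁, hb₁, hio₁, hb] at hc
  rw [ha] at hr
  simp only [wp_ite, wp_seq, wp_set, Expr.eval, Expr.cost, Store.set, Store.tick]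
  refine ⟨fun h => wp_of_wp (load_spec ?_) fun s₃ hfr₃ ⟨hX, hY, hc₃⟩ => ?_,
    fun h => wp_of_wp (load_spec ?_) fun s₃ hfr₃ ⟨hX, hY, hc₃⟩ => ?_⟩
  · simp; omega
  · simp only [ne_eq, reduceCtorEq, not_false_eq_true, Function.update_of_ne,
      hn₂, hn₁, hio₂, hio₁] at hX hY hc₃
    have h1 : s₃.v .sw = _ := hfr₃.v .sw rfl
    have h2 : s₃.v .a = _ := hfr₃.v .a rfl
    have h3 : s₃.v .b = _ := hfr₃.v .b rfl
    simp only [ne_eq, reduceCtorEq, not_false_eq_true, Function.update_of_ne,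
      Function.update_self] at h1 h2 h3
    refine ⟨1, h1, by omega, ?_, hX, hY, ?_, by omega⟩
    · rw [show Fin.rev (1 : Fin 2) = 0 from rfl]; omega
    · rw [show Fin.rev (1 : Fin 2) = 0 from rfl]; omega
  · simp; omega
  · simp only [ne_eq, reduceCtorEq, not_false_eq_true, Function.update_of_ne,
      hn₂, hn₁, hio₂, hio₁] at hX hY hc₃
    have h1 : s₃.v .sw = _ := hfr₃.v .sw rfl
    have h2 : s₃.v .a = _ := hfr₃.v .a rfl
    have h3 : s₃.v .b = _ := hfr₃.v .b rfl
    simp only [ne_eq, reduceCtorEq, not_false_eq_true, Function.update_of_ne,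
      Function.update_self] at h1 h2 h3
    refine ⟨0, h1, by omega, ?_, hX, hY, ?_, by omega⟩
    · rw [show Fin.rev (0 : Fin 2) = 1 from rfl]; omega
    · rw [show Fin.rev (0 : Fin 2) = 1 from rfl]; omega

open Matching

/-- Link the edges of each row. -/
def buildLists : Cmd :=
  .for .e (.lit 1) (.add Var.n (.lit 1)) (.put .nxt Var.e (.get .head (.get .X Var.e)) ;;
    .put .head (.get .X Var.e) Var.e)

theorem buildLists_spec {s : Store} (hhead : ∀ i, s.f .head i = 0) :
    wp buildLists (fun s' => (∀ a, Lists (s.v .n) a (s.f .X) (s'.f .nxt) (s'.f .head)) ∧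
      s'.clock ≤ s.clock + 100 * (s.v .n + 1)) s := by
  refine wp_for (fun k s' => (∀ e, 1 ≤ e → e < k → s'.f .nxt e = last (s.f .X) (s.f .X e) (e - 1))
      ∧ ∀ i, s'.f .head i = last (s.f .X) i (k - 1))
      1 (s.v .n + 1) 80 rfl (by omega) rfl (fun s' hfr => ?_) (fun _ _ _ h => h)
      ⟨fun _ _ _ => by omega, hhead⟩ ?_ ?_
  · simp [Expr.eval, hfr.v .n rfl]
  · intro k s' hk1 hk2 hfr hke ⟨hJ1, hJ2⟩
    have hX : s'.f .X = s.f .X := hfr.f .X rfl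
    simp only [wp_seq, wp_put, Expr.eval, Expr.cost, Store.set, Store.put, hke, hX, hJ2,
      Function.update_self, ne_eq, reduceCtorEq, not_false_eq_true, Function.update_of_ne]
    refine ⟨⟨fun e h1 h2 => ?_, fun i => ?_⟩, by omega⟩
    · by_cases he : e = k
      · subst he; simp
      · rw [Function.update_of_ne he]; exact hJ1 e h1 (by omega)
    · obtain ⟨m, rfl⟩ : ∃ m, k = m + 1 := ⟨k - 1, by omega⟩
      rw [Nat.add_sub_cancel, last]
      by_cases hi : i = s.f .X (m + 1)
      · subst hi; simp
      · rw [Function.update_of_ne hi, if_neg (Ne.symm hi), hJ2, Nat.add_sub_cancel]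
  · intro s' _ ⟨hJ1, hJ2⟩ hc
    simp only [Expr.cost] at hc
    exact ⟨fun a => ⟨fun e h1 h2 => hJ1 e h1 (by omega), fun i _ => hJ2 i⟩, by omega⟩

/-- Find the least positive `L` with `n ≤ L * L`. -/
def findSqrt : Cmd :=
  .set .L (.lit 1) ;; .set .sq (.lit 1) ;;
  .loop Var.sq Var.n (.set .sq (.add (.add Var.sq (.add Var.L Var.L)) (.lit 1)) ;;
    .set .L (.add Var.L (.lit 1)))

theorem findSqrt_spec {s : Store} (hn : 1 ≤ s.v .n) :
    wp findSqrt (fun s' => 1 ≤ s'.v .L ∧ s.v .n ≤ s'.v .L * s'.v .L ∧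
      (s'.v .L - 1) * (s'.v .L - 1) < s.v .n ∧ s'.clock ≤ s.clock + 100 * (s.v .n + 1)) s := by
  simp only [findSqrt, wp_seq, wp_set, Expr.eval, Expr.cost, Store.set]
  refine wp_loop (fun s' => 1 ≤ s'.v .L ∧ s'.v .sq = s'.v .L * s'.v .L ∧
      (s'.v .L - 1) * (s'.v .L - 1) < s.v .n ∧
      s'.clock ≤ s.clock + 10 + 40 * s'.v .L) (s.clock + 10 + 40 * (s.v .n + 1)) ?_ ?_
  · simp; omega
  · intro s' hfr ⟨h1, h2, h3, h4⟩
    have hn' : s'.v .n = s.v .n := by rw [hfr.v .n rfl]; simp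
    obtain ⟨m, hm⟩ : ∃ m, s'.v .L = m + 1 := ⟨s'.v .L - 1, by omega⟩
    rw [hm, Nat.add_sub_cancel] at h3
    have hmn : m ≤ m * m := Nat.le_mul_self m
    simp only [wp_seq, wp_set, Expr.eval, Expr.cost, Store.set, Store.tick, hn', h2,
      Function.update_self, ne_eq, reduceCtorEq, not_false_eq_true, Function.update_of_ne]
    refine ⟨by omega, fun h => ⟨by omega, by ring, by simpa using h, by omega⟩,
      fun h => ⟨h1, by omega, by rw [hm, Nat.add_sub_cancel]; exact h3, by omega⟩⟩

end Imp


/-! ### The auction as a program -/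

namespace Imp

open Matching

/-- The turn goes to the next row. -/
def nextRow : Cmd := .set .i0 (.add Var.i0 (.lit 1)) ;; .set .cur Var.i0

/-- One step of the auction. -/
def auctionStep : Cmd :=
  .set .e (.get .pt Var.cur) ;;
  .ite (.lit 0) Var.e
    (.put .pt Var.cur (.get .nxt Var.e) ;;
      .ite (.get .lv Var.cur) (.get .pr (.get .Y Var.e)) .skip
        (.set .j (.get .Y Var.e) ;; .put .pr Var.j (.add (.get .lv Var.cur) (.lit 1)) ;;
          .set .o (.get .mc Var.j) ;; .put .mc Var.j Var.e ;; .put .mr Var.cur Var.e ;;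
          .ite (.lit 0) Var.o (.set .cur (.get .X Var.o) ;; .put .mr Var.cur (.lit 0)) nextRow))
    (.put .lv Var.cur (.add (.get .lv Var.cur) (.lit 1)) ;;
      .put .pt Var.cur (.get .head Var.cur) ;;
      .ite (.get .lv Var.cur) Var.L .skip nextRow)

/-- The auction for all rows. -/
def auction : Cmd :=
  .for .i (.lit 0) Var.a (.put .pt Var.i (.get .head Var.i)) ;;
  .set .i0 (.lit 0) ;; .set .cur (.lit 0) ;; .loop Var.i0 Var.a auctionStep

theorem auction_loop_spec {s : Store} {n a b L : ℕ} {X Y nxt head : ℕ → ℕ}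
    (hX : s.f .X = X) (hY : s.f .Y = Y) (hnx : s.f .nxt = nxt) (hhd : s.f .head = head)
    (ha : s.v .a = a) (hL : s.v .L = L) (hG : Graph n a b X Y) (hl : Lists n a X nxt head)
    (hA : Auction n a b X Y L (s.f .mr) (s.f .mc) (s.f .pr) (s.f .lv) (s.f .pt) (s.v .i0)
      (s.v .cur)) :
    wp (.loop Var.i0 Var.a auctionStep) (fun s' => IsMate n a b X Y (s'.f .mr) (s'.f .mc) ∧
      (∀ mr' mc', IsMate n a b X Y mr' mc' →
        L * matchSize a mr' ≤ matchSize a (s'.f .mr) * (L + 1)) ∧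
      s'.clock ≤ s.clock + 300 * (auctionPot n a L X (s.f .lv) (s.f .pt) + a + 1)) s := by
  refine wp_loop (fun s' =>
    Auction n a b X Y L (s'.f .mr) (s'.f .mc) (s'.f .pr) (s'.f .lv) (s'.f .pt) (s'.v .i0)
      (s'.v .cur) ∧ s'.clock + 300 * (auctionPot n a L X (s'.f .lv) (s'.f .pt) + (a - s'.v .i0)) ≤
        s.clock + 300 * (auctionPot n a L X (s.f .lv) (s.f .pt) + a))
    (s.clock + 300 * (auctionPot n a L X (s.f .lv) (s.f .pt) + a)) ⟨hA, by omega⟩ ?_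
  rintro s' hfr ⟨hA, hc⟩
  have hX' : s'.f .X = X := (hfr.f .X rfl).trans hX
  have hY' : s'.f .Y = Y := (hfr.f .Y rfl).trans hY
  have hnx' : s'.f .nxt = nxt := (hfr.f .nxt rfl).trans hnx
  have hhd' : s'.f .head = head := (hfr.f .head rfl).trans hhd
  have ha' : s'.v .a = a := (hfr.v .a rfl).trans ha
  have hL' : s'.v .L = L := (hfr.v .L rfl).trans hL
  refine ⟨by omega, fun hlt => ?_, fun hge => ?_⟩
  · have hi0 : s'.v .i0 < a := by simpa [Expr.eval, ha'] using hlt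
    simp only [auctionStep, nextRow, wp_seq, wp_set, wp_put, wp_ite, wp_skip, Expr.eval, Expr.cost,
      Store.set, Store.put, Store.tick, hX', hY', hnx', hhd', hL',
      Function.update_self, ne_eq, reduceCtorEq, not_false_eq_true, Function.update_of_ne]
    refine ⟨fun hpos => ⟨fun hpr => ?_, fun hpr => ⟨fun ho => ?_, fun ho => ?_⟩⟩, fun hpos =>
      ⟨fun hlv => ?_, fun hlv => ?_⟩⟩
    · obtain ⟨h1, h2⟩ := hA.skip hl hi0 (by omega) hpr
      exact ⟨h1, by omega⟩
    · obtain ⟨-, h1, h2⟩ := hA.bid hG hl hi0 (by omega) hpr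
      exact ⟨h1 (by omega), by omega⟩
    · obtain ⟨h1, -, h2⟩ := hA.bid hG hl hi0 (by omega) hpr
      exact ⟨h1 (by omega), by omega⟩
    · obtain ⟨h1, -, h2⟩ := hA.raise_level hl hi0 (by omega)
      exact ⟨h1 hlv, by omega⟩
    · obtain ⟨-, h1, h2⟩ := hA.raise_level hl hi0 (by omega)
      exact ⟨h1 hlv, by omega⟩
  · have hi0 : s'.v .i0 = a := by
      have h1 : ¬ s'.v .i0 < a := by simpa [Expr.eval, ha'] using hge
      have := hA.le_rows
      omega
    rw [hi0] at hA
    refine ⟨hA.mate, fun mr' mc' h' => hA.matchSize_le hG h', ?_⟩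
    simp only [Store.tick, Expr.cost]
    omega

theorem auction_spec {s : Store} {n a b L : ℕ} {X Y nxt head : ℕ → ℕ}
    (hX : s.f .X = X) (hY : s.f .Y = Y) (hnx : s.f .nxt = nxt) (hhd : s.f .head = head)
    (ha : s.v .a = a) (hL : s.v .L = L) (hG : Graph n a b X Y) (hl : Lists n a X nxt head)
    (hL1 : 1 ≤ L) (hmr : s.f .mr = fun _ => 0) (hmc : s.f .mc = fun _ => 0)
    (hpr : s.f .pr = fun _ => 0) (hlv : s.f .lv = fun _ => 0) :
    wp auction (fun s' => IsMate n a b X Y (s'.f .mr) (s'.f .mc) ∧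
      (∀ mr' mc', IsMate n a b X Y mr' mc' →
        L * matchSize a mr' ≤ matchSize a (s'.f .mr) * (L + 1)) ∧
      s'.clock ≤ s.clock + 500 * (L * (n + a) + n + a + 1)) s := by
  rw [auction, wp_seq]
  refine wp_for (fun k s' => ∀ i < k, s'.f .pt i = head i) 0 a 30 rfl (by omega) rfl
    (fun s' hfr => ?_) (fun _ _ _ h => h) (fun _ h => by omega) ?_ ?_
  · simp [Expr.eval, hfr.v .a rfl, ha]
  · intro k s' _ hk hfr hke hJ
    have hhd' : s'.f .head = head := (hfr.f .head rfl).trans hhd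
    simp only [wp_put, Expr.eval, Expr.cost, Store.set, Store.put, hke, hhd', Function.update_self]
    refine ⟨fun i hi => ?_, by omega⟩
    by_cases hik : i = k
    · subst hik; simp
    · rw [Function.update_of_ne hik]; exact hJ i (by omega)
  · intro s₁ hfr₁ hpt hc₁
    simp only [wp_seq, wp_set, Expr.eval, Expr.cost, Store.set] at hc₁ ⊢
    have hf : ∀ F, F ≠ .pt → s₁.f F = s.f F := fun F hF =>
      hfr₁.f F (by simpa [Cmd.for, Cmd.modF] using Ne.symm hF)
    have hv : ∀ x, x ≠ .i → s₁.v x = s.v x := fun x hx =>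
      hfr₁.v x (by simpa [Cmd.for, Cmd.modV] using Ne.symm hx)
    have hstart : Auction n a b X Y L (fun _ => 0) (fun _ => 0) (fun _ => 0) (fun _ => 0)
        (s₁.f .pt) 0 0 := Auction.start hG hL1 hl hpt
    have hpot := Auction.pot_start (L := L) hG hl hpt
    refine wp_mono (auction_loop_spec (n := n) (a := a) (b := b) (L := L) (X := X) (Y := Y)
      (nxt := nxt) (head := head) ?_ ?_ ?_ ?_ ?_ ?_ hG hl ?_) fun s₂ h => ?_
    · simp [hf, hX]
    · simp [hf, hY]
    · simp [hf, hnx]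
    · simp [hf, hhd]
    · simp [hv, ha]
    · simp [hv, hL]
    · simp only [ne_eq, reduceCtorEq, not_false_eq_true, Function.update_of_ne,
        Function.update_self, hf, hmr, hmc, hpr, hlv]
      exact hstart
    · obtain ⟨h1, h2, h3⟩ := h
      refine ⟨h1, h2, ?_⟩
      simp only [hf .lv (by decide), hlv, hpot] at h3
      nlinarith [Nat.sub_le a 0]

/-! ### The search for augmenting paths as a program -/

/-- Put the free rows into the queue. -/
def fillQueue : Cmd :=
  .set .qt (.lit 0) ;;
  .for .i (.lit 0) Var.a (.ite (.get .mr Var.i) (.lit 1)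
    (.put .qu Var.qt Var.i ;; .set .qt (.add Var.qt (.lit 1))) .skip)

/-- One step of the search: examine an edge, take a row from the queue, or stop. -/
def searchStep : Cmd :=
  .ite (.lit 0) Var.e
    (.set .j (.get .Y Var.e) ;;
      .ite Var.base (.get .vis Var.j) (.set .e (.get .nxt Var.e))
        (.set .st (.add Var.st (.lit 1)) ;; .put .vis Var.j Var.st ;; .put .par Var.j Var.e ;;
          .set .o (.get .mc Var.j) ;;
          .ite (.lit 0) Var.o
            (.put .qu Var.qt (.get .X Var.o) ;; .set .qt (.add Var.qt (.lit 1)) ;;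
              .set .e (.get .nxt Var.e))
            (.set .fnd (.lit 1) ;; .set .run (.lit 0))))
    (.ite Var.qh Var.qt
      (.set .e (.get .head (.get .qu Var.qh)) ;; .set .qh (.add Var.qh (.lit 1)))
      (.set .run (.lit 0)))

/-- Search until the queue is exhausted or a free column `j` is found. -/
def search : Cmd :=
  .set .base Var.st ;; fillQueue ;; .set .qh (.lit 0) ;; .set .e (.lit 0) ;; .set .fnd (.lit 0) ;;
  .set .run (.lit 1) ;; .loop (.lit 0) Var.run searchStep

/-- Augment the matching along the path to the column `j`. -/
def augment : Cmd :=
  .loop (.lit 0) Var.fnd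
    (.set .e (.get .par Var.j) ;; .set .o (.get .mr (.get .X Var.e)) ;;
      .put .mr (.get .X Var.e) Var.e ;; .put .mc Var.j Var.e ;;
      .ite (.lit 0) Var.o (.set .j (.get .Y Var.o) ;; .put .mc Var.j (.lit 0))
        (.set .fnd (.lit 0)))

/-- Augment the matching as long as this is possible. -/
def augmentAll : Cmd :=
  .set .go (.lit 1) ;;
  .loop (.lit 0) Var.go (search ;; .ite (.lit 0) Var.fnd augment (.set .go (.lit 0)))

theorem augment_spec {s : Store} {n a b base : ℕ} {X Y : ℕ → ℕ} (hX : s.f .X = X)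
    (hY : s.f .Y = Y) (hG : Graph n a b X Y) (hfnd : s.v .fnd = 1)
    (hA : Augmenting n a b X Y (s.f .mr) (s.f .mc) base (s.f .vis) (s.f .par) (s.v .j)) :
    wp augment (fun s' => IsMate n a b X Y (s'.f .mr) (s'.f .mc) ∧
      matchSize a (s'.f .mr) = matchSize a (s.f .mr) + 1 ∧
      s'.clock ≤ s.clock + 200 * (s.f .vis (s.v .j) - base + 1)) s := by
  refine wp_loop (fun s' => s'.v .fnd = 1 ∧
      Augmenting n a b X Y (s'.f .mr) (s'.f .mc) base (s.f .vis) (s.f .par) (s'.v .j) ∧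
      matchSize a (s'.f .mr) = matchSize a (s.f .mr) ∧
      s'.clock + 200 * (s.f .vis (s'.v .j) - base) ≤
        s.clock + 200 * (s.f .vis (s.v .j) - base) ∨
      s'.v .fnd = 0 ∧ IsMate n a b X Y (s'.f .mr) (s'.f .mc) ∧
      matchSize a (s'.f .mr) = matchSize a (s.f .mr) + 1 ∧
      s'.clock ≤ s.clock + 200 * (s.f .vis (s.v .j) - base))
    (s.clock + 200 * (s.f .vis (s.v .j) - base)) (Or.inl ⟨hfnd, hA, rfl, le_rfl⟩) ?_
  intro s' hfr hJ
  have hX' : s'.f .X = X := (hfr.f .X rfl).trans hX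
  have hY' : s'.f .Y = Y := (hfr.f .Y rfl).trans hY
  have hpar : s'.f .par = s.f .par := hfr.f .par rfl
  rcases hJ with ⟨hf, hA, hsz, hc⟩ | ⟨hf, hm, hsz, hc⟩
  · have hv := hA.visited
    refine ⟨by omega, fun _ => ?_, fun hn => absurd hn (by simp [Expr.eval, hf])⟩
    simp only [wp_seq, wp_set, wp_put, wp_ite, Expr.eval, Expr.cost,
      Store.set, Store.put, Store.tick, hX', hY', hpar,
      Function.update_self, ne_eq, reduceCtorEq, not_false_eq_true, Function.update_of_ne]
    refine ⟨fun ho => Or.inl ?_, fun ho => Or.inr ?_⟩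
    · obtain ⟨h1, h2, h3⟩ := hA.step hG (by omega)
      have h4 := h1.visited
      exact ⟨hf, h1, h3.trans hsz, by omega⟩
    · obtain ⟨h1, h2⟩ := hA.finish hG (by omega)
      exact ⟨trivial, h1, by rw [h2, hsz], by omega⟩
  · refine ⟨by omega, fun hp => absurd hp (by simp [Expr.eval, hf]), fun _ => ⟨hm, hsz, ?_⟩⟩
    simp only [Store.tick, Expr.cost]
    omega

theorem fillQueue_spec {s : Store} {n a : ℕ} (X : ℕ → ℕ) (ha : s.v .a = a) :
    wp fillQueue (fun s' => (∀ p < s'.v .qt, s'.f .qu p < a ∧ s.f .mr (s'.f .qu p) = 0) ∧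
      (∀ i < a, s.f .mr i = 0 → ∃ p < s'.v .qt, s'.f .qu p = i) ∧
      (∑ p ∈ Finset.range (s'.v .qt), (cnt X (s'.f .qu p) n + 1) ≤
        ∑ i ∈ Finset.range a, if s.f .mr i = 0 then cnt X i n + 1 else 0) ∧
      s'.clock ≤ s.clock + 100 * (a + 1)) s := by
  rw [fillQueue, wp_seq, wp_set]
  refine wp_for (fun k s' => (∀ p < s'.v .qt, s'.f .qu p < k ∧ s.f .mr (s'.f .qu p) = 0) ∧
      (∀ i < k, s.f .mr i = 0 → ∃ p < s'.v .qt, s'.f .qu p = i) ∧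
      (∑ p ∈ Finset.range (s'.v .qt), (cnt X (s'.f .qu p) n + 1) ≤
        ∑ i ∈ Finset.range k, if s.f .mr i = 0 then cnt X i n + 1 else 0))
    0 a 60 rfl (by omega) rfl (fun s' hfr => ?_) (fun _ _ _ h => h) ?_ ?_ ?_
  · simp [Expr.eval, hfr.v .a rfl, Store.set, ha]
  · simp [Store.set, Expr.eval]
  · rintro k s' _ hk hfr hke ⟨h1, h2, h3⟩
    have hmr : s'.f .mr = s.f .mr := hfr.f .mr rfl
    simp only [wp_seq, wp_set, wp_put, wp_ite, wp_skip, Expr.eval, Expr.cost,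
      Store.set, Store.put, Store.tick, hmr, hke,
      Function.update_self, ne_eq, reduceCtorEq, not_false_eq_true, Function.update_of_ne,
      Finset.sum_range_succ]
    refine ⟨fun h0 => ?_, fun h0 => ?_⟩
    · have h0 : s.f .mr k = 0 := by omega
      refine ⟨⟨fun p hp => ?_, fun i hi hi0 => ?_, ?_⟩, by omega⟩
      · by_cases hpq : p = s'.v .qt
        · subst hpq; rw [Function.update_self]; exact ⟨by omega, h0⟩
        · rw [Function.update_of_ne hpq]
          obtain ⟨h4, h5⟩ := h1 p (by omega)
          exact ⟨by omega, h5⟩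
      · by_cases hik : i = k
        · exact ⟨s'.v .qt, by omega, by rw [Function.update_self, hik]⟩
        · obtain ⟨p, hp, hpi⟩ := h2 i (by omega) hi0
          exact ⟨p, by omega, by rw [Function.update_of_ne (by omega)]; exact hpi⟩
      · rw [if_pos h0]
        refine Nat.add_le_add ((Finset.sum_congr rfl fun p hp => ?_).trans_le h3) le_rfl
        rw [Function.update_of_ne (by have := Finset.mem_range.mp hp; omega)]
    · refine ⟨⟨fun p hp => ?_, fun i hi hi0 => ?_, by omega⟩, by omega⟩
      · obtain ⟨h4, h5⟩ := h1 p (by omega)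
        exact ⟨by omega, h5⟩
      · have : i ≠ k := by rintro rfl; omega
        exact h2 i (by omega) hi0
  · rintro s' _ ⟨h1, h2, h3⟩ hc
    refine ⟨h1, h2, h3, ?_⟩
    simp only [Store.set, Expr.cost] at hc
    omega

theorem search_loop_spec {s : Store} {n a b base : ℕ} {X Y nxt head : ℕ → ℕ}
    (hX : s.f .X = X) (hY : s.f .Y = Y) (hnx : s.f .nxt = nxt) (hhd : s.f .head = head)
    (hbase : s.v .base = base) (hst : s.v .st = base)
    (hG : Graph n a b X Y) (hl : Lists n a X nxt head) (hfnd : s.v .fnd = 0) (hrun : s.v .run = 1)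
    (hS : Search n a b X Y (s.f .mr) (s.f .mc) base (s.f .vis) (s.f .par) (s.f .qu)
      (s.v .st) (s.v .qh) (s.v .qt) (s.v .e)) :
    wp (.loop (.lit 0) Var.run searchStep) (fun s' => (∀ j < b, s'.f .vis j ≤ s'.v .st) ∧
      s'.clock + 200 * (s'.v .st - base) ≤ s.clock + 500 *
        (searchPot n a X Y (s.f .mr) base (s.f .vis) (s.f .qu) (s.v .qh) (s.v .qt) (s.v .e) + 1) ∧
      (s'.v .fnd = 0 ∧ Certified n a X Y (s.f .mr) ∨
        s'.v .fnd = 1 ∧ Augmenting n a b X Y (s.f .mr) (s.f .mc) base (s'.f .vis) (s'.f .par)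
          (s'.v .j))) s := by
  -- every stamp sets aside the time that one step of the augmentation takes
  refine wp_loop (fun s' => base ≤ s'.v .st ∧ (∀ j < b, s'.f .vis j ≤ s'.v .st) ∧
    (s'.v .run = 1 ∧ s'.v .fnd = 0 ∧
      Search n a b X Y (s.f .mr) (s.f .mc) base (s'.f .vis) (s'.f .par) (s'.f .qu)
        (s'.v .st) (s'.v .qh) (s'.v .qt) (s'.v .e) ∧
      s'.clock + 200 * (s'.v .st - base) + 500 * (searchPot n a X Y (s.f .mr) base (s'.f .vis)
          (s'.f .qu) (s'.v .qh) (s'.v .qt) (s'.v .e)) ≤ s.clock + 500 *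
        searchPot n a X Y (s.f .mr) base (s.f .vis) (s.f .qu) (s.v .qh) (s.v .qt) (s.v .e) ∨
      s'.v .run = 0 ∧ s'.clock + 200 * (s'.v .st - base) ≤ s.clock + 400 + 500 *
        searchPot n a X Y (s.f .mr) base (s.f .vis) (s.f .qu) (s.v .qh) (s.v .qt) (s.v .e) ∧
      (s'.v .fnd = 0 ∧ Certified n a X Y (s.f .mr) ∨
        s'.v .fnd = 1 ∧ Augmenting n a b X Y (s.f .mr) (s.f .mc) base (s'.f .vis) (s'.f .par)
          (s'.v .j))))
    (s.clock + 400 + 500 *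
        searchPot n a X Y (s.f .mr) base (s.f .vis) (s.f .qu) (s.v .qh) (s.v .qt) (s.v .e))
    ⟨hst.ge, hS.vis_le, Or.inl ⟨hrun, hfnd, hS, by omega⟩⟩ ?_
  rintro s' hfr ⟨hbs, hvis, hJ⟩
  have hX' : s'.f .X = X := (hfr.f .X rfl).trans hX
  have hY' : s'.f .Y = Y := (hfr.f .Y rfl).trans hY
  have hnx' : s'.f .nxt = nxt := (hfr.f .nxt rfl).trans hnx
  have hhd' : s'.f .head = head := (hfr.f .head rfl).trans hhd
  have hmc' : s'.f .mc = s.f .mc := hfr.f .mc rfl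
  have hbase' : s'.v .base = base := (hfr.v .base rfl).trans hbase
  rcases hJ with ⟨hr, hf, hS', hc⟩ | ⟨hr, hc, hfin⟩
  · refine ⟨by omega, fun _ => ?_, fun hn => absurd hn (by simp [Expr.eval, hr])⟩
    have hvis' : ∀ m, ∀ j < b,
        Function.update (s'.f .vis) m (s'.v .st + 1) j ≤ s'.v .st + 1 := by
      intro m j hj
      by_cases hjm : j = m
      · subst hjm; rw [Function.update_self]
      · rw [Function.update_of_ne hjm]; have := hvis j hj; omega
    simp only [searchStep, wp_seq, wp_set, wp_put, wp_ite, Expr.eval, Expr.cost,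
      Store.set, Store.put, Store.tick, hX', hY', hnx', hhd', hmc', hbase',
      Function.update_self, ne_eq, reduceCtorEq, not_false_eq_true, Function.update_of_ne]
    refine ⟨fun he => ⟨fun hv => ?_, fun hv => ⟨fun ho => ?_, fun ho => ?_⟩⟩,
      fun he => ⟨fun hq => ?_, fun hq => ?_⟩⟩
    · obtain ⟨h1, h2⟩ := hS'.skip hl (by omega) hv
      exact ⟨hbs, hvis, Or.inl ⟨hr, hf, h1, by omega⟩⟩
    · obtain ⟨h1, h2⟩ := hS'.visit hG hl (by omega) hv (by omega)
      exact ⟨by omega, hvis' _, Or.inl ⟨hr, hf, h1, by omega⟩⟩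
    · have h1 := hS'.found hG (by omega) hv (by omega)
      exact ⟨by omega, hvis' _, Or.inr ⟨trivial, by omega, Or.inr ⟨trivial, h1⟩⟩⟩
    · have he0 : s'.v .e = 0 := by omega
      rw [he0] at hS' hc
      obtain ⟨h1, h2⟩ := hS'.pop hl hq
      exact ⟨hbs, hvis, Or.inl ⟨hr, hf, h1, by omega⟩⟩
    · have he0 : s'.v .e = 0 := by omega
      rw [he0] at hS'
      exact ⟨hbs, hvis, Or.inr ⟨trivial, by omega, Or.inl ⟨hf, hS'.certified hG hq⟩⟩⟩
  · refine ⟨by omega, fun hp => absurd hp (by simp [Expr.eval, hr]), fun _ => ⟨hvis, ?_, hfin⟩⟩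
    simp only [Store.tick, Expr.cost]
    omega

theorem search_spec {s : Store} {n a b : ℕ} {X Y nxt head : ℕ → ℕ}
    (hX : s.f .X = X) (hY : s.f .Y = Y) (hnx : s.f .nxt = nxt) (hhd : s.f .head = head)
    (ha : s.v .a = a) (hG : Graph n a b X Y) (hl : Lists n a X nxt head)
    (hm : IsMate n a b X Y (s.f .mr) (s.f .mc)) (hvis : ∀ j < b, s.f .vis j ≤ s.v .st) :
    wp search (fun s' => (∀ j < b, s'.f .vis j ≤ s'.v .st) ∧
      s'.clock + 200 * (s'.v .st - s.v .st) ≤ s.clock + 700 * (n + a + 1) ∧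
      (s'.v .fnd = 0 ∧ Certified n a X Y (s.f .mr) ∨
        s'.v .fnd = 1 ∧ Augmenting n a b X Y (s.f .mr) (s.f .mc) (s.v .st) (s'.f .vis)
          (s'.f .par) (s'.v .j))) s := by
  rw [search, wp_seq, wp_set, wp_seq]
  refine wp_of_wp (fillQueue_spec (n := n) (a := a) X ?_) fun s₁ hfr₁ ⟨h1, h2, h3, hc₁⟩ => ?_
  · simp [Store.set, ha]
  · have hf : ∀ F, F ≠ .qu → s₁.f F = s.f F := fun F hF =>
      hfr₁.f F (by simpa [fillQueue, Cmd.for, Cmd.modF] using Ne.symm hF)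
    have hst : s₁.v .st = s.v .st := by rw [hfr₁.v .st rfl]; rfl
    have hbase : s₁.v .base = s.v .st := by
      rw [hfr₁.v .base rfl]; simp [Store.set, Expr.eval]
    simp only [Store.set, Expr.cost] at h1 h2 h3 hc₁
    simp only [wp_seq, wp_set, Expr.eval, Expr.cost, Store.set]
    have hpot := Search.pot_start (vis := s.f .vis) (base := s.v .st) (mr := s.f .mr) hG h3
    have hS : Search n a b X Y (s.f .mr) (s.f .mc) (s.v .st) (s.f .vis) (s.f .par) (s₁.f .qu)
        (s.v .st) 0 (s₁.v .qt) 0 := Search.start hm hvis h1 h2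
    refine wp_mono (search_loop_spec (n := n) (a := a) (b := b) (X := X) (Y := Y)
      (nxt := nxt) (head := head) (base := s.v .st) ?_ ?_ ?_ ?_ ?_ ?_ hG hl ?_ ?_ ?_)
      fun s₂ h => ?_
    · simp [hf, hX]
    · simp [hf, hY]
    · simp [hf, hnx]
    · simp [hf, hhd]
    · simp [hbase]
    · simp [hst]
    · simp
    · simp
    · simp only [ne_eq, reduceCtorEq, not_false_eq_true, Function.update_of_ne,
        Function.update_self, hf, hst]
      exact hS
    · obtain ⟨g1, g2, g3⟩ := h
      simp only [ne_eq, reduceCtorEq, not_false_eq_true, Function.update_of_ne,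
        Function.update_self, hf] at g2 g3
      refine ⟨g1, ?_, g3⟩
      linarith

/-- Few phases are needed, because the matching that the auction leaves is nearly maximum. -/
theorem augmentAll_spec {s : Store} {n a b L : ℕ} {X Y nxt head : ℕ → ℕ}
    (hX : s.f .X = X) (hY : s.f .Y = Y) (hnx : s.f .nxt = nxt) (hhd : s.f .head = head)
    (ha : s.v .a = a) (hG : Graph n a b X Y) (hl : Lists n a X nxt head)
    (hm : IsMate n a b X Y (s.f .mr) (s.f .mc)) (hvis : ∀ j < b, s.f .vis j ≤ s.v .st)
    (hL : 0 < L) (haL : a ≤ L * L) (happrox : ∀ mr' mc', IsMate n a b X Y mr' mc' →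
        L * matchSize a mr' ≤ matchSize a (s.f .mr) * (L + 1)) :
    wp augmentAll (fun s' => IsMate n a b X Y (s'.f .mr) (s'.f .mc) ∧
      Certified n a X Y (s'.f .mr) ∧
      s'.clock ≤ s.clock + 1000 * ((L + 2) * (n + a + 1))) s := by
  have hbound : ∀ mr' mc', IsMate n a b X Y mr' mc' →
      matchSize a mr' ≤ matchSize a (s.f .mr) + L := by
    intro mr' mc' h
    have h1 := happrox mr' mc' h
    have h2 := matchSize_le a (s.f .mr)
    refine Nat.le_of_mul_le_mul_left (h1.trans ?_) hL
    rw [mul_add, mul_add, mul_comm, mul_one]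
    omega
  rw [augmentAll, wp_seq, wp_set]
  refine wp_loop (fun s' => (∀ j < b, s'.f .vis j ≤ s'.v .st) ∧
      IsMate n a b X Y (s'.f .mr) (s'.f .mc) ∧
      (s'.v .go = 1 ∧ s'.clock + (matchSize a (s.f .mr) + L - matchSize a (s'.f .mr)) *
          (1000 * (n + a + 1)) ≤ s.clock + 10 + L * (1000 * (n + a + 1)) ∨
        s'.v .go = 0 ∧ Certified n a X Y (s'.f .mr) ∧
          s'.clock ≤ s.clock + 10 + (L + 1) * (1000 * (n + a + 1))))
    (s.clock + 10 + (L + 1) * (1000 * (n + a + 1)))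
    ⟨hvis, hm, Or.inl ⟨by simp [Store.set, Expr.eval], ?_⟩⟩ ?_
  · simp only [Store.set, Expr.cost]
    rw [Nat.add_sub_cancel_left]
    omega
  · rintro s' hfr ⟨hv, hm', hJ⟩
    have hX' : s'.f .X = X := (hfr.f .X rfl).trans hX
    have hY' : s'.f .Y = Y := (hfr.f .Y rfl).trans hY
    have hnx' : s'.f .nxt = nxt := (hfr.f .nxt rfl).trans hnx
    have hhd' : s'.f .head = head := (hfr.f .head rfl).trans hhd
    have ha' : s'.v .a = a := (hfr.v .a rfl).trans (by simpa [Store.set] using ha)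
    have hL1 : (L + 1) * (1000 * (n + a + 1)) = L * (1000 * (n + a + 1)) + 1000 * (n + a + 1) := by
      ring
    rcases hJ with ⟨hgo, hc⟩ | ⟨hgo, hcert, hc⟩
    · refine ⟨by omega, fun _ => ?_, fun hn => absurd hn (by simp [Expr.eval, hgo])⟩
      rw [wp_seq]
      refine wp_of_wp (search_spec (n := n) (a := a) (b := b) (X := X) (Y := Y)
        (nxt := nxt) (head := head) hX' hY' hnx' hhd' ha' hG hl hm' hv)
        fun s₁ hfr₁ ⟨h1, h2, h3⟩ => ?_
      simp only [Store.tick, Expr.cost] at h2 h3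
      have hmr₁ : s₁.f .mr = s'.f .mr := hfr₁.f .mr rfl
      have hmc₁ : s₁.f .mc = s'.f .mc := hfr₁.f .mc rfl
      have hgo₁ : s₁.v .go = 1 := (hfr₁.v .go rfl).trans hgo
      simp only [wp_ite, wp_set, Expr.eval, Expr.cost]
      refine ⟨fun hf => ?_, fun hf => ?_⟩
      · obtain ⟨hf1, hA⟩ : s₁.v .fnd = 1 ∧ _ := h3.resolve_left (by omega)
        refine wp_of_wp (augment_spec (n := n) (a := a) (b := b) (base := s'.v .st) (X := X)
          (Y := Y) ((hfr₁.f .X rfl).trans hX') ((hfr₁.f .Y rfl).trans hY') hG hf1 ?_)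
          fun s₂ hfr₂ ⟨g1, g2, g3⟩ => ?_
        · simp only [Store.tick]
          rw [hmr₁, hmc₁]
          exact hA
        · have hvis₂ : s₂.f .vis = s₁.f .vis := hfr₂.f .vis rfl
          have hst₂ : s₂.v .st = s₁.v .st := hfr₂.v .st rfl
          have hgo₂ : s₂.v .go = s₁.v .go := hfr₂.v .go rfl
          simp only [Store.tick, hmr₁] at g2 g3
          have hj := h1 _ hA.lt
          have hj' := hA.visited
          have hb := hbound _ _ g1
          refine ⟨by rw [hvis₂, hst₂]; exact h1, g1, Or.inl ⟨by omega, ?_⟩⟩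
          obtain ⟨m, hm⟩ : ∃ m, matchSize a (s.f .mr) + L - matchSize a (s'.f .mr) = m + 1 :=
            ⟨matchSize a (s.f .mr) + L - matchSize a (s'.f .mr) - 1, by omega⟩
          rw [show matchSize a (s.f .mr) + L - matchSize a (s₂.f .mr) = m by omega]
          rw [hm, add_mul, one_mul] at hc
          omega
      · obtain ⟨-, hcert⟩ := h3.resolve_right (by omega)
        refine ⟨h1, ?_, Or.inr ⟨by simp [Store.set, Store.tick], ?_, ?_⟩⟩
        · simp only [Store.set, Store.tick, hmr₁, hmc₁]; exact hm'
        · simp only [Store.set, Store.tick, hmr₁]; exact hcert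
        · simp only [Store.set, Store.tick]
          omega
    · refine ⟨by omega, fun hp => absurd hp (by simp [Expr.eval, hgo]), fun _ =>
        ⟨hm', hcert, ?_⟩⟩
      simp only [Store.tick, Expr.cost]
      rw [show 1000 * ((L + 2) * (n + a + 1)) =
        (L + 1) * (1000 * (n + a + 1)) + 1000 * (n + a + 1) by ring]
      omega

end Imp


/-! ### A minimum edge cover from a maximum matching -/

namespace Matching

/-- The number of marked edges at the node `i`, when the edge `e` has its end at `x e`. -/
def deg (n : ℕ) (keep x : ℕ → ℕ) (i : ℕ) : ℕ :=
  ((Finset.Icc 1 n).filter fun e => keep e ≠ 0 ∧ x e = i).card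

/-- The set of marked edges. -/
def kept (n : ℕ) (keep : ℕ → ℕ) : Finset ℕ := (Finset.Icc 1 n).filter fun e => keep e ≠ 0

theorem deg_ne_zero {n : ℕ} {keep x : ℕ → ℕ} {i : ℕ} :
    deg n keep x i ≠ 0 ↔ i ∈ (kept n keep).image x := by
  rw [deg, ne_eq, Finset.card_eq_zero, ← ne_eq, ← Finset.nonempty_iff_ne_empty]
  simp only [Finset.Nonempty, Finset.mem_filter, Finset.mem_image, kept, and_assoc]

theorem kept_update {n : ℕ} {keep : ℕ → ℕ} {e : ℕ} (h1 : 1 ≤ e) (hn : e ≤ n) :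
    kept n (Function.update keep e 1) = insert e (kept n keep) := by
  ext e'
  simp only [kept, Finset.mem_filter, Finset.mem_insert, Finset.mem_Icc]
  by_cases h : e' = e
  · subst h; simp [h1, hn]
  · simp [h]

theorem deg_update {n : ℕ} {keep : ℕ → ℕ} {e : ℕ} (h1 : 1 ≤ e) (hn : e ≤ n) (h0 : keep e = 0)
    (x : ℕ → ℕ) :
    deg n (Function.update keep e 1) x =
      Function.update (deg n keep x) (x e) (deg n keep x (x e) + 1) := by
  funext i
  have key : ∀ i, ((Finset.Icc 1 n).filter fun e' => Function.update keep e 1 e' ≠ 0 ∧ x e' = i) =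
      if x e = i then insert e ((Finset.Icc 1 n).filter fun e' => keep e' ≠ 0 ∧ x e' = i)
      else (Finset.Icc 1 n).filter fun e' => keep e' ≠ 0 ∧ x e' = i := by
    intro i
    ext e'
    by_cases h : e' = e
    · subst h
      split_ifs with hx <;> simp [h1, hn, hx]
    · split_ifs with hx <;> simp [h]
  rw [deg, key]
  by_cases hx : i = x e
  · subst hx
    rw [if_pos rfl, Finset.card_insert_of_notMem (by simp [h0]), Function.update_self]
    rfl
  · rw [if_neg (Ne.symm hx), Function.update_of_ne hx]
    rfl

/-- A stage of the construction of an edge cover from the matching `mr`: every edge that is added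
touches a row or a column that was not touched before. -/
structure Covering (n a : ℕ) (X Y mr keep dr dc : ℕ → ℕ) : Prop where
  row_deg : dr = deg n keep X
  col_deg : dc = deg n keep Y
  card_add_le : (kept n keep).card + matchSize a mr ≤
    ((kept n keep).image X).card + ((kept n keep).image Y).card

namespace Covering

variable {n a b : ℕ} {X Y mr mc keep dr dc : ℕ → ℕ}

theorem start (hG : Graph n a b X Y) (hm : IsMate n a b X Y mr mc)
    (hdr : dr = deg n keep X) (hdc : dc = deg n keep Y)
    (hk : ∀ e, keep e ≠ 0 ↔ 1 ≤ e ∧ e ≤ n ∧ mr (X e) = e) : Covering n a X Y mr keep dr dc := by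
  have hmem : ∀ e, e ∈ kept n keep ↔ 1 ≤ e ∧ e ≤ n ∧ mr (X e) = e := by
    intro e
    simp only [kept, Finset.mem_filter, Finset.mem_Icc, hk]
    tauto
  refine ⟨hdr, hdc, ?_⟩
  rw [Finset.card_image_of_injOn, Finset.card_image_of_injOn]
  · refine Nat.add_le_add_left (Finset.card_le_card_of_injOn mr (fun i hi => ?_) ?_) _
    · have hi := Finset.mem_filter.mp (Finset.mem_coe.mp hi)
      obtain ⟨h1, h2, -⟩ := hm.row i (Finset.mem_range.mp hi.1) hi.2
      exact Finset.mem_coe.mpr ((hmem _).mpr ⟨Nat.pos_of_ne_zero hi.2, h1, by rw [h2]⟩)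
    · intro i hi i' hi' h
      have hi := Finset.mem_filter.mp (Finset.mem_coe.mp hi)
      have hi' := Finset.mem_filter.mp (Finset.mem_coe.mp hi')
      rw [← (hm.row i (Finset.mem_range.mp hi.1) hi.2).2.1, h]
      exact (hm.row i' (Finset.mem_range.mp hi'.1) hi'.2).2.1
  · have hcol : ∀ e ∈ kept n keep, mc (Y e) = e := by
      intro e he
      obtain ⟨h1, h2, h3⟩ := (hmem e).mp he
      have := (hm.row (X e) (hG.row_lt e h1 h2) (by omega)).2.2
      rwa [h3] at this
    intro e he e' he' h
    rw [← hcol e he, ← hcol e' he', h]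
  · intro e he e' he' h
    rw [← ((hmem e).mp he).2.2, ← ((hmem e').mp he').2.2, h]

theorem add (h : Covering n a X Y mr keep dr dc) {e : ℕ} (h1 : 1 ≤ e) (hn : e ≤ n)
    (h0 : keep e = 0) (hnew : dr (X e) = 0 ∨ dc (Y e) = 0) :
    Covering n a X Y mr (Function.update keep e 1) (Function.update dr (X e) (dr (X e) + 1))
      (Function.update dc (Y e) (dc (Y e) + 1)) := by
  refine ⟨by rw [h.row_deg, deg_update h1 hn h0], by rw [h.col_deg, deg_update h1 hn h0], ?_⟩
  rw [kept_update h1 hn, Finset.image_insert, Finset.image_insert,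
    Finset.card_insert_of_notMem (by simp [kept, h0])]
  have hle := h.card_add_le
  rcases hnew with h2 | h2
  · rw [h.row_deg] at h2
    rw [Finset.card_insert_of_notMem fun hc => deg_ne_zero.mpr hc h2]
    have := Finset.card_le_card (Finset.subset_insert (Y e) ((kept n keep).image Y))
    omega
  · rw [h.col_deg] at h2
    rw [Finset.card_insert_of_notMem (a := Y e) fun hc => deg_ne_zero.mpr hc h2]
    have := Finset.card_le_card (Finset.subset_insert (X e) ((kept n keep).image X))
    omega

/-- Each edge taken beyond the matching covers a new row or column, so the edges taken and those
of the matching are together at most as many as the rows and columns with edges. By the certificate,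
every edge cover and the matching are together at least as many. -/
theorem card_kept_le (h : Covering n a X Y mr keep dr dc) (hc : Certified n a X Y mr) {F : Finset ℕ}
    (hF : F ⊆ Finset.Icc 1 n) (hX : ∀ e ∈ Finset.Icc 1 n, ∃ e' ∈ F, X e' = X e)
    (hY : ∀ e ∈ Finset.Icc 1 n, ∃ e' ∈ F, Y e' = Y e) : (kept n keep).card ≤ F.card := by
  have h1 := h.card_add_le
  have h2 := hc F hF hX hY
  have h3 : kept n keep ⊆ Finset.Icc 1 n := Finset.filter_subset _ _
  have h4 := Finset.card_le_card (Finset.image_subset_image (f := X) h3)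
  have h5 := Finset.card_le_card (Finset.image_subset_image (f := Y) h3)
  omega

end Covering

/-- `g 0, …, g (c - 1)` lists the elements of `S` in increasing order. -/
structure Enumerates (S : Finset ℕ) (c : ℕ) (g : ℕ → ℕ) : Prop where
  mem : ∀ p < c, g p ∈ S
  lt : ∀ p q, p < q → q < c → g p < g q
  exists_eq : ∀ i ∈ S, ∃ p < c, g p = i

theorem Enumerates.injOn {S : Finset ℕ} {c : ℕ} {g : ℕ → ℕ} (h : Enumerates S c g) :
    Set.InjOn g (Finset.range c) := by
  intro p hp q hq hpq
  have hp := Finset.mem_range.mp (Finset.mem_coe.mp hp)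
  have hq := Finset.mem_range.mp (Finset.mem_coe.mp hq)
  rcases lt_trichotomy p q with hlt | heq | hlt
  · have := h.lt p q hlt hq; omega
  · exact heq
  · have := h.lt q p hlt hp; omega

theorem Enumerates.card_eq {S : Finset ℕ} {c : ℕ} {g : ℕ → ℕ} (h : Enumerates S c g) :
    S.card = c := by
  have : S = (Finset.range c).image g := by
    ext i
    simp only [Finset.mem_image, Finset.mem_range]
    exact ⟨h.exists_eq i, fun ⟨p, hp, hi⟩ => hi ▸ h.mem p hp⟩
  rw [this, Finset.card_image_of_injOn h.injOn, Finset.card_range]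

end Matching

namespace Imp

open Matching

/-- Mark the edge `e`. -/
def keepEdge : Cmd :=
  .put .keep Var.e (.lit 1) ;;
  .put .dr (.get .X Var.e) (.add (.get .dr (.get .X Var.e)) (.lit 1)) ;;
  .put .dc (.get .Y Var.e) (.add (.get .dc (.get .Y Var.e)) (.lit 1))

/-- Mark the edges of the matching, and then every edge that touches a new row or column. -/
def coverEdges : Cmd :=
  .for .e (.lit 1) (.add Var.n (.lit 1))
    (.ite Var.e (.get .mr (.get .X Var.e)) .skip
      (.ite (.get .mr (.get .X Var.e)) Var.e .skip keepEdge)) ;;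
  .for .e (.lit 1) (.add Var.n (.lit 1))
    (.ite (.lit 0) (.get .keep Var.e) .skip
      (.ite (.get .dr (.get .X Var.e)) (.lit 1) keepEdge
        (.ite (.get .dc (.get .Y Var.e)) (.lit 1) keepEdge .skip)))

theorem coverEdges_spec {s : Store} {n a b : ℕ} {X Y : ℕ → ℕ} (hX : s.f .X = X)
    (hY : s.f .Y = Y) (hn : s.v .n = n) (hG : Graph n a b X Y)
    (hm : IsMate n a b X Y (s.f .mr) (s.f .mc)) (hkeep : s.f .keep = fun _ => 0)
    (hdr : s.f .dr = fun _ => 0) (hdc : s.f .dc = fun _ => 0) :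
    wp coverEdges (fun s' =>
      Covering n a X Y (s.f .mr) (s'.f .keep) (s'.f .dr) (s'.f .dc) ∧
      (∀ e, 1 ≤ e → e ≤ n → s'.f .dr (X e) ≠ 0 ∧ s'.f .dc (Y e) ≠ 0) ∧
      s'.clock ≤ s.clock + 500 * (n + 1)) s := by
  rw [coverEdges, wp_seq]
  refine wp_for (fun k s' => s'.f .dr = deg n (s'.f .keep) X ∧ s'.f .dc = deg n (s'.f .keep) Y ∧
      ∀ e, s'.f .keep e ≠ 0 ↔ 1 ≤ e ∧ e < k ∧ s.f .mr (X e) = e) 1 (n + 1) 200 rfl (by omega) rfl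
    (fun s' hfr => ?_) (fun _ _ _ h => h) ⟨?_, ?_, ?_⟩ ?_ ?_
  · simp [Expr.eval, hfr.v .n rfl, hn]
  · funext i; simp [Store.set, hdr, hkeep, deg]
  · funext i; simp [Store.set, hdc, hkeep, deg]
  · intro e; simp only [Store.set, hkeep, ne_eq, not_true, false_iff]; omega
  · intro k s' hk1 hk2 hfr hke ⟨hJ1, hJ2, hJ3⟩
    have hX' : s'.f .X = X := (hfr.f .X rfl).trans hX
    have hY' : s'.f .Y = Y := (hfr.f .Y rfl).trans hY
    have hmr' : s'.f .mr = s.f .mr := hfr.f .mr rfl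
    have hk0 : s'.f .keep k = 0 := by
      by_contra hc
      exact absurd ((hJ3 k).mp hc).2.1 (lt_irrefl k)
    have hskip : s.f .mr (X k) ≠ k →
        ∀ e, s'.f .keep e ≠ 0 ↔ 1 ≤ e ∧ e < k + 1 ∧ s.f .mr (X e) = e := by
      intro hne e
      rw [hJ3]
      refine ⟨fun ⟨h1, h2, h3⟩ => ⟨h1, by omega, h3⟩, fun ⟨h1, h2, h3⟩ => ⟨h1, ?_, h3⟩⟩
      have : e ≠ k := by rintro rfl; exact hne h3
      omega
    simp only [keepEdge, wp_ite, wp_seq, wp_put, wp_skip, Expr.eval, Expr.cost, Store.set,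
      Store.put, Store.tick, hke, hX', hY', hmr', Function.update_self, ne_eq, reduceCtorEq,
      not_false_eq_true, Function.update_of_ne]
    refine ⟨fun h => ⟨⟨hJ1, hJ2, hskip (by omega)⟩, by omega⟩,
      fun h => ⟨fun h' => ⟨⟨hJ1, hJ2, hskip (by omega)⟩, by omega⟩, fun h' =>
        ⟨⟨?_, ?_, fun e => ?_⟩, by omega⟩⟩⟩
    · rw [deg_update hk1 (by omega) hk0, hJ1]
    · rw [deg_update hk1 (by omega) hk0, hJ2]
    · by_cases hek : e = k
      · subst hek
        simp only [Function.update_self]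
        exact ⟨fun _ => ⟨hk1, by omega, by omega⟩, fun _ => by omega⟩
      · rw [Function.update_of_ne hek]
        refine (hJ3 e).trans ⟨fun ⟨h1, h2, h3⟩ => ⟨h1, by omega, h3⟩,
          fun ⟨h1, h2, h3⟩ => ⟨h1, by omega, h3⟩⟩
  · intro s₁ hfr₁ ⟨hJ1, hJ2, hJ3⟩ hc₁
    have hstart := Covering.start hG hm hJ1 hJ2 fun e => by
      rw [hJ3, Nat.lt_succ_iff]
    refine wp_for (fun k s' => Covering n a X Y (s.f .mr) (s'.f .keep) (s'.f .dr) (s'.f .dc) ∧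
        ∀ e, 1 ≤ e → e < k → s'.f .dr (X e) ≠ 0 ∧ s'.f .dc (Y e) ≠ 0) 1 (n + 1) 200 rfl (by omega)
      rfl (fun s' hfr => ?_) (fun _ _ _ h => h) ⟨hstart, fun _ _ _ => by omega⟩ ?_ ?_
    · simp [Expr.eval, hfr.v .n rfl, hfr₁.v .n rfl, hn]
    · intro k s' hk1 hk2 hfr hke ⟨hC, hJ⟩
      have hX' : s'.f .X = X := (hfr.f .X rfl).trans ((hfr₁.f .X rfl).trans hX)
      have hY' : s'.f .Y = Y := (hfr.f .Y rfl).trans ((hfr₁.f .Y rfl).trans hY)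
      have hstay : s'.f .dr (X k) ≠ 0 → s'.f .dc (Y k) ≠ 0 →
          ∀ e, 1 ≤ e → e < k + 1 → s'.f .dr (X e) ≠ 0 ∧ s'.f .dc (Y e) ≠ 0 := by
        intro h1 h2 e h3 h4
        by_cases he : e = k
        · subst he; exact ⟨h1, h2⟩
        · exact hJ e h3 (by omega)
      have hmono : ∀ (g : ℕ → ℕ) (i j : ℕ), g i ≠ 0 ∨ i = j →
          Function.update g j (g j + 1) i ≠ 0 := by
        intro g i j h
        by_cases hij : i = j
        · subst hij; simp
        · rw [Function.update_of_ne hij]; exact h.resolve_right hij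
      have hgrow : ∀ e, 1 ≤ e → e < k + 1 →
          Function.update (s'.f .dr) (X k) (s'.f .dr (X k) + 1) (X e) ≠ 0 ∧
          Function.update (s'.f .dc) (Y k) (s'.f .dc (Y k) + 1) (Y e) ≠ 0 := by
        intro e h1 h2
        by_cases he : e = k
        · subst he; exact ⟨hmono _ _ _ (Or.inr rfl), hmono _ _ _ (Or.inr rfl)⟩
        · obtain ⟨h3, h4⟩ := hJ e h1 (by omega)
          exact ⟨hmono _ _ _ (Or.inl h3), hmono _ _ _ (Or.inl h4)⟩
      simp only [keepEdge, wp_ite, wp_seq, wp_put, wp_skip, Expr.eval, Expr.cost, Store.set,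
        Store.put, Store.tick, hke, hX', hY', Function.update_self, ne_eq, reduceCtorEq,
        not_false_eq_true, Function.update_of_ne]
      refine ⟨fun h => ⟨⟨hC, hstay ?_ ?_⟩, by omega⟩, fun h => ⟨fun h2 => ⟨⟨hC.add hk1 (by omega)
        (by omega) (Or.inl (by omega)), hgrow⟩, by omega⟩, fun h2 => ⟨fun h3 => ⟨⟨hC.add hk1
        (by omega) (by omega) (Or.inr (by omega)), hgrow⟩, by omega⟩, fun h3 =>
        ⟨⟨hC, hstay (by omega) (by omega)⟩, by omega⟩⟩⟩⟩
      · rw [hC.row_deg, deg_ne_zero]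
        exact Finset.mem_image_of_mem X (Finset.mem_filter.mpr
          ⟨Finset.mem_Icc.mpr ⟨hk1, by omega⟩, by omega⟩)
      · rw [hC.col_deg, deg_ne_zero]
        exact Finset.mem_image_of_mem Y (Finset.mem_filter.mpr
          ⟨Finset.mem_Icc.mpr ⟨hk1, by omega⟩, by omega⟩)
    · intro s₂ hfr₂ ⟨hC, hJ⟩ hc₂
      simp only [Expr.cost] at hc₁ hc₂
      exact ⟨hC, fun e h1 h2 => hJ e h1 (by omega), by omega⟩

/-- List the empty lines below `bd` in the array `G`, and count them in `res`. -/
def listGaps (bd res : Var) (D G : Fld) : Cmd :=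
  .set res (.lit 0) ;;
  .for .i (.lit 0) bd (.ite (.get D Var.i) (.lit 1)
    (.put G res Var.i ;; .set res (.add res (.lit 1))) .skip)

theorem listGaps_spec {bd res : Var} {D G : Fld} (hbr : bd ≠ res) (hbi : bd ≠ .i) (hri : res ≠ .i)
    (hDG : D ≠ G) {s : Store} :
    wp (listGaps bd res D G) (fun s' =>
      Enumerates ((Finset.range (s.v bd)).filter fun i => s.f D i = 0) (s'.v res) (s'.f G) ∧
      s'.clock ≤ s.clock + 100 * (s.v bd + 1)) s := by
  rw [listGaps, wp_seq, wp_set]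
  refine wp_for (fun k s' => Enumerates ((Finset.range k).filter fun i => s.f D i = 0)
      (s'.v res) (s'.f G)) 0 (s.v bd) 60 rfl (by omega) (by simp [Cmd.modV, hri])
      (fun s' hfr => ?_) (fun _ _ _ h => h) ?_ ?_ ?_
  · simp only [Expr.eval]
    rw [hfr.v bd (by simp [Cmd.for, Cmd.modV, hbi.symm, hbr.symm])]
    simp only [Store.set]
    rw [Function.update_of_ne hbr]
  · refine ⟨fun p hp => ?_, fun p q _ hq => ?_, fun i hi => by simp at hi⟩
    · simp [Store.set, Expr.eval, hri] at hp
    · simp [Store.set, Expr.eval, hri] at hq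
  · intro k s' _ hk2 hfr hke hJ
    have hD : s'.f D = s.f D := hfr.f D (by simp [Cmd.for, Cmd.modF, hDG.symm])
    simp only [wp_ite, wp_seq, wp_put, wp_set, wp_skip, Expr.eval, Expr.cost, Store.set, Store.put,
      Store.tick, hke, hD, Function.update_of_ne hri, Function.update_self]
    rw [Finset.range_add_one, Finset.filter_insert]
    refine ⟨fun h => ⟨?_, by omega⟩, fun h => ⟨?_, by omega⟩⟩
    · rw [if_pos (by omega)]
      constructor
      · intro p hp
        by_cases hpr : p = s'.v res
        · subst hpr; simp
        · rw [Function.update_of_ne hpr]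
          exact Finset.mem_insert_of_mem (hJ.mem p (by omega))
      · intro p q hpq hq
        rw [Function.update_of_ne (by omega : p ≠ s'.v res)]
        by_cases hqr : q = s'.v res
        · subst hqr
          rw [Function.update_self]
          simpa using (Finset.mem_filter.mp (hJ.mem p hpq)).1
        · rw [Function.update_of_ne hqr]
          exact hJ.lt p q hpq (by omega)
      · intro i hi
        rcases Finset.mem_insert.mp hi with rfl | hi
        · exact ⟨s'.v res, by omega, Function.update_self _ _ _⟩
        · obtain ⟨p, hp, hpi⟩ := hJ.exists_eq i hi
          exact ⟨p, by omega, by rw [Function.update_of_ne (by omega)]; exact hpi⟩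
    · rw [if_neg (by omega)]
      exact hJ
  · intro s' _ hJ hc
    simp only [Store.set, Expr.cost] at hc
    exact ⟨hJ, by omega⟩

end Imp


/-! ### The moves of the algorithm in terms of relative coordinates -/

namespace AlgorithmOne

open Matching Imp

variable {n : ℕ}

/-- The entries `g u, …, g (R - 1)` of a list of lines along `f`. -/
def pending (I : IntConfig n) (f : Fin 2) (g : ℕ → ℕ) (u R : ℕ) : Finset ℤ :=
  (Finset.Ico u R).image fun p => I.lo f + (g p : ℤ)

theorem mem_pending {I : IntConfig n} {f : Fin 2} {g : ℕ → ℕ} {u R : ℕ} {i : ℤ} :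
    i ∈ pending I f g u R ↔ ∃ p, u ≤ p ∧ p < R ∧ I.lo f + (g p : ℤ) = i := by
  simp [pending, and_assoc]

theorem isLeast_pending {I : IntConfig n} {f : Fin 2} {g : ℕ → ℕ} {u R : ℕ} {S : Finset ℕ}
    (h : Enumerates S R g) (hu : u < R) :
    IsLeast (pending I f g u R : Set ℤ) (I.lo f + (g u : ℤ)) := by
  refine ⟨Finset.mem_coe.mpr (mem_pending.mpr ⟨u, le_rfl, hu, rfl⟩), fun i hi => ?_⟩
  obtain ⟨p, hp, hpR, rfl⟩ := mem_pending.mp (Finset.mem_coe.mp hi)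
  rcases hp.eq_or_lt with rfl | hlt
  · exact le_rfl
  · have := h.lt u p hlt hpR
    omega

theorem pending_erase {I : IntConfig n} {f : Fin 2} {g : ℕ → ℕ} {u R : ℕ} {S : Finset ℕ}
    (h : Enumerates S R g) (hu : u < R) :
    (pending I f g u R).erase (I.lo f + (g u : ℤ)) = pending I f g (u + 1) R := by
  ext i
  rw [Finset.mem_erase, mem_pending, mem_pending]
  constructor
  · rintro ⟨hi, p, h1, h2, rfl⟩
    have : p ≠ u := by rintro rfl; exact hi rfl
    exact ⟨p, by omega, h2, rfl⟩
  · rintro ⟨p, h1, h2, rfl⟩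
    have := h.lt u p h1 h2
    exact ⟨by omega, p, by omega, h2, rfl⟩

theorem gaps_eq_pending {I : IntConfig n} {f : Fin 2} {x g : ℕ → ℕ} {R : ℕ}
    (hx : ∀ k : Fin n, I.pos k f = I.lo f + (x (k + 1) : ℤ))
    (h : Enumerates (freeSet (I.side f) n x) R g) : I.gaps f = pending I f g 0 R := by
  have hfree : ∀ i : ℕ, i ∈ freeSet (I.side f) n x ↔ I.lo f + (i : ℤ) ∈ I.gaps f := by
    intro i
    rw [IntConfig.mem_gaps, IntConfig.mem_lines]
    simp only [freeSet, Finset.mem_filter, Finset.mem_range, Finset.mem_image, Finset.mem_Icc,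
      hx, not_exists, not_and]
    refine ⟨fun ⟨h1, h2⟩ => ⟨by omega, fun k hk => ?_⟩, fun ⟨h1, h2⟩ => ⟨by omega, ?_⟩⟩
    · exact h2 (k + 1) ⟨by omega, k.2⟩ (by omega)
    · rintro e ⟨h3, h4⟩ rfl
      refine h2 ⟨e - 1, by omega⟩ ?_
      simp only [show e - 1 + 1 = e by omega]
  ext i
  rw [mem_pending]
  constructor
  · intro hi
    have hl := IntConfig.mem_lines.mp (IntConfig.mem_gaps.mp hi).1
    obtain ⟨j, hj⟩ : ∃ j : ℕ, i = I.lo f + (j : ℤ) := ⟨(i - I.lo f).toNat, by omega⟩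
    subst hj
    obtain ⟨p, hp, hpj⟩ := h.exists_eq j ((hfree j).mpr hi)
    exact ⟨p, by omega, hp, by rw [hpj]⟩
  · rintro ⟨p, -, hp, rfl⟩
    exact (hfree _).mp (h.mem p hp)

theorem card_gaps_eq {I : IntConfig n} {f : Fin 2} {x g : ℕ → ℕ} {R : ℕ}
    (hx : ∀ k : Fin n, I.pos k f = I.lo f + (x (k + 1) : ℤ))
    (h : Enumerates (freeSet (I.side f) n x) R g) : (I.gaps f).card = R := by
  rw [gaps_eq_pending hx h, pending, ← Finset.range_eq_Ico, Finset.card_image_of_injOn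
    fun p hp q hq hpq => h.injOn hp hq (by simpa using hpq), Finset.card_range]

/-- What the program knows while it slides sensors along the axis `g`, before it looks at sensor
number `e`: the gaps that remain are listed in `gl` from position `u` on, `D` counts the sensors
outside the free set on the lines that were occupied initially, and a sensor that has been
passed over without a move was alone on its line. -/
structure Sliding (I : IntConfig n) (M : Finset (Fin n)) (d g : Fin 2) (x gl keep : ℕ → ℕ) (R : ℕ)
    (Γ : Finset ℤ) (e u m : ℕ) (D : ℕ → ℕ) (io : Fin 2 → ℕ → ℕ) (s : State n) : Prop where
  reach : Reach I M d (kindAt (I.gaps d).card (I.gaps d.rev).card M.card) m s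
  pos : ∀ (k : Fin n) f, s.pos k f = I.lo f + (io f (k + 1) : ℤ)
  gaps : s.gaps I g = pending I g gl u R
  gaps_rev : s.gaps I g.rev = Γ
  deg_eq : ∀ i ∈ (Finset.Icc 1 n).image x, D i = deg n keep (io g) i
  todo : ∀ e', 1 ≤ e' → e ≤ e' → e' ≤ n → keep e' ≠ 0 → io g e' = x e'
  done : u < R → ∀ e', 1 ≤ e' → e' < e → keep e' ≠ 0 → io g e' = x e' → D (x e') ≤ 1

namespace Sliding

variable {I : IntConfig n} {M : Finset (Fin n)} {d g : Fin 2} {x gl keep : ℕ → ℕ} {R : ℕ}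
  {Γ : Finset ℤ} {e u m : ℕ} {D : ℕ → ℕ} {io : Fin 2 → ℕ → ℕ} {s : State n}

theorem skip (h : Sliding I M d g x gl keep R Γ e u m D io s)
    (he : u < R → keep e ≠ 0 → D (x e) ≤ 1) :
    Sliding I M d g x gl keep R Γ (e + 1) u m D io s := by
  refine { h with
    todo := fun e' h1 h2 => h.todo e' h1 (by omega)
    done := fun hu e' h1 h2 h3 h4 => ?_ }
  by_cases hee : e' = e
  · subst hee; exact he hu h3
  · exact h.done hu e' h1 (by omega) h3 h4

theorem move (hin : ∀ k d, I.pos k d ∈ I.lines d) (hM : Choice I M d)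
    (hMk : ∀ k : Fin n, k ∈ M ↔ keep (k + 1) = 0)
    (hE : Enumerates (freeSet (I.side g) n x) R gl)
    (hκ : ∀ (s : State n) k i, IsTypeOne s.pos Mᶜ g k → i ∈ s.gaps I g →
      Move I M d (kindAt (I.gaps d).card (I.gaps d.rev).card M.card m) s (s.slide k g i))
    (h : Sliding I M d g x gl keep R Γ e u m D io s) (h1 : 1 ≤ e) (hn : e ≤ n)
    (hke : keep e ≠ 0) (hu : u < R) (hD : 1 < D (x e)) :
    ∃ s', Sliding I M d g x gl keep R Γ (e + 1) (u + 1) (m + 1)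
      (Function.update D (x e) (D (x e) - 1))
      (Function.update io g (Function.update (io g) e (gl u))) s' := by
  have hio := h.todo e h1 le_rfl hn hke
  have hxe : x e ∈ (Finset.Icc 1 n).image x :=
    Finset.mem_image_of_mem x (Finset.mem_Icc.mpr ⟨h1, hn⟩)
  obtain ⟨k, hk⟩ : ∃ k : Fin n, (k : ℕ) + 1 = e := ⟨⟨e - 1, by omega⟩, by simp; omega⟩
  have hkM : k ∈ Mᶜ := by rw [Finset.mem_compl, hMk, hk]; exact hke
  have hdeg := h.deg_eq _ hxe
  obtain ⟨e', he', hne⟩ := Finset.exists_mem_ne (s := (Finset.Icc 1 n).filter fun e' =>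
    keep e' ≠ 0 ∧ io g e' = x e) (by rw [deg] at hdeg; omega) e
  simp only [Finset.mem_filter, Finset.mem_Icc] at he'
  obtain ⟨l, hl⟩ : ∃ l : Fin n, (l : ℕ) + 1 = e' := ⟨⟨e' - 1, by omega⟩, by simp; omega⟩
  obtain ⟨moved, hst⟩ := exists_stage_of_reach hin hM h.reach
  have hlM : l ∈ Mᶜ := by rw [Finset.mem_compl, hMk, hl]; exact he'.2.1
  have hlk : l ≠ k := by rintro rfl; omega
  have hsame : s.pos l g = s.pos k g := by rw [h.pos, h.pos, hl, hk, he'.2.2, hio]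
  have hT : IsTypeOne s.pos Mᶜ g k := by
    refine ⟨hkM, ⟨l, hlM, hlk, hsame⟩, ?_⟩
    obtain ⟨f, hf⟩ := hst.inv.star k hkM
    obtain rfl | rfl := Fin.eq_or_eq_rev_of_two g f
    · exact absurd hsame (hf l hlM hlk)
    · exact hf
  have hgap : I.lo g + (gl u : ℤ) ∈ s.gaps I g := by
    rw [h.gaps]
    exact mem_pending.mpr ⟨u, le_rfl, hu, rfl⟩
  have hfree : gl u ∉ (Finset.Icc 1 n).image x := (Finset.mem_filter.mp (hE.mem u hu)).2
  have hgaps := State.gaps_slide (I := I) hT (I.lo g + (gl u : ℤ))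
  refine ⟨s.slide k g (I.lo g + (gl u : ℤ)), ⟨reach_succ.mpr ⟨s, h.reach, hκ s k _ hT hgap⟩,
    fun l f => ?_, ?_, ?_, fun i hi => ?_, fun e'' h3 h4 h5 h6 => ?_,
    fun hu' e'' h3 h4 h5 h6 => ?_⟩⟩
  · by_cases hlk : l = k
    · subst hlk
      obtain rfl | rfl := Fin.eq_or_eq_rev_of_two g f
      · rw [State.slide_pos_self, Function.update_self, hk, Function.update_self]
      · rw [State.slide_pos_rev, Function.update_of_ne (Fin.rev_ne_self_of_two g), h.pos]
    · rw [State.slide_pos_of_ne _ _ _ hlk, h.pos]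
      by_cases hf : f = g
      · subst hf
        have : (l : ℕ) + 1 ≠ e := fun hc => hlk (Fin.ext (by omega))
        rw [Function.update_self, Function.update_of_ne this]
      · rw [Function.update_of_ne hf]
  · rw [hgaps.1, h.gaps, pending_erase hE hu]
  · rw [hgaps.2, h.gaps_rev]
  · rw [Function.update_self]
    have hgi : gl u ≠ i := fun hc => hfree (hc ▸ hi)
    have hset : ((Finset.Icc 1 n).filter fun e'' => keep e'' ≠ 0 ∧
        Function.update (io g) e (gl u) e'' = i) =
        ((Finset.Icc 1 n).filter fun e'' => keep e'' ≠ 0 ∧ io g e'' = i).erase e := by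
      ext e''
      by_cases hee : e'' = e
      · subst hee; simp [hgi]
      · simp [hee]
    rw [deg, hset]
    by_cases hix : i = x e
    · subst hix
      rw [Function.update_self, Finset.card_erase_of_mem, hdeg, deg]
      simp [h1, hn, hke, hio]
    · rw [Function.update_of_ne hix, Finset.erase_eq_of_notMem, h.deg_eq i hi, deg]
      simp [hio, Ne.symm hix]
  · rw [Function.update_self, Function.update_of_ne (by omega)]
    exact h.todo e'' h3 (by omega) h5 h6
  · rw [Function.update_self] at h6
    by_cases hee : e'' = e
    · subst hee
      rw [Function.update_self] at h6
      exact absurd (h6 ▸ hxe) hfree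
    · rw [Function.update_of_ne hee] at h6
      have := h.done hu e'' h3 (by omega) h5 h6
      by_cases hxx : x e'' = x e
      · rw [hxx] at this ⊢; rw [Function.update_self]; omega
      · rw [Function.update_of_ne hxx]; exact this

theorem finish (hin : ∀ k d, I.pos k d ∈ I.lines d) (hside : ∀ d, I.side d ≤ n)
    (hM : Choice I M d) (hMk : ∀ k : Fin n, k ∈ M ↔ keep (k + 1) = 0)
    (hx : ∀ k : Fin n, I.pos k g = I.lo g + (x (k + 1) : ℤ))
    (hg : g = d ∨ M.card < (I.gaps d.rev).card) (hm : M.card ≤ m)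
    (h : Sliding I M d g x gl keep R Γ (n + 1) u m D io s) : R ≤ u := by
  by_contra! hu
  obtain ⟨moved, hst⟩ := exists_stage_of_reach hin hM h.reach
  have hgA : g ∈ (if (I.gaps d.rev).card ≤ M.card then {d} else Set.univ : Set (Fin 2)) := by
    split_ifs with hc
    · exact hg.resolve_right (by omega)
    · trivial
  obtain ⟨k, hT⟩ := hst.inv.exists_isTypeOne hside (by rw [hst.card_unused]; omega) hgA
    ⟨I.lo g + (gl u : ℤ), by rw [h.gaps]; exact mem_pending.mpr ⟨u, le_rfl, hu, rfl⟩⟩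
  have hpos := h.pos k g
  rw [hst.inv.unmoved k (hst.inv.not_mem_moved_of_isTypeOne hT), hx] at hpos
  obtain ⟨hkM, ⟨l, hlM, hlk, hsame⟩, -⟩ := hT
  rw [Finset.mem_compl, hMk] at hkM hlM
  rw [h.pos, h.pos] at hsame
  have h1 := h.done hu (k + 1) (by omega) (by omega) hkM (by omega)
  have hmem : x ((k : ℕ) + 1) ∈ (Finset.Icc 1 n).image x :=
    Finset.mem_image_of_mem x (Finset.mem_Icc.mpr ⟨by omega, k.2⟩)
  rw [h.deg_eq _ hmem, deg, Finset.card_le_one] at h1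
  have := h1 (k + 1) (Finset.mem_filter.mpr ⟨Finset.mem_Icc.mpr ⟨by omega, k.2⟩, hkM, by omega⟩)
    (l + 1) (Finset.mem_filter.mpr ⟨Finset.mem_Icc.mpr ⟨by omega, l.2⟩, hlM, by omega⟩)
  exact hlk (Fin.ext (by omega))

end Sliding

/-- What the program knows while it moves the sensors of the free set, before it looks at sensor
number `e`. -/
structure Placing (I : IntConfig n) (M : Finset (Fin n)) (d : Fin 2) (X Y rg cg keep : ℕ → ℕ)
    (r c e u w : ℕ) (io : Fin 2 → ℕ → ℕ) (s : State n) : Prop where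
  reach : Reach I M d (kindAt (I.gaps d).card (I.gaps d.rev).card M.card) u s
  pos : ∀ (k : Fin n) f, s.pos k f = I.lo f + (io f (k + 1) : ℤ)
  le : u ≤ r
  le_card : u ≤ M.card
  eq_min : w = min u c
  row_gaps : s.gaps I d = pending I d rg u r
  col_gaps : s.gaps I d.rev = pending I d.rev cg w c
  unused : u < r → ∀ k : Fin n, k ∈ s.unused ↔ k ∈ M ∧ e ≤ k + 1
  row_keep : ∀ e', 1 ≤ e' → e' ≤ n → keep e' ≠ 0 → io d e' = X e'
  col_keep : ∀ e', 1 ≤ e' → e' ≤ n → keep e' ≠ 0 → io d.rev e' = Y e'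

namespace Placing

variable {I : IntConfig n} {M : Finset (Fin n)} {d : Fin 2} {X Y rg cg keep : ℕ → ℕ}
  {r c e u w : ℕ} {io : Fin 2 → ℕ → ℕ} {s : State n}

theorem skip (hMk : ∀ k : Fin n, k ∈ M ↔ keep (k + 1) = 0)
    (h : Placing I M d X Y rg cg keep r c e u w io s) (he : u < r → keep e ≠ 0) :
    Placing I M d X Y rg cg keep r c (e + 1) u w io s := by
  refine { h with unused := fun hu k => ?_ }
  rw [h.unused hu]
  refine and_congr_right fun hk => ⟨fun hle => ?_, fun hle => by omega⟩
  have : e ≠ k + 1 := by rintro rfl; exact he hu ((hMk k).mp hk)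
  omega

theorem move (hin : ∀ k d, I.pos k d ∈ I.lines d) (hM : Choice I M d)
    (hMk : ∀ k : Fin n, k ∈ M ↔ keep (k + 1) = 0) {S T : Finset ℕ}
    (hr : Enumerates S r rg) (hc : Enumerates T c cg) (hrc : (I.gaps d).card = r)
    (hcc : (I.gaps d.rev).card = c)
    (h : Placing I M d X Y rg cg keep r c e u w io s) (h1 : 1 ≤ e) (hn : e ≤ n)
    (hke : keep e = 0) (hu : u < r) :
    (w < c → ∃ s', Placing I M d X Y rg cg keep r c (e + 1) (u + 1) (w + 1)
      (Function.update (Function.update io d (Function.update (io d) e (rg u))) d.rev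
        (Function.update (io d.rev) e (cg w))) s') ∧
    (¬ w < c → ∃ s', Placing I M d X Y rg cg keep r c (e + 1) (u + 1) w
      (Function.update io d (Function.update (io d) e (rg u))) s') := by
  obtain ⟨k, hk⟩ : ∃ k : Fin n, (k : ℕ) + 1 = e := ⟨⟨e - 1, by omega⟩, by simp; omega⟩
  have hkM : k ∈ M := by rw [hMk, hk, hke]
  have hku : k ∈ s.unused := (h.unused hu k).mpr ⟨hkM, by omega⟩
  obtain ⟨moved, hst⟩ := exists_stage_of_reach hin hM h.reach
  have huM : u < M.card := by
    have h2 := hst.card_unused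
    have h3 := Finset.card_pos.mpr ⟨k, hku⟩
    omega
  have hle := h.eq_min
  have hdr := Fin.rev_ne_self_of_two d
  have hgd : I.lo d + (rg u : ℤ) ∈ s.gaps I d := by
    rw [h.row_gaps]; exact mem_pending.mpr ⟨u, le_rfl, hu, rfl⟩
  have hune : ∀ q, u + 1 < r → ∀ l : Fin n, l ∈ (s.place k q).unused ↔ l ∈ M ∧ e + 1 ≤ l + 1 := by
    intro q _ l
    rw [State.place, Finset.mem_erase, h.unused hu]
    constructor
    · rintro ⟨h2, h3, h4⟩
      have : (l : ℕ) ≠ k := fun hc => h2 (Fin.ext hc)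
      exact ⟨h3, by omega⟩
    · rintro ⟨h2, h3⟩
      exact ⟨by rintro rfl; omega, h2, by omega⟩
  have hek : ∀ e', keep e' ≠ 0 → e' ≠ e := by rintro e' h2 rfl; exact h2 hke
  have hupd : ∀ (l : Fin n), l ≠ k → (l : ℕ) + 1 ≠ e := fun l hl hc => hl (Fin.ext (by omega))
  have hwu : w + 1 = min (u + 1) c ∨ ¬ w < c := by omega
  constructor
  · intro hw
    have hwu : w = u := by omega
    have hgc : I.lo d.rev + (cg w : ℤ) ∈ s.gaps I d.rev := by
      rw [h.col_gaps]; exact mem_pending.mpr ⟨w, le_rfl, hw, rfl⟩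
    -- the crossing of the next row gap with the next column gap
    obtain ⟨q, hq1, hq2⟩ : ∃ q : Fin 2 → ℤ, q d = I.lo d + (rg u : ℤ) ∧
        q d.rev = I.lo d.rev + (cg w : ℤ) :=
      ⟨Function.update (fun _ => I.lo d.rev + (cg w : ℤ)) d (I.lo d + (rg u : ℤ)), by simp,
        by simp [hdr]⟩
    have hmove : Move I M d (kindAt (I.gaps d).card (I.gaps d.rev).card M.card u) s
        (s.place k q) := by
      rw [kindAt]
      split_ifs with h2 h3 h4
      · refine .jumpFirst s k q hku ?_ (by rw [hq2]; exact hgc)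
        rw [h.row_gaps, hq1]
        exact isLeast_pending hr hu
      all_goals first | omega | skip
      refine .jump s k q hku fun f => ?_
      obtain rfl | rfl := Fin.eq_or_eq_rev_of_two d f
      · rw [hq1]; exact hgd
      · rw [hq2]; exact hgc
    refine ⟨s.place k q, reach_succ.mpr ⟨s, h.reach, hmove⟩, fun l f => ?_, hu, huM, by omega, ?_,
      ?_, hune q, fun e' h2 h3 h4 => ?_, fun e' h2 h3 h4 => ?_⟩
    · by_cases hlk : l = k
      · subst hlk
        rw [State.place_pos_self, hk]
        obtain rfl | rfl := Fin.eq_or_eq_rev_of_two d f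
        · rw [hq1, Function.update_of_ne hdr.symm, Function.update_self, Function.update_self]
        · rw [hq2, Function.update_self, Function.update_self]
      · rw [State.place_pos_of_ne _ _ hlk, h.pos]
        obtain rfl | rfl := Fin.eq_or_eq_rev_of_two d f
        · rw [Function.update_of_ne hdr.symm, Function.update_self,
            Function.update_of_ne (hupd l hlk)]
        · rw [Function.update_self, Function.update_of_ne (hupd l hlk)]
    · rw [hst.inv.gaps_place hku, hq1, h.row_gaps, pending_erase hr hu]
    · rw [hst.inv.gaps_place hku, hq2, h.col_gaps, pending_erase hc hw]
    · rw [Function.update_of_ne hdr.symm, Function.update_self, Function.update_of_ne (hek e' h4)]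
      exact h.row_keep e' h2 h3 h4
    · rw [Function.update_self, Function.update_of_ne (hek e' h4)]
      exact h.col_keep e' h2 h3 h4
  · intro hw
    have hmove : Move I M d (kindAt (I.gaps d).card (I.gaps d.rev).card M.card u) s
        (s.slide k d (I.lo d + (rg u : ℤ))) := by
      rw [kindAt]
      split_ifs with h2 h3 h4
      all_goals first | omega | skip
      · exact .freeSlide s k _ hku hgd
      · refine .freeMove s k _ hku (by rw [Function.update_self]; exact hgd) ?_
        rw [Function.update_of_ne hdr]
        exact hst.inv.mem_lines k d.rev
    refine ⟨s.slide k d (I.lo d + (rg u : ℤ)), reach_succ.mpr ⟨s, h.reach, hmove⟩, fun l f => ?_,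
      hu, huM, by omega, ?_, ?_, hune _, fun e' h2 h3 h4 => ?_, fun e' h2 h3 h4 => ?_⟩
    · by_cases hlk : l = k
      · subst hlk
        obtain rfl | rfl := Fin.eq_or_eq_rev_of_two d f
        · rw [State.slide_pos_self, Function.update_self, hk, Function.update_self]
        · rw [State.slide_pos_rev, Function.update_of_ne hdr, h.pos]
      · rw [State.slide_pos_of_ne _ _ _ hlk, h.pos]
        obtain rfl | rfl := Fin.eq_or_eq_rev_of_two d f
        · rw [Function.update_self, Function.update_of_ne (hupd l hlk)]
        · rw [Function.update_of_ne hdr]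
    · rw [State.slide, hst.inv.gaps_place hku, Function.update_self, h.row_gaps,
        pending_erase hr hu]
    · rw [State.slide, State.gaps_place_of_eq (Function.update_of_ne hdr _ _), h.col_gaps]
    · rw [Function.update_self, Function.update_of_ne (hek e' h4)]
      exact h.row_keep e' h2 h3 h4
    · rw [Function.update_of_ne hdr]
      exact h.col_keep e' h2 h3 h4

end Placing

end AlgorithmOne


/-! ### The program that moves the sensors -/

namespace Imp

open Matching AlgorithmOne

/-- Move the sensors that are not kept into the gaps along `d`, and also into gaps along the other
axis as long as there are any. -/
def placeFree (d : Fin 2) : Cmd :=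
  .set .u (.lit 0) ;; .set .w (.lit 0) ;;
  .for .e (.lit 1) (.add Var.n (.lit 1))
    (.ite (.get .keep Var.e) (.lit 1)
      (.ite Var.u Var.r
        (.out d Var.e (.get .rg Var.u) ;; .set .u (.add Var.u (.lit 1)) ;;
          .ite Var.w Var.c
            (.out d.rev Var.e (.get .cg Var.w) ;; .set .w (.add Var.w (.lit 1))) .skip)
        .skip)
      .skip)

/-- Slide kept sensors with company along `g` into the gaps that are listed in `G` from position
`y` on. -/
def slideKept (g : Fin 2) (y z : Var) (F D G : Fld) : Cmd :=
  .for .e (.lit 1) (.add Var.n (.lit 1))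
    (.ite (.lit 0) (.get .keep Var.e)
      (.ite y z
        (.ite (.lit 1) (.get D (.get F Var.e))
          (.put D (.get F Var.e) (.sub (.get D (.get F Var.e)) (.lit 1)) ;;
            .out g Var.e (.get G y) ;; .set y (.add y (.lit 1)))
          .skip)
        .skip)
      .skip)

/-- All moves, if the axis `d` has at least as many gaps as the other one. -/
def moveAll (d : Fin 2) : Cmd :=
  placeFree d ;; slideKept d .u .r .X .dr .rg ;; slideKept d.rev .w .c .Y .dc .cg

variable {n : ℕ}

/-- One pass over the edges is enough: the number of kept sensors in a line that has edges never
grows, so a sensor that was alone in its line when its turn came stays alone. -/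
theorem slideKept_spec {I : IntConfig n} (hin : ∀ k d, I.pos k d ∈ I.lines d)
    (hside : ∀ d, I.side d ≤ n) {M : Finset (Fin n)} {d g : Fin 2} (hM : Choice I M d)
    {y z : Var} {F D G : Fld}
    (hyz : g = d ∧ y = .u ∧ z = .r ∧ F = .X ∧ D = .dr ∧ G = .rg ∨
      g = d.rev ∧ y = .w ∧ z = .c ∧ F = .Y ∧ D = .dc ∧ G = .cg)
    {s : Store} (hn : s.v .n = n) (hs : s.size = n)
    (hMk : ∀ k : Fin n, k ∈ M ↔ s.f .keep (k + 1) = 0)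
    (hx : ∀ k : Fin n, I.pos k g = I.lo g + (s.f F (k + 1) : ℤ))
    (hE : Enumerates (freeSet (I.side g) n (s.f F)) (s.v z) (s.f G)) (hle : s.v y ≤ s.v z)
    (hg : s.v y < s.v z → g = d ∨ M.card < (I.gaps d.rev).card) {m : ℕ}
    (hm : s.v y < s.v z → M.card ≤ m)
    (hκ : ∀ p, s.v y ≤ p → p < s.v z → ∀ (t : AlgorithmOne.State n) k i,
      IsTypeOne t.pos Mᶜ g k → i ∈ t.gaps I g →
      Move I M d (kindAt (I.gaps d).card (I.gaps d.rev).card M.card (m + (p - s.v y))) t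
        (t.slide k g i))
    {t : AlgorithmOne.State n} (ht : Sliding I M d g (s.f F) (s.f G) (s.f .keep) (s.v z)
      (t.gaps I g.rev) 1 (s.v y) m (s.f D) s.io t) :
    wp (slideKept g y z F D G) (fun s' => s'.v y = s.v z ∧ ∃ t',
      Reach I M d (kindAt (I.gaps d).card (I.gaps d.rev).card M.card) (m + (s.v z - s.v y)) t' ∧
      (∀ (k : Fin n) f, t'.pos k f = I.lo f + (s'.io f (k + 1) : ℤ)) ∧
      t'.gaps I g.rev = t.gaps I g.rev ∧ s'.clock ≤ s.clock + 200 * (n + 1)) s := by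
  have hye : y ≠ .e := by rcases hyz with h | h <;> rw [h.2.1] <;> decide
  have hyn : y ≠ .n := by rcases hyz with h | h <;> rw [h.2.1] <;> decide
  have hyz' : y ≠ z := by rcases hyz with h | h <;> rw [h.2.1, h.2.2.1] <;> decide
  have hze : z ≠ .e := by rcases hyz with h | h <;> rw [h.2.2.1] <;> decide
  have hDF : D ≠ F := by rcases hyz with h | h <;> rw [h.2.2.2.2.1, h.2.2.2.1] <;> decide
  have hDG : D ≠ G := by rcases hyz with h | h <;> rw [h.2.2.2.2.1, h.2.2.2.2.2] <;> decide
  have hDk : D ≠ .keep := by rcases hyz with h | h <;> rw [h.2.2.2.2.1] <;> decide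
  refine wp_for (fun k s' => s.v y ≤ s'.v y ∧ s'.v y ≤ s.v z ∧ ∃ t',
      Sliding I M d g (s.f F) (s.f G) (s.f .keep) (s.v z) (t.gaps I g.rev) k (s'.v y)
        (m + (s'.v y - s.v y)) (s'.f D) s'.io t') 1 (n + 1) 120 rfl (by omega)
    (by simp [Cmd.modV, hye]) (fun s' hfr => ?_) (fun _ _ _ h => h) ⟨?_, ?_, t, ?_⟩ ?_ ?_
  · simp [Expr.eval, hfr.v .n (by simp [Cmd.for, Cmd.modV, hyn]), hn]
  · simp [Store.set, hye]
  · simp [Store.set, hye, hle]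
  · simpa [Store.set, hye] using ht
  · intro k s' hk1 hk2 hfr hke ⟨h1, h2, t', hS⟩
    have hF : s'.f F = s.f F := hfr.f F (by simp [Cmd.for, Cmd.modF, hDF])
    have hG : s'.f G = s.f G := hfr.f G (by simp [Cmd.for, Cmd.modF, hDG])
    have hkeep : s'.f .keep = s.f .keep := hfr.f .keep (by simp [Cmd.for, Cmd.modF, hDk])
    have hz : s'.v z = s.v z := hfr.v z (by simp [Cmd.for, Cmd.modV, hze.symm, hyz'])
    have hsz := hfr.size
    simp only [wp_ite, wp_seq, wp_put, wp_set, wp_out, wp_skip, Expr.eval, Expr.cost, Store.set,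
      Store.put, Store.out, Store.tick, hke, hF, hkeep, hz, Function.update_of_ne hDG.symm, hG,
      Function.update_of_ne hye, Function.update_self]
    refine ⟨fun h3 => ⟨fun h4 => ⟨fun h5 => ⟨by omega, ⟨by omega, by omega, ?_⟩, by omega⟩,
      fun h5 => ⟨⟨h1, h2, t', hS.skip fun _ _ => by omega⟩, by omega⟩⟩,
      fun h4 => ⟨⟨h1, h2, t', hS.skip fun _ => by omega⟩, by omega⟩⟩,
      fun h3 => ⟨⟨h1, h2, t', hS.skip fun _ => by omega⟩, by omega⟩⟩
    rw [show m + (s'.v y + 1 - s.v y) = m + (s'.v y - s.v y) + 1 by omega]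
    exact hS.move hin hM hMk hE (hκ _ h1 h4) hk1 (by omega) (by omega) h4 h5
  · intro s' hfr ⟨h1, h2, t', hS⟩ hc
    simp only [Expr.cost] at hc
    have hy : s'.v y = s.v z := by
      by_contra hne
      have hlt : s'.v y < s.v z := by omega
      have := hS.finish hin hside hM hMk hx (hg (by omega)) (by have := hm (by omega); omega)
      omega
    exact ⟨hy, t', by rw [← hy]; exact hS.reach, hS.pos, hS.gaps_rev, by omega⟩

theorem placeFree_spec {I : IntConfig n} (hin : ∀ k d, I.pos k d ∈ I.lines d)
    {M : Finset (Fin n)} {d : Fin 2} (hM : Choice I M d)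
    {s : Store} (hn : s.v .n = n) (hs : s.size = n)
    (hMk : ∀ k : Fin n, k ∈ M ↔ s.f .keep (k + 1) = 0)
    (hpos : ∀ (k : Fin n) f, I.pos k f = I.lo f + (s.io f (k + 1) : ℤ))
    (hX : ∀ e, 1 ≤ e → e ≤ n → s.f .X e = s.io d e)
    (hY : ∀ e, 1 ≤ e → e ≤ n → s.f .Y e = s.io d.rev e)
    (hr : Enumerates (freeSet (I.side d) n (s.f .X)) (s.v .r) (s.f .rg))
    (hc : Enumerates (freeSet (I.side d.rev) n (s.f .Y)) (s.v .c) (s.f .cg))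
    (hrg : I.gaps d = pending I d (s.f .rg) 0 (s.v .r))
    (hcg : I.gaps d.rev = pending I d.rev (s.f .cg) 0 (s.v .c))
    (hrc : (I.gaps d).card = s.v .r) (hcc : (I.gaps d.rev).card = s.v .c) :
    wp (placeFree d) (fun s' => ∃ t, Placing I M d (s.f .X) (s.f .Y) (s.f .rg) (s.f .cg)
      (s.f .keep) (s.v .r) (s.v .c) (n + 1) (s'.v .u) (s'.v .w) s'.io t ∧
      s'.clock ≤ s.clock + 200 * (n + 1)) s := by
  have hdr := Fin.rev_ne_self_of_two d
  simp only [placeFree, wp_seq, wp_set, Expr.eval, Expr.cost, Store.set]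
  refine wp_for (fun k s' => ∃ t, Placing I M d (s.f .X) (s.f .Y) (s.f .rg) (s.f .cg)
      (s.f .keep) (s.v .r) (s.v .c) k (s'.v .u) (s'.v .w) s'.io t) 1 (n + 1) 120 rfl (by omega)
    rfl (fun s' hfr => ?_) (fun _ _ _ h => h) ⟨AlgorithmOne.start I M, ?_⟩ ?_ ?_
  · simp [Expr.eval, hfr.v .n rfl, hn]
  · simp only [Store.set, ne_eq, reduceCtorEq, not_false_eq_true, Function.update_of_ne,
      Function.update_self]
    refine ⟨reach_zero.mpr rfl, hpos, by omega, by omega, by omega, hrg, hcg, fun _ k => ?_,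
      fun e h1 h2 _ => (hX e h1 h2).symm, fun e h1 h2 _ => (hY e h1 h2).symm⟩
    simp [AlgorithmOne.start]
  · intro k s' hk1 hk2 hfr hke ⟨t, hP⟩
    have hrg' : s'.f .rg = s.f .rg := hfr.f .rg rfl
    have hcg' : s'.f .cg = s.f .cg := hfr.f .cg rfl
    have hkeep : s'.f .keep = s.f .keep := hfr.f .keep rfl
    have hr' : s'.v .r = s.v .r := by rw [hfr.v .r rfl]; simp
    have hc' : s'.v .c = s.v .c := by rw [hfr.v .c rfl]; simp
    have hsz : s'.size = s.size := hfr.size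
    simp only [wp_ite, wp_seq, wp_set, wp_out, wp_skip, Expr.eval, Expr.cost, Store.set,
      Store.out, Store.tick, hke, hrg', hcg', hkeep, hr', hc', Function.update_self, ne_eq,
      reduceCtorEq, not_false_eq_true, Function.update_of_ne, hdr]
    refine ⟨fun h1 => ⟨fun h2 => ?_, fun h2 => ⟨⟨t, hP.skip hMk fun _ => by omega⟩, by omega⟩⟩,
      fun h1 => ⟨⟨t, hP.skip hMk fun _ => by omega⟩, by omega⟩⟩
    obtain ⟨hm1, hm2⟩ := hP.move hin hM hMk hr hc hrc hcc hk1 (by omega) (by omega) h2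
    exact ⟨by omega, fun h3 => ⟨by omega, hm1 h3, by omega⟩, fun h3 => ⟨hm2 h3, by omega⟩⟩
  · intro s' hfr ⟨t, hP⟩ hc
    simp only [Expr.cost] at hc
    exact ⟨t, hP, by omega⟩

/-- The program makes one of the possible runs of the algorithm, in linear time. -/
theorem moveAll_spec {I : IntConfig n} (hin : ∀ k d, I.pos k d ∈ I.lines d)
    (hside : ∀ d, I.side d ≤ n) {M : Finset (Fin n)} {d : Fin 2} (hM : Choice I M d)
    {s : Store} (hn : s.v .n = n) (hs : s.size = n)
    (hMk : ∀ k : Fin n, k ∈ M ↔ s.f .keep (k + 1) = 0)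
    (hpos : ∀ (k : Fin n) f, I.pos k f = I.lo f + (s.io f (k + 1) : ℤ))
    (hX : ∀ e, 1 ≤ e → e ≤ n → s.f .X e = s.io d e)
    (hY : ∀ e, 1 ≤ e → e ≤ n → s.f .Y e = s.io d.rev e)
    (hr : Enumerates (freeSet (I.side d) n (s.f .X)) (s.v .r) (s.f .rg))
    (hc : Enumerates (freeSet (I.side d.rev) n (s.f .Y)) (s.v .c) (s.f .cg))
    (hdr : s.f .dr = deg n (s.f .keep) (s.f .X)) (hdc : s.f .dc = deg n (s.f .keep) (s.f .Y)) :
    wp (moveAll d) (fun s' => (∃ t, Run I M d (plan I M d) (start I M) t ∧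
      ∀ (k : Fin n) f, t.pos k f = I.lo f + (s'.io f (k + 1) : ℤ)) ∧
      s'.clock ≤ s.clock + 600 * (n + 1)) s := by
  have hxd : ∀ k : Fin n, I.pos k d = I.lo d + (s.f .X (k + 1) : ℤ) := fun k => by
    rw [hpos, hX _ (by omega) k.2]
  have hyd : ∀ k : Fin n, I.pos k d.rev = I.lo d.rev + (s.f .Y (k + 1) : ℤ) := fun k => by
    rw [hpos, hY _ (by omega) k.2]
  have hrg := gaps_eq_pending hxd hr
  have hcg := gaps_eq_pending hyd hc
  have hrc : (I.gaps d).card = s.v .r := card_gaps_eq hxd hr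
  have hcc : (I.gaps d.rev).card = s.v .c := card_gaps_eq hyd hc
  have hle := hM.2
  rw [moveAll, wp_seq]
  refine wp_of_wp (placeFree_spec hin hM hn hs hMk hpos hX hY hr hc hrg hcg hrc hcc)
    fun s₁ hfr₁ h => ?_
  obtain ⟨t₁, hP, hc₁⟩ := h
  obtain ⟨moved, hst⟩ := exists_stage_of_reach hin hM hP.reach
  have hMu : s₁.v .u < s.v .r → M.card ≤ s₁.v .u := by
    intro hu
    have h1 : t₁.unused = ∅ := by
      ext k
      rw [hP.unused hu]
      simp only [Finset.notMem_empty, iff_false, not_and]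
      intro _
      omega
    have h2 := hst.card_unused
    rw [h1, Finset.card_empty] at h2
    omega
  have hfX : s₁.f .X = s.f .X := hfr₁.f .X rfl
  have hfY : s₁.f .Y = s.f .Y := hfr₁.f .Y rfl
  have hfrg : s₁.f .rg = s.f .rg := hfr₁.f .rg rfl
  have hfcg : s₁.f .cg = s.f .cg := hfr₁.f .cg rfl
  have hfk : s₁.f .keep = s.f .keep := hfr₁.f .keep rfl
  have hfdr : s₁.f .dr = s.f .dr := hfr₁.f .dr rfl
  have hfdc : s₁.f .dc = s.f .dc := hfr₁.f .dc rfl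
  have hvr : s₁.v .r = s.v .r := hfr₁.v .r rfl
  have hvc : s₁.v .c = s.v .c := hfr₁.v .c rfl
  have hvn : s₁.v .n = s.v .n := hfr₁.v .n rfl
  have hsz₁ := hfr₁.size
  have hdeg : ∀ (x z : ℕ → ℕ), (∀ e, 1 ≤ e → e ≤ n → s.f .keep e ≠ 0 → x e = z e) →
      deg n (s.f .keep) z = deg n (s.f .keep) x := by
    intro x z h
    funext i
    rw [deg, deg]
    congr 1
    refine Finset.filter_congr fun e he => and_congr_right fun hk => ?_
    have he := Finset.mem_Icc.mp he
    rw [h e he.1 he.2 hk]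
  have hmin := hP.eq_min
  have hule := hP.le
  have hucard := hP.le_card
  rw [wp_seq]
  refine wp_of_wp (slideKept_spec (I := I) (M := M) (d := d) (g := d) (m := s₁.v .u) (t := t₁) hin
    hside hM (Or.inl ⟨rfl, rfl, rfl, rfl, rfl, rfl⟩) (by omega) (by omega) ?_ ?_ ?_ ?_ ?_ ?_ ?_ ?_)
    fun s₂ hfr₂ h => ?_
  · rw [hfk]; exact hMk
  · rw [hfX]; exact hxd
  · rw [hfX, hvr, hfrg]; exact hr
  · omega
  · exact fun _ => Or.inl rfl
  · rw [hvr]; exact hMu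
  · intro p hp1 hp2 t k i hT hi
    have hMu := hMu (by omega)
    rw [Nat.add_sub_cancel' hp1, kindAt]
    split_ifs
    all_goals first | omega | skip
    · exact .slideMajor t k i hT hi
    · exact .slideAny t k d i hT hi
  · rw [hfX, hfrg, hfk, hvr, hfdr]
    refine ⟨hP.reach, hP.pos, hP.row_gaps, rfl, fun i _ => ?_,
      fun e h1 _ h2 h3 => hP.row_keep e h1 h2 h3, fun _ e h1 h2 => by omega⟩
    rw [hdr, hdeg _ _ hP.row_keep]
  obtain ⟨hu₂, t₂, hreach₂, hpos₂, hgaps₂, hc₂⟩ := h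
  have hgX : s₂.f .Y = s₁.f .Y := hfr₂.f .Y rfl
  have hgcg : s₂.f .cg = s₁.f .cg := hfr₂.f .cg rfl
  have hgk : s₂.f .keep = s₁.f .keep := hfr₂.f .keep rfl
  have hgdc : s₂.f .dc = s₁.f .dc := hfr₂.f .dc rfl
  have hwc : s₂.v .c = s₁.v .c := hfr₂.v .c rfl
  have hww : s₂.v .w = s₁.v .w := hfr₂.v .w rfl
  have hwn : s₂.v .n = s₁.v .n := hfr₂.v .n rfl
  have hsz₂ := hfr₂.size
  have hio₂ : s₂.io d.rev = s₁.io d.rev := hfr₂.io d.rev (by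
    simp [slideKept, Cmd.for, Cmd.modPos, Ne.symm (Fin.rev_ne_self_of_two d)])
  rw [hvr] at hreach₂
  rw [show s₁.v .u + (s.v .r - s₁.v .u) = s.v .r by omega] at hreach₂
  have hlt : s₁.v .w < s.v .c → M.card < s.v .c ∧ s₁.v .w = M.card := by
    intro h
    by_cases hu : s₁.v .u < s.v .r
    · have := hMu hu
      omega
    · omega
  refine wp_of_wp (slideKept_spec (I := I) (M := M) (d := d) (g := d.rev) (m := s.v .r) (t := t₂)
    hin hside hM (Or.inr ⟨rfl, rfl, rfl, rfl, rfl, rfl⟩) (by omega) (by omega) ?_ ?_ ?_ ?_ ?_ ?_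
    ?_ ?_) fun s₃ hfr₃ h => ?_
  · rw [hgk, hfk]; exact hMk
  · rw [hgX, hfY]; exact hyd
  · rw [hgX, hfY, hwc, hvc, hgcg, hfcg]; exact hc
  · omega
  · intro h
    have := hlt (by omega)
    right
    omega
  · intro h
    have := hlt (by omega)
    omega
  · intro p hp1 hp2 t k i hT hi
    have := hlt (by omega)
    rw [kindAt]
    split_ifs
    all_goals first | omega | skip
    exact .slideAny t k d.rev i hT hi
  · rw [hgX, hfY, hgcg, hfcg, hgk, hfk, hwc, hvc, hgdc, hfdc, hww]
    refine ⟨hreach₂, hpos₂, ?_, rfl, fun i _ => ?_, fun e h1 _ h2 h3 => ?_,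
      fun _ e h1 h2 => by omega⟩
    · rw [hgaps₂, hP.col_gaps]
    · rw [hdc, hio₂, hdeg _ _ hP.col_keep]
    · rw [hio₂]; exact hP.col_keep e h1 h2 h3
  obtain ⟨hw₃, t₃, hreach₃, hpos₃, -, hc₃⟩ := h
  refine ⟨⟨t₃, (run_plan_iff hM).mpr ?_, hpos₃⟩, by omega⟩
  convert hreach₃ using 1
  rw [planLength]
  split_ifs
  · have : ¬ s₁.v .w < s.v .c := fun h => by have := hlt h; omega
    omega
  · have : s₁.v .w < s.v .c := by omega
    have := hlt this
    omega

end Imp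


/-! ### The whole program -/

namespace AlgorithmOne

open Matching Imp

variable {n : ℕ}

/-- The edges outside a minimum edge cover form a maximum free set. -/
theorem isMaxFreeSet_of_cover {I : IntConfig n} (hin : ∀ k d, I.pos k d ∈ I.lines d)
    {M : Finset (Fin n)} {x : Fin 2 → ℕ → ℕ} {keep : ℕ → ℕ}
    (hMk : ∀ k : Fin n, k ∈ M ↔ keep (k + 1) = 0)
    (hx : ∀ (k : Fin n) f, I.pos k f = I.lo f + (x f (k + 1) : ℤ))
    (hcov : ∀ f e, 1 ≤ e → e ≤ n → deg n keep (x f) (x f e) ≠ 0)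
    (hmin : ∀ F ⊆ Finset.Icc 1 n, (∀ f, ∀ e ∈ Finset.Icc 1 n, ∃ e' ∈ F, x f e' = x f e) →
      (kept n keep).card ≤ F.card) : I.IsMaxFreeSet M := by
  -- sensors are numbered from `1` in the program
  let num : Fin n ↪ ℕ := ⟨fun k => k + 1, fun k l h => Fin.ext (Nat.succ_injective h)⟩
  have hval : ∀ k, num k = k + 1 := fun _ => rfl
  have hnum : ∀ e, 1 ≤ e → e ≤ n → ∃ k, num k = e := fun e h1 h2 =>
    ⟨⟨e - 1, by omega⟩, by rw [hval]; simp only; omega⟩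
  have hmem : ∀ k, num k ∈ Finset.Icc 1 n := fun k => by
    rw [hval, Finset.mem_Icc]; exact ⟨by omega, k.2⟩
  have hkept : kept n keep = Mᶜ.map num := by
    ext e
    simp only [kept, Finset.mem_filter, Finset.mem_map, Finset.mem_compl]
    constructor
    · rintro ⟨h1, h2⟩
      obtain ⟨k, rfl⟩ := hnum e (Finset.mem_Icc.mp h1).1 (Finset.mem_Icc.mp h1).2
      exact ⟨k, fun hk => h2 ((hMk k).mp hk), rfl⟩
    · rintro ⟨k, hk, rfl⟩
      exact ⟨hmem k, fun h => hk ((hMk k).mpr h)⟩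
  refine ⟨(IntConfig.isFreeSet_iff hin).mpr fun k f => ?_, fun M' hM' => ?_⟩
  · obtain ⟨e, he, hek⟩ := Finset.mem_image.mp (deg_ne_zero.mp (hcov f (k + 1) (by omega) k.2))
    rw [hkept] at he
    obtain ⟨l, hl, rfl⟩ := Finset.mem_map.mp he
    exact ⟨l, hl, by rw [hx, hx, ← hval, hek]⟩
  · have hle := hmin (M'ᶜ.map num) (fun e he => by
      obtain ⟨k, -, rfl⟩ := Finset.mem_map.mp he
      exact hmem k) fun f e he => by
        obtain ⟨k, rfl⟩ := hnum e (Finset.mem_Icc.mp he).1 (Finset.mem_Icc.mp he).2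
        obtain ⟨l, hl, hlk⟩ := (IntConfig.isFreeSet_iff hin).mp hM' k f
        rw [hx, hx] at hlk
        exact ⟨num l, Finset.mem_map_of_mem num hl, by rw [hval, hval]; omega⟩
    rw [hkept, Finset.card_map, Finset.card_map, Finset.card_compl, Finset.card_compl,
      Fintype.card_fin] at hle
    have := Finset.card_le_univ M'
    rw [Fintype.card_fin] at this
    omega

end AlgorithmOne

namespace Imp

open Matching AlgorithmOne

/-- Choose the axis and find a maximum matching. -/
def matchEdges : Cmd := chooseAxis ;; buildLists ;; findSqrt ;; auction ;; augmentAll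

theorem matchEdges_spec {s : Store} {n : ℕ} {side : Fin 2 → ℕ} (hn : s.v .n = n) (hs : s.size = n)
    (hn1 : 1 ≤ n) (hside : ∀ d, side d ≤ n) (ha : s.v .a = side 0) (hb : s.v .b = side 1)
    (hf : s.f = fun _ _ => 0) (hlt : ∀ d e, 1 ≤ e → e ≤ n → s.io d e < side d) :
    wp matchEdges (fun s' => ∃ (d : Fin 2) (L : ℕ), s'.v .sw = d ∧ s'.v .a = side d ∧
      s'.v .b = side d.rev ∧
      (∀ e, 1 ≤ e → e ≤ n → s'.f .X e = s.io d e) ∧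
      (∀ e, 1 ≤ e → e ≤ n → s'.f .Y e = s.io d.rev e) ∧
      (freeSet (side d.rev) n (s.io d.rev)).card ≤ (freeSet (side d) n (s.io d)).card ∧
      Graph n (side d) (side d.rev) (s'.f .X) (s'.f .Y) ∧
      IsMate n (side d) (side d.rev) (s'.f .X) (s'.f .Y) (s'.f .mr) (s'.f .mc) ∧
      Certified n (side d) (s'.f .X) (s'.f .Y) (s'.f .mr) ∧
      1 ≤ L ∧ (L - 1) * (L - 1) < n ∧ s'.clock ≤ s.clock + 20000 * (n * L)) s := by
  rw [matchEdges, wp_seq]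
  have hs0 := hside 0
  have hs1 := hside 1
  refine wp_of_wp (chooseAxis_spec (by omega) ha hb fun i => by rw [hf]) fun s₁ hfr₁ h => ?_
  obtain ⟨d, hsw, ha₁, hb₁, hX, hY, hgaps, hc₁⟩ := h
  rw [hn] at hX hY hgaps
  have hsd := hside d
  have hG : Graph n (side d) (side d.rev) (s₁.f .X) (s₁.f .Y) :=
    ⟨fun e h1 h2 => by rw [hX e h1 h2]; exact hlt d e h1 h2,
      fun e h1 h2 => by rw [hY e h1 h2]; exact hlt d.rev e h1 h2⟩
  have hn₁ : s₁.v .n = n := (hfr₁.v .n rfl).trans hn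
  rw [wp_seq]
  refine wp_of_wp (buildLists_spec fun i => ?_) fun s₂ hfr₂ ⟨hl, hc₂⟩ => ?_
  · rw [hfr₁.f .head rfl, hf]
  rw [hn₁] at hl
  have hn₂ : s₂.v .n = n := (hfr₂.v .n rfl).trans hn₁
  rw [wp_seq]
  refine wp_of_wp (findSqrt_spec (by omega)) fun s₃ hfr₃ ⟨hL1, hnL, hLn, hc₃⟩ => ?_
  rw [hn₂] at hnL hLn
  have hX₃ : s₃.f .X = s₁.f .X := (hfr₃.f .X rfl).trans (hfr₂.f .X rfl)
  have hY₃ : s₃.f .Y = s₁.f .Y := (hfr₃.f .Y rfl).trans (hfr₂.f .Y rfl)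
  have hnx₃ : s₃.f .nxt = s₂.f .nxt := hfr₃.f .nxt rfl
  have hhd₃ : s₃.f .head = s₂.f .head := hfr₃.f .head rfl
  have ha₃ : s₃.v .a = side d := (hfr₃.v .a rfl).trans ((hfr₂.v .a rfl).trans ha₁)
  have hz : ∀ F, chooseAxis.modF F = false → buildLists.modF F = false →
      findSqrt.modF F = false → s₃.f F = fun _ => 0 := fun F h1 h2 h3 => by
    rw [hfr₃.f F h3, hfr₂.f F h2, hfr₁.f F h1, hf]
  rw [wp_seq]
  refine wp_of_wp (auction_spec hX₃ hY₃ hnx₃ hhd₃ ha₃ rfl hG (hl _) hL1 (hz .mr rfl rfl rfl)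
    (hz .mc rfl rfl rfl) (hz .pr rfl rfl rfl) (hz .lv rfl rfl rfl))
    fun s₄ hfr₄ ⟨hm₄, happ, hc₄⟩ => ?_
  have hX₄ : s₄.f .X = s₁.f .X := (hfr₄.f .X rfl).trans hX₃
  have hY₄ : s₄.f .Y = s₁.f .Y := (hfr₄.f .Y rfl).trans hY₃
  have hvis : s₄.f .vis = fun _ => 0 := (hfr₄.f .vis rfl).trans (hz .vis rfl rfl rfl)
  refine wp_of_wp (augmentAll_spec hX₄ hY₄ ((hfr₄.f .nxt rfl).trans hnx₃)
    ((hfr₄.f .head rfl).trans hhd₃) ((hfr₄.v .a rfl).trans ha₃) hG (hl _) hm₄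
    (fun j _ => by rw [hvis]; exact Nat.zero_le _) hL1 (by omega) happ)
    fun s₅ hfr₅ ⟨hm₅, hcert, hc₅⟩ => ?_
  have hX₅ : s₅.f .X = s₁.f .X := (hfr₅.f .X rfl).trans hX₄
  have hY₅ : s₅.f .Y = s₁.f .Y := (hfr₅.f .Y rfl).trans hY₄
  refine ⟨d, s₃.v .L, ?_, ?_, ?_, ?_, ?_, hgaps, ?_, ?_, ?_, hL1, hLn, ?_⟩
  · rw [hfr₅.v .sw rfl, hfr₄.v .sw rfl, hfr₃.v .sw rfl, hfr₂.v .sw rfl, hsw]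
  · rw [hfr₅.v .a rfl, hfr₄.v .a rfl, ha₃]
  · rw [hfr₅.v .b rfl, hfr₄.v .b rfl, hfr₃.v .b rfl, hfr₂.v .b rfl, hb₁]
  · rw [hX₅]; exact hX
  · rw [hY₅]; exact hY
  · rw [hX₅, hY₅]; exact hG
  · rw [hX₅, hY₅]; exact hm₅
  · rw [hX₅, hY₅]; exact hcert
  · have h1 : n ≤ n * s₃.v .L := Nat.le_mul_of_pos_right n hL1
    have h2 : s₃.v .L ≤ n * s₃.v .L := Nat.le_mul_of_pos_left _ hn1
    have h3 : s₃.v .L * (n + side d) ≤ 2 * (n * s₃.v .L) := by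
      have := Nat.mul_le_mul_left (s₃.v .L) hsd
      rw [mul_add, mul_comm n]
      omega
    have h4 : (s₃.v .L + 2) * (n + side d + 1) ≤ 9 * (n * s₃.v .L) := by
      rw [show (s₃.v .L + 2) * (n + side d + 1) =
        s₃.v .L * (n + side d) + s₃.v .L + 2 * (n + side d + 1) by ring]
      omega
    generalize s₃.v .L * (n + side d) = p at h3 hc₄
    generalize (s₃.v .L + 2) * (n + side d + 1) = q at h4 hc₅
    rw [hn] at hc₁
    rw [hn₁] at hc₂
    rw [hn₂] at hc₃
    linarith

/-- The program for the whole algorithm. -/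
def algorithm : Cmd :=
  matchEdges ;; coverEdges ;; listGaps .a .r .dr .rg ;; listGaps .b .c .dc .cg ;;
  .ite (.lit 0) Var.sw (moveAll 1) (moveAll 0)

theorem freeSet_eq {n m : ℕ} {keep x : ℕ → ℕ} (h : ∀ e, 1 ≤ e → e ≤ n → deg n keep x (x e) ≠ 0) :
    freeSet m n x = (Finset.range m).filter fun i => deg n keep x i = 0 := by
  refine Finset.filter_congr fun i _ => ?_
  rw [← not_iff_not, not_not, ← ne_eq, deg_ne_zero]
  constructor
  · intro hi
    obtain ⟨e, he, rfl⟩ := Finset.mem_image.mp hi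
    exact deg_ne_zero.mp (h e (Finset.mem_Icc.mp he).1 (Finset.mem_Icc.mp he).2)
  · exact fun hi => Finset.image_subset_image (Finset.filter_subset _ _) hi

theorem freeSet_congr {n m : ℕ} {x z : ℕ → ℕ} (h : ∀ e, 1 ≤ e → e ≤ n → x e = z e) :
    freeSet m n x = freeSet m n z := by
  rw [freeSet, freeSet, Finset.image_congr fun e he => ?_]
  have he := Finset.mem_Icc.mp (Finset.mem_coe.mp he)
  exact h e he.1 he.2

theorem algorithm_spec {n : ℕ} {I : IntConfig n} (hin : ∀ k d, I.pos k d ∈ I.lines d)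
    (hside : ∀ d, I.side d ≤ n) {s : Store} (hn : s.v .n = n) (hs : s.size = n)
    (ha : s.v .a = I.side 0) (hb : s.v .b = I.side 1) (hf : s.f = fun _ _ => 0)
    (hpos : ∀ (k : Fin n) f, I.pos k f = I.lo f + (s.io f (k + 1) : ℤ)) :
    wp algorithm (fun s' => IsOutput I (fun k f => I.lo f + (s'.io f (k + 1) : ℤ)) ∧
      ∃ L, 1 ≤ L ∧ (L - 1) * (L - 1) < n ∧ s'.clock ≤ s.clock + 25000 * (n * L)) s := by
  have hn1 : 1 ≤ n := (I.side_pos 0).trans_le (hside 0)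
  rw [algorithm, wp_seq]
  refine wp_of_wp (matchEdges_spec hn hs hn1 hside ha hb hf fun d e h1 h2 => ?_) fun s₁ hfr₁ h => ?_
  · have h3 := hpos ⟨e - 1, by omega⟩ d
    have h4 := IntConfig.mem_lines.mp (hin ⟨e - 1, by omega⟩ d)
    simp only [show e - 1 + 1 = e by omega] at h3
    omega
  obtain ⟨d, L, hsw, ha₁, hb₁, hX, hY, hgaps, hG, hm, hcert, hL1, hLn, hc₁⟩ := h
  have hn₁ : s₁.v .n = n := (hfr₁.v .n rfl).trans hn
  have hz : ∀ F, matchEdges.modF F = false → s₁.f F = fun _ => 0 := fun F h => by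
    rw [hfr₁.f F h, hf]
  rw [wp_seq]
  refine wp_of_wp (coverEdges_spec rfl rfl hn₁ hG hm (hz .keep rfl) (hz .dr rfl) (hz .dc rfl))
    fun s₂ hfr₂ ⟨hC, hcov, hc₂⟩ => ?_
  rw [wp_seq]
  refine wp_of_wp (listGaps_spec (by decide) (by decide) (by decide) (by decide))
    fun s₃ hfr₃ ⟨hr, hc₃⟩ => ?_
  rw [wp_seq]
  refine wp_of_wp (listGaps_spec (by decide) (by decide) (by decide) (by decide))
    fun s₄ hfr₄ ⟨hc, hc₄⟩ => ?_
  have ha₂ : s₂.v .a = I.side d := (hfr₂.v .a rfl).trans ha₁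
  have hb₃ : s₃.v .b = I.side d.rev := (hfr₃.v .b rfl).trans ((hfr₂.v .b rfl).trans hb₁)
  have hX₄ : s₄.f .X = s₁.f .X := by rw [hfr₄.f .X rfl, hfr₃.f .X rfl, hfr₂.f .X rfl]
  have hY₄ : s₄.f .Y = s₁.f .Y := by rw [hfr₄.f .Y rfl, hfr₃.f .Y rfl, hfr₂.f .Y rfl]
  have hk₄ : s₄.f .keep = s₂.f .keep := by rw [hfr₄.f .keep rfl, hfr₃.f .keep rfl]
  have hdr₄ : s₄.f .dr = s₂.f .dr := by rw [hfr₄.f .dr rfl, hfr₃.f .dr rfl]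
  have hdc₃ : s₃.f .dc = s₂.f .dc := hfr₃.f .dc rfl
  have hdc₄ : s₄.f .dc = s₂.f .dc := (hfr₄.f .dc rfl).trans hdc₃
  have hio₄ : s₄.io = s.io := funext fun f => by
    rw [hfr₄.io f rfl, hfr₃.io f rfl, hfr₂.io f rfl, hfr₁.io f rfl]
  have hn₄ : s₄.v .n = n := by rw [hfr₄.v .n rfl, hfr₃.v .n rfl, hfr₂.v .n rfl, hn₁]
  have hsw₄ : s₄.v .sw = d := by rw [hfr₄.v .sw rfl, hfr₃.v .sw rfl, hfr₂.v .sw rfl, hsw]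
  have hs₄ : s₄.size = n := by rw [hfr₄.size, hfr₃.size, hfr₂.size, hfr₁.size, hs]
  have hcovr : ∀ e, 1 ≤ e → e ≤ n → deg n (s₂.f .keep) (s₁.f .X) (s₁.f .X e) ≠ 0 :=
    fun e h1 h2 => by rw [← hC.row_deg]; exact (hcov e h1 h2).1
  have hcovc : ∀ e, 1 ≤ e → e ≤ n → deg n (s₂.f .keep) (s₁.f .Y) (s₁.f .Y e) ≠ 0 :=
    fun e h1 h2 => by rw [← hC.col_deg]; exact (hcov e h1 h2).2
  have hrE : Enumerates (freeSet (I.side d) n (s₄.f .X)) (s₄.v .r) (s₄.f .rg) := by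
    rw [ha₂, hC.row_deg] at hr
    rwa [hX₄, freeSet_eq hcovr, hfr₄.v .r rfl, hfr₄.f .rg rfl]
  have hcE : Enumerates (freeSet (I.side d.rev) n (s₄.f .Y)) (s₄.v .c) (s₄.f .cg) := by
    rw [hb₃, hdc₃, hC.col_deg] at hc
    rwa [hY₄, freeSet_eq hcovc]
  have hxd : ∀ k : Fin n, I.pos k d = I.lo d + (s₄.f .X (k + 1) : ℤ) := fun k => by
    rw [hpos, hX₄, hX _ (by omega) k.2]
  have hyd : ∀ k : Fin n, I.pos k d.rev = I.lo d.rev + (s₄.f .Y (k + 1) : ℤ) := fun k => by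
    rw [hpos, hY₄, hY _ (by omega) k.2]
  have hMk : ∀ k : Fin n, k ∈ Finset.univ.filter (fun k : Fin n => s₂.f .keep (k + 1) = 0) ↔
      s₂.f .keep (k + 1) = 0 := fun k => by simp
  generalize (Finset.univ.filter fun k : Fin n => s₂.f .keep (k + 1) = 0) = M at hMk
  have hM : Choice I M d := by
    refine ⟨isMaxFreeSet_of_cover hin (x := s.io) hMk hpos ?_ ?_, ?_⟩
    · have key : ∀ f (x : ℕ → ℕ), (∀ e, 1 ≤ e → e ≤ n → x e = s.io f e) →
          (∀ e, 1 ≤ e → e ≤ n → deg n (s₂.f .keep) x (x e) ≠ 0) →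
          ∀ e, 1 ≤ e → e ≤ n → deg n (s₂.f .keep) (s.io f) (s.io f e) ≠ 0 := by
        intro f x hx hdeg e h1 h2
        obtain ⟨e', he', hee⟩ := Finset.mem_image.mp (deg_ne_zero.mp (hdeg e h1 h2))
        have h3 := Finset.mem_Icc.mp (Finset.mem_filter.mp he').1
        rw [hx e h1 h2, hx e' h3.1 h3.2] at hee
        exact deg_ne_zero.mpr (Finset.mem_image.mpr ⟨e', he', hee⟩)
      intro f
      obtain rfl | rfl := Fin.eq_or_eq_rev_of_two d f
      · exact key _ _ hX hcovr
      · exact key _ _ hY hcovc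
    · intro F hF hcovF
      have key : ∀ f (x : ℕ → ℕ), (∀ e, 1 ≤ e → e ≤ n → x e = s.io f e) →
          ∀ e ∈ Finset.Icc 1 n, ∃ e' ∈ F, x e' = x e := by
        intro f x hx e he
        obtain ⟨e', he', hee⟩ := hcovF f e he
        have h3 := Finset.mem_Icc.mp (hF he')
        have h4 := Finset.mem_Icc.mp he
        exact ⟨e', he', by rw [hx e' h3.1 h3.2, hx e h4.1 h4.2, hee]⟩
      exact hC.card_kept_le hcert hF (key _ _ hX) (key _ _ hY)
    · rw [card_gaps_eq hxd hrE, card_gaps_eq hyd hcE, ← hrE.card_eq, ← hcE.card_eq, hX₄, hY₄,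
        freeSet_congr hX, freeSet_congr hY]
      exact hgaps
  have hmove := fun t => moveAll_spec (s := s₄.tick t) hin hside hM hn₄ hs₄
    (fun k => by rw [hMk]; exact Iff.of_eq (by rw [← hk₄]; rfl))
    (fun k f => by rw [hpos, ← hio₄]; rfl)
    (fun e h1 h2 => by rw [← hio₄, ← hX₄] at hX; exact hX e h1 h2)
    (fun e h1 h2 => by rw [← hio₄, ← hY₄] at hY; exact hY e h1 h2) hrE hcE
    (by rw [← hX₄, ← hk₄, ← hdr₄] at hC; exact hC.row_deg)
    (by have := hC.col_deg; rw [← hY₄, ← hk₄, ← hdc₄] at this; exact this)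
  have hfin : ∀ (s' : Store) t, t ≤ 5 → ((∃ t', Run I M d (plan I M d) (start I M) t' ∧
      ∀ (k : Fin n) f, t'.pos k f = I.lo f + (s'.io f (k + 1) : ℤ)) ∧
      s'.clock ≤ (s₄.tick t).clock + 600 * (n + 1)) →
      IsOutput I (fun k f => I.lo f + (s'.io f (k + 1) : ℤ)) ∧
      ∃ L, 1 ≤ L ∧ (L - 1) * (L - 1) < n ∧ s'.clock ≤ s.clock + 25000 * (n * L) := by
    rintro s' t ht ⟨⟨t', hrun, hp⟩, hc'⟩
    refine ⟨⟨M, d, t', hM, hrun, funext fun k => funext fun f => hp k f⟩, L, hL1, hLn, ?_⟩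
    have h1 : n ≤ n * L := Nat.le_mul_of_pos_right n hL1
    have h2 := hside d
    have h3 := hside d.rev
    rw [ha₂] at hc₃
    rw [hb₃] at hc₄
    simp only [Store.tick] at hc'
    linarith
  rw [wp_ite]
  have hd : d = 0 ∨ d = 1 := by omega
  refine ⟨fun h => ?_, fun h => ?_⟩
  · obtain rfl : d = 1 := by
      rcases hd with rfl | rfl
      · simp [Expr.eval, hsw₄] at h
      · rfl
    exact wp_mono (hmove _) fun s' h => hfin s' _ (by simp [Expr.cost]) h
  · obtain rfl : d = 0 := by
      rcases hd with rfl | rfl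
      · rfl
      · simp [Expr.eval, hsw₄] at h
    exact wp_mono (hmove _) fun s' h => hfin s' _ (by simp [Expr.cost]) h

/-! ### The machine program -/

open RAM (Program Exec)

/-- Read the size of the input and the sides of the rectangle, and compute the address where the
arrays begin. -/
def prologue : Program :=
  .seq (.load Var.n.reg 0) <| .seq (.const 0 2) <| .seq (.load Var.a.reg 0) <|
  .seq (.const 0 4) <| .seq (.load Var.b.reg 0) <| .seq (.const 0 5) <|
  .seq (.add 1 Var.n.reg Var.n.reg) (.add 1 1 0)

/-- The store that describes an input. -/
def initial {n : ℕ} (I : IntConfig n) : Store where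
  v := Function.update (Function.update (Function.update (fun _ => 0) .n n) .a (I.side 0)) .b
    (I.side 1)
  f _ _ := 0
  io d e := if h : e - 1 < n then (I.pos ⟨e - 1, h⟩ d - I.lo d).toNat else 0
  size := n
  clock := 0

/-- The address `5 + 2 * n`, where the arrays begin, is the first one after the input. -/
theorem exec_prologue {n : ℕ} {I : IntConfig n} (hin : ∀ k d, I.pos k d ∈ I.lines d) :
    ∃ σ, Exec prologue (RAM.input I) σ 8 ∧ Rep I (initial I) σ := by
  refine ⟨_, .seq (.load _ _ 0 _ rfl) (.seq (.const ..) (.seq (.load _ _ 2 _ rfl) (.seq (.const ..)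
    (.seq (.load _ _ 4 _ rfl) (.seq (.const ..) (.seq (.add ..) (.add ..))))))), ?_⟩
  constructor
  · rfl
  · intro x
    cases x <;> rfl
  · change (n : ℤ) + n + 5 = _
    push_cast
    ring
  · intro F i
    have h1 : 5 + 2 * n + 32 * i + F.ctorIdx = 2 * n + 32 * i + F.ctorIdx + 5 := by ring
    have h2 : ¬ (2 * n + 32 * i + F.ctorIdx) / 2 < n := by omega
    simp only [RAM.State.setReg, RAM.input, h1, initial]
    rw [dif_neg h2]
    rfl
  · intro d
    have hd : d = 0 ∨ d = 1 := by omega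
    rcases hd with rfl | rfl <;> rfl
  · intro d e h1 h2
    have h3 : 3 + 2 * e + (d : ℕ) = 2 * (e - 1) + d + 5 := by omega
    have h4 : (2 * (e - 1) + (d : ℕ)) / 2 = e - 1 := by omega
    have h5 : (if (2 * (e - 1) + (d : ℕ)) % 2 = 0 then (0 : Fin 2) else 1) = d := by
      have hd : d = 0 ∨ d = 1 := by omega
      rcases hd with rfl | rfl <;> simp
    have h6 : e - 1 < n := by omega
    have h7 := IntConfig.mem_lines.mp (hin ⟨e - 1, h6⟩ d)
    simp only [RAM.State.setReg, RAM.input, h3, h4, h5, initial]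
    rw [dif_pos h6, dif_pos h6]
    omega

/-- After the prologue the program runs for at most `25000 * n * L` steps, where `L ≤ 1 + √n` is the
number of levels of the auction. -/
theorem exists_program : ∃ (P : Program) (C : ℝ), ∀ (n : ℕ) (I : IntConfig n),
    I.toConfiguration.Admissible → ∃ (σ : RAM.State) (t : ℕ), Exec P (RAM.input I) σ t ∧
      (t : ℝ) ≤ C * (n : ℝ) ^ (3 / 2 : ℝ) ∧ IsOutput I (RAM.output n σ) := by
  refine ⟨.seq prologue algorithm.compile, 50008, fun n I hadm => ?_⟩
  have hin := IntConfig.pos_mem_lines_of_admissible hadm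
  have hside := IntConfig.side_le_of_admissible hadm
  have hn1 : 1 ≤ n := (I.side_pos 0).trans_le (hside 0)
  obtain ⟨σ₀, hex₀, hrep₀⟩ := exec_prologue hin
  obtain ⟨σ, s', t, hex, hrep, ht, hout, L, hL1, hLn, hclock⟩ :=
    exec_of_wp (algorithm_spec (s := initial I) hin hside (by simp [initial]) rfl
      (by simp [initial]) (by simp [initial]) rfl fun k f => by
        have := IntConfig.mem_lines.mp (hin k f)
        simp only [initial, Nat.add_sub_cancel, k.2, dite_true, Fin.eta]
        omega) hrep₀
  refine ⟨σ, 8 + t, .seq hex₀ hex, ?_, ?_⟩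
  · have hn0 : (0 : ℝ) ≤ n := n.cast_nonneg
    have hpow : (n : ℝ) ^ (3 / 2 : ℝ) = n * √n := by
      rw [show (3 / 2 : ℝ) = 1 + 1 / 2 by norm_num, Real.rpow_add (by exact_mod_cast hn1),
        Real.rpow_one, Real.sqrt_eq_rpow]
    have hsq1 : 1 ≤ √(n : ℝ) := Real.one_le_sqrt.mpr (by exact_mod_cast hn1)
    have hL : (L : ℝ) ≤ 2 * √n := by
      have h1 : ((L - 1 : ℕ) : ℝ) ≤ √n := by
        refine Real.le_sqrt_of_sq_le ?_
        rw [sq]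
        exact_mod_cast hLn.le
      rw [Nat.cast_sub hL1, Nat.cast_one] at h1
      linarith
    have h1 : (t : ℝ) ≤ 25000 * (n * L) := by
      have : t ≤ 25000 * (n * L) := by
        simp only [initial] at ht hclock
        omega
      exact_mod_cast this
    have h2 : (n : ℝ) * L ≤ n * (2 * √n) := mul_le_mul_of_nonneg_left hL hn0
    have h3 : (1 : ℝ) ≤ n * √n := by
      have : (1 : ℝ) ≤ n := by exact_mod_cast hn1
      nlinarith
    rw [hpow]
    push_cast
    linarith
  · convert hout using 1
    funext k f
    rw [← hrep.io f (k + 1) (by omega) k.2, RAM.output, RAM.cell]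
    congr 1
    ring

end Imp

/-- Algorithm 1 never gets stuck, every run of it produces an optimal solution of MinNum-WCR whose
number of moved sensors is `max r c` or `r + c - k`, and a random access machine carries it out
in time `O(n^{3/2})`. -/
theorem mainTheorem4 :
    (∀ (n : ℕ) (I : IntConfig n), I.toConfiguration.Admissible →
      ∀ (M : Finset (Fin n)) (d : Fin 2), AlgorithmOne.Choice I M d →
        (∀ (l₁ l₂ : List AlgorithmOne.MoveKind) (a : AlgorithmOne.MoveKind)
            (s : AlgorithmOne.State n),
          AlgorithmOne.plan I M d = l₁ ++ a :: l₂ →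
          AlgorithmOne.Run I M d l₁ (AlgorithmOne.start I M) s →
          ∃ s', AlgorithmOne.Move I M d a s s') ∧
        (∀ s : AlgorithmOne.State n,
          AlgorithmOne.Run I M d (AlgorithmOne.plan I M d) (AlgorithmOne.start I M) s →
          (∀ k, gridPoint (s.pos k) ∈ I.toConfiguration.rect.carrier) ∧
          I.toConfiguration.SolvesMinNum (fun k => gridPoint (s.pos k)) ∧
          I.toConfiguration.numMoved (fun k => gridPoint (s.pos k)) =
            if min (I.gaps 0).card (I.gaps 1).card ≤ M.card then
              max (I.gaps 0).card (I.gaps 1).card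
            else (I.gaps 0).card + (I.gaps 1).card - M.card)) ∧
    (∃ (P : RAM.Program) (C : ℝ), ∀ (n : ℕ) (I : IntConfig n), I.toConfiguration.Admissible →
      ∃ (σ : RAM.State) (t : ℕ), RAM.Exec P (RAM.input I) σ t ∧
        (t : ℝ) ≤ C * (n : ℝ) ^ (3 / 2 : ℝ) ∧
        AlgorithmOne.IsOutput I (RAM.output n σ)) := by
  refine ⟨fun n I hadm M d hM => ?_, Imp.exists_program⟩
  have hin := IntConfig.pos_mem_lines_of_admissible hadm
  have hside := IntConfig.side_le_of_admissible hadm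
  exact ⟨fun _ _ _ _ hplan hrun => AlgorithmOne.exists_move_of_run hin hside hM hplan hrun,
    fun _ hrun => AlgorithmOne.solves_of_run hin hM hrun⟩
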